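/- **Setting.** Let $\mathcal S,\mathcal A$ be measurable spaces, $\mathcal P(\cdot|s,a)$ a transition kernel, $\rho$ an initial distribution, $\gamma\in(0,1)$, and $\phi:\mathcal S\to\mathbb R^d$ a measurable feature map with $\|\phi(s)\|_2\le1$. Policies $\pi_\theta(\cdot|s)$, $\theta\in\mathbb R^m$, have strictly positive densities $\pi_\theta(a|s)$ with respect to a fixed $\sigma$-finite measure $\mathrm da$. The reward parameter $\varphi$ ranges over a convex set $\Omega(\varphi)\subseteq\mathbb R^k$ and determines a reward $r_\varphi$ and a factor $\alpha_\varphi\ge0$; the regularized reward is $\tilde r_{\varphi,\theta}(s,a)=r_\varphi(s,a)-\alpha_\varphi\log\pi_\theta(a|s)$ (all functions jointly measurable). Let $\widetilde V^{\pi_\theta}_\varphi(s)=\sum_{t\ge0}\gamma^t\,\mathbb E[\tilde r_{\varphi,\theta}(s_t,a_t)\mid s_0=s]$ under $\pi_\theta$ and $\mathcal P$, $J_\varphi(\theta)=\mathbb E_{s\sim\rho}\widetilde V^{\pi_\theta}_\varphi(s)$, $\nu_\theta=(1-\gamma)\sum_{t\ge0}\gamma^t\Pr(s_t\in\cdot\mid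 s_0\sim\rho,\pi_\theta)$, and, with $s\sim\nu_\theta$, $a\sim\pi_\theta(\cdot|s)$, $s'\sim\mathcal P(\cdot|s,a)$, $$A_\theta=\mathbb E[\phi(s)(\phi(s)-\gamma\phi(s'))^\top],\quad b_{\varphi,\theta}=\mathbb E[\tilde r_{\varphi,\theta}(s,a)\phi(s)],\quad \omega^*(\varphi,\theta)=A_\theta^{-1}b_{\varphi,\theta},$$ $$\epsilon=\sup_{\theta,\varphi}\Big(\mathbb E_{s\sim\nu_\theta}\big(\phi(s)^\top\omega^*(\varphi,\theta)-\widetilde V^{\pi_\theta}_\varphi(s)\big)^2\Big)^{1/2}.$$ **Assumptions,** with constants $\lambda,L,S,C,D>0$, for all $\theta\in\mathbb R^m$, $\varphi\in\Omega(\varphi)$, $s$, $a$: 1. $x^\top A_\theta x\ge\lambda\|x\|_2^2$ for all $x\in\mathbb R^d$. 2. $\log\pi_\theta(a|s)$ is twice differentiable in $\theta$, $\|\nabla_\theta\log\pi_\theta(a|s)\|_2\le L$ and $\|\nabla^2_\theta\log\pi_\theta(a|s)\|_2\le S$. 3. With $g_{\varphi,\theta}(s)=\mathbb E_{a\sim\pi_\theta(\cdot|s)}[\tilde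 r_{\varphi,\theta}(s,a)]$: $|g_{\varphi,\theta}(s)|\le C$, $\mathbb E_{a\sim\pi_\theta(\cdot|s)}[\tilde r_{\varphi,\theta}(s,a)^2]\le C^2$, $\|\nabla_\theta g_{\varphi,\theta}(s)\|_2\le CL$, $\|\nabla_\theta^2 g_{\varphi,\theta}(s)\|_2\le C(L^2+S)$, $\|\nabla_\varphi g_{\varphi,\theta}(s)\|_2\le D$ (the derivatives exist). **Algorithm.** Start with $s_0\sim\rho$ and arbitrary $\theta_0,\omega_0,\varphi_0$. For $t=0,1,\dots$, given the past, sample $a_t\sim\pi_{\theta_t}(\cdot|s_t)$, $s'_t\sim\mathcal P(\cdot|s_t,a_t)$ and $s_{t+1}\sim\gamma\mathcal P(\cdot|s_t,a_t)+(1-\gamma)\rho$ (the last two independently given $s_t,a_t$), let $\hat\delta_t=\tilde r_{\varphi_t,\theta_t}(s_t,a_t)+(\gamma\phi(s'_t)-\phi(s_t))^\top\omega_t$, and put $$\theta_{t+1}=\theta_t+\eta^\theta_t\hat\delta_t\nabla_\theta\log\pi_{\theta_t}(a_t|s_t),\quad \omega_{t+1}=\mathrm{Proj}_{C_\omega}\big(\omega_t+\eta^\omega_t\hat\delta_t\phi(s_t)\big),\quad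 \varphi_{t+1}=\varphi_t+\eta^\varphi_th_\varphi(t)\in\Omega(\varphi),$$ where $\mathrm{Proj}_{C_\omega}$ is the projection onto the ball of radius $C_\omega$, $C_\omega$ is a bound for $\|\omega^*(\varphi,\theta)\|_2$ over all $\varphi,\theta$, and $h_\varphi(t)$ is any random vector, depending only on what has been observed when $a_{t+1}$ is sampled, with $\mathbb E\|h_\varphi(t)\|_2^2\le C_\varphi^2$. For $t\ge1$ the step sizes are $\eta^\theta_t=c_\theta/\sqrt t$, $\eta^\omega_t=c_\omega/\sqrt t$, $\eta^\varphi_t=c_\varphi/t$; the step sizes at $t=0$ are arbitrary. **Errors.** For $T\ge2$ (for odd $T$ the lower summation limit is $\lfloor T/2\rfloor$) let $$G_T=\tfrac1{T/2}\sum_{t=T/2}^{T-1}\mathbb E\|\nabla_\theta J_{\varphi_t}(\theta_t)\|_2^2,\quad W_T=\tfrac1{T/2}\sum_{t=T/2}^{T-1}\mathbb E\|\omega_t-\omega^*(\varphi_t,\theta_t)\|_2^2,\quad F_T=\tfrac1{T/2}\sum_{t=T/2}^{T-1}\mathbb E\|\varphi_{t+1}-\varphi_t\|_2^2.$$ **Claim.**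 There are constants $L_\omega,S_\omega>0$, depending only on $\gamma,\lambda,L,S,C,D$, such that in every such problem each map $\omega^*(\varphi,\cdot)$, $\varphi\in\Omega(\varphi)$, is bounded by $C/\lambda$, is $L_\omega$-Lipschitz and has an $S_\omega$-Lipschitz derivative, and such that the following holds. Let $c_\theta,c_\omega>0$ and $c_\varphi,C_\varphi,C_\omega\ge0$ with $$\frac{c_\theta}{c_\omega}\le\min\Big\{\frac{\lambda}{LS_\omega},\frac1{16LL_\omega}\Big\}.$$ Then there is a constant $K$, depending only on $\gamma,\lambda,L,S,C,D,c_\theta,c_\omega,c_\varphi,C_\varphi,C_\omega$ (not on the decision process, the dimensions, $h_\varphi$ or $T$), such that each $J_\varphi$ is differentiable, all the expectations in $G_T,W_T,F_T$ are finite, and for all $T\ge2$ $$F_T\le\frac KT,\qquad G_T\le\frac K{\sqrt T}+K\epsilon,\qquad W_T\le\frac K{\sqrt T}+K\epsilon .$$ -/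

import Mathlib

open MeasureTheory ProbabilityTheory
open scoped ENNReal RealInnerProductSpace

universe u v z

noncomputable section

/-- The Euclidean space `ℝⁿ` with its `2`-norm. -/
abbrev Euc (n : ℕ) : Type := EuclideanSpace ℝ (Fin n)

/-- A discounted Markov decision process with state space `St` and action space `Ac`, together with
a family of policies with parameter `θ ∈ ℝᵐ`, a family of entropy-regularised rewards with
parameter `φ ∈ rewardSet ⊆ ℝᵏ`, and a feature map with values in `ℝᵈ`. -/
structure ParamMDP (St Ac : Type*) [MeasurableSpace St] [MeasurableSpace Ac] (m k d : ℕ) where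
  /-- discount factor -/
  γ : ℝ
  γ_pos : 0 < γ
  γ_lt_one : γ < 1
  /-- transition kernel -/
  P : Kernel (St × Ac) St
  markov_P : IsMarkovKernel P
  /-- initial distribution -/
  ρ : Measure St
  prob_ρ : IsProbabilityMeasure ρ
  /-- reference measure `da` on the actions (for instance Lebesgue or counting measure) -/
  base : Measure Ac
  sigmaFinite_base : SigmaFinite base
  /-- policy density `π_θ(a|s)` with respect to `da` -/
  pol : Euc m → St → Ac → ℝ
  pol_meas : Measurable fun x : (Euc m × St) × Ac => pol x.1.1 x.1.2 x.2
  pol_pos : ∀ θ s a, 0 < pol θ s a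
  pol_lintegral : ∀ θ s, ∫⁻ a, ENNReal.ofReal (pol θ s a) ∂base = 1
  /-- the set `Ω(φ)` of reward parameters -/
  rewardSet : Set (Euc k)
  convex_rewardSet : Convex ℝ rewardSet
  /-- base reward `r_φ(s,a)` -/
  r : Euc k → St → Ac → ℝ
  r_meas : Measurable fun x : Euc k × St × Ac => r x.1 x.2.1 x.2.2
  /-- regularisation factor `α_φ` -/
  α : Euc k → ℝ
  α_meas : Measurable α
  α_nonneg : ∀ φ ∈ rewardSet, 0 ≤ α φ
  /-- feature map -/
  feat : St → Euc d
  feat_meas : Measurable feat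
  norm_feat_le : ∀ s, ‖feat s‖ ≤ 1

namespace ParamMDP

variable {St Ac : Type*} [MeasurableSpace St] [MeasurableSpace Ac] {m k d : ℕ}

attribute [instance] ParamMDP.markov_P ParamMDP.prob_ρ ParamMDP.sigmaFinite_base

/-- The policy as a kernel: `M.policy (θ, s)` is the law `π_θ(·|s)` on actions. -/
def policy (M : ParamMDP St Ac m k d) : Kernel (Euc m × St) Ac :=
  Kernel.withDensity (Kernel.const (Euc m × St) M.base)
    (fun x a => ENNReal.ofReal (M.pol x.1 x.2 a))

theorem policy_apply (M : ParamMDP St Ac m k d) (x : Euc m × St) :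
    M.policy x = M.base.withDensity (fun a => ENNReal.ofReal (M.pol x.1 x.2 a)) := by
  unfold policy
  rw [Kernel.withDensity_apply _ (by exact M.pol_meas.ennreal_ofReal)]
  rfl

instance instMarkovPolicy (M : ParamMDP St Ac m k d) : IsMarkovKernel M.policy := by
  refine ⟨fun x => ⟨?_⟩⟩
  rw [policy_apply, withDensity_apply _ MeasurableSet.univ, Measure.restrict_univ]
  exact M.pol_lintegral x.1 x.2

/-- The sampling kernel `P̂(·|s,a) = γ P(·|s,a) + (1 - γ) ρ`. -/
def Phat (M : ParamMDP St Ac m k d) : Kernel (St × Ac) St where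
  toFun x := ENNReal.ofReal M.γ • M.P x + ENNReal.ofReal (1 - M.γ) • M.ρ
  measurable' := by
    refine Measure.measurable_of_measurable_coe _ fun U hU => ?_
    simp only [Measure.coe_add, Measure.coe_smul, Pi.add_apply, Pi.smul_apply, smul_eq_mul]
    exact ((Kernel.measurable_coe M.P hU).const_mul _).add_const _

instance instMarkovPhat (M : ParamMDP St Ac m k d) : IsMarkovKernel M.Phat := by
  refine ⟨fun x => ⟨?_⟩⟩
  change (ENNReal.ofReal M.γ • M.P x + ENNReal.ofReal (1 - M.γ) • M.ρ) Set.univ = 1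
  simp only [Measure.coe_add, Measure.coe_smul, Pi.add_apply, Pi.smul_apply, smul_eq_mul,
    measure_univ, mul_one]
  rw [← ENNReal.ofReal_add M.γ_pos.le (by linarith [M.γ_lt_one])]
  simp

/-- One sampling step: given `(θ, s)`, the joint law of `(a, s', s'')` where `a ∼ π_θ(·|s)` and,
given `a`, independently `s' ∼ P(·|s,a)` and `s'' ∼ P̂(·|s,a)`. -/
def sampleStep (M : ParamMDP St Ac m k d) : Kernel (Euc m × St) (Ac × St × St) :=
  M.policy ⊗ₖ ((M.P ×ₖ M.Phat).comap
    (fun x : (Euc m × St) × Ac => (x.1.2, x.2)) (by fun_prop))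

/-- The state-to-state transition kernel under the policy `π_θ`. -/
def stateKernel (M : ParamMDP St Ac m k d) (θ : Euc m) : Kernel St St :=
  ((M.policy.comap (fun s : St => (θ, s)) (by fun_prop)) ⊗ₖ M.P).snd

/-- The law of `s_t` under the policy `π_θ` when `s_0 = s`. -/
def stateLaw (M : ParamMDP St Ac m k d) (θ : Euc m) (t : ℕ) (s : St) : Measure St :=
  (M.stateKernel θ ^ t) s

/-- The discounted visitation distribution
`ν_θ = (1 - γ) ∑ₜ γᵗ Pr(s_t ∈ · | s_0 ∼ ρ, π_θ)`. -/
def visit (M : ParamMDP St Ac m k d) (θ : Euc m) : Measure St :=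
  Measure.sum fun t : ℕ =>
    ENNReal.ofReal ((1 - M.γ) * M.γ ^ t) • M.ρ.bind (M.stateKernel θ ^ t)

/-- The regularised reward `r̃_{φ,θ}(s,a) = r_φ(s,a) - α_φ log π_θ(a|s)`. -/
def regReward (M : ParamMDP St Ac m k d) (φ : Euc k) (θ : Euc m) (s : St) (a : Ac) : ℝ :=
  M.r φ s a - M.α φ * Real.log (M.pol θ s a)

/-- The expected regularised reward `E_{a ∼ π_θ(·|s)} r̃_{φ,θ}(s,a)`. -/
def expReward (M : ParamMDP St Ac m k d) (φ : Euc k) (θ : Euc m) (s : St) : ℝ :=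
  ∫ a, M.regReward φ θ s a ∂(M.policy (θ, s))

/-- The regularised value function `Ṽ_φ^{π_θ}(s) = ∑ₜ γᵗ E[r̃_{φ,θ}(s_t,a_t) | s_0 = s]`. -/
def value (M : ParamMDP St Ac m k d) (φ : Euc k) (θ : Euc m) (s : St) : ℝ :=
  ∑' t : ℕ, M.γ ^ t * ∫ y, M.expReward φ θ y ∂(M.stateLaw θ t s)

/-- The policy objective `J_φ(θ) = E_{s ∼ ρ} Ṽ_φ^{π_θ}(s)`. -/
def J (M : ParamMDP St Ac m k d) (φ : Euc k) (θ : Euc m) : ℝ :=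
  ∫ s, M.value φ θ s ∂M.ρ

/-- The score `∇_θ log π_θ(a|s)`. -/
def score (M : ParamMDP St Ac m k d) (θ : Euc m) (s : St) (a : Ac) : Euc m :=
  gradient (fun ϑ => Real.log (M.pol ϑ s a)) θ

/-- The operator `A_θ = E[ϕ(s) (ϕ(s) - γ ϕ(s'))ᵀ]` with `s ∼ ν_θ`, `a ∼ π_θ(·|s)`,
`s' ∼ P(·|s,a)`; here `rankOne ℝ x y` is the operator `x yᵀ`. -/
def A (M : ParamMDP St Ac m k d) (θ : Euc m) : Euc d →L[ℝ] Euc d :=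
  ∫ s, ∫ a, ∫ s', InnerProductSpace.rankOne ℝ (M.feat s) (M.feat s - M.γ • M.feat s')
    ∂(M.P (s, a)) ∂(M.policy (θ, s)) ∂(M.visit θ)

/-- The vector `b_{φ,θ} = E[r̃_{φ,θ}(s,a) ϕ(s)]` with `s ∼ ν_θ`, `a ∼ π_θ(·|s)`. -/
def b (M : ParamMDP St Ac m k d) (φ : Euc k) (θ : Euc m) : Euc d :=
  ∫ s, ∫ a, M.regReward φ θ s a • M.feat s ∂(M.policy (θ, s)) ∂(M.visit θ)

/-- The TD limiting point `ω*(φ,θ) = A_θ⁻¹ b_{φ,θ}`. -/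
def omegaStar (M : ParamMDP St Ac m k d) (φ : Euc k) (θ : Euc m) : Euc d :=
  Ring.inverse (M.A θ) (M.b φ θ)

/-- The linear function approximation error `ε`. -/
def approxError (M : ParamMDP St Ac m k d) : ℝ :=
  ⨆ x : M.rewardSet × Euc m,
    √(∫ s, (⟪M.feat s, M.omegaStar x.1 x.2⟫ - M.value x.1 x.2 s) ^ 2 ∂(M.visit x.2))

/-- Sufficient exploration: `A_θ` is positive definite, uniformly with constant `lam`. -/
def SufficientExploration (M : ParamMDP St Ac m k d) (lam : ℝ) : Prop :=
  ∀ (θ : Euc m) (x : Euc d), lam * ‖x‖ ^ 2 ≤ ⟪x, M.A θ x⟫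

/-- Lipschitz continuity of the policy: `‖∇ log π‖ ≤ L` and `‖∇² log π‖ ≤ S`. -/
structure LipschitzPolicy (M : ParamMDP St Ac m k d) (L S : ℝ) : Prop where
  diff : ∀ s a, Differentiable ℝ fun θ => Real.log (M.pol θ s a)
  diff_score : ∀ s a, Differentiable ℝ fun θ => M.score θ s a
  score_le : ∀ θ s a, ‖M.score θ s a‖ ≤ L
  hess_le : ∀ θ s a, ‖fderiv ℝ (fun ϑ => M.score ϑ s a) θ‖ ≤ S

/-- Lipschitz continuity of the regularised reward (boundedness, bounded second moment, Lipschitz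
continuity and smoothness in `θ`, Lipschitz continuity in `φ`). -/
structure LipschitzReward (M : ParamMDP St Ac m k d) (L S C D : ℝ) : Prop where
  memLp : ∀ φ ∈ M.rewardSet, ∀ θ s, MemLp (M.regReward φ θ s) 2 (M.policy (θ, s))
  bounded : ∀ φ ∈ M.rewardSet, ∀ θ s, |M.expReward φ θ s| ≤ C
  secondMoment : ∀ φ ∈ M.rewardSet, ∀ θ s,
    ∫ a, M.regReward φ θ s a ^ 2 ∂(M.policy (θ, s)) ≤ C ^ 2
  diff : ∀ φ ∈ M.rewardSet, ∀ s, Differentiable ℝ fun θ => M.expReward φ θ s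
  grad_le : ∀ φ ∈ M.rewardSet, ∀ θ s, ‖gradient (fun ϑ => M.expReward φ ϑ s) θ‖ ≤ C * L
  diff_grad : ∀ φ ∈ M.rewardSet, ∀ s,
    Differentiable ℝ (gradient fun θ => M.expReward φ θ s)
  hess_le : ∀ φ ∈ M.rewardSet, ∀ θ s,
    ‖fderiv ℝ (gradient fun ϑ => M.expReward φ ϑ s) θ‖ ≤ C * (L ^ 2 + S)
  grad_reward_le : ∀ φ ∈ M.rewardSet, ∀ θ s, ∃ g : Euc k,
    HasGradientWithinAt (fun ψ => M.expReward ψ θ s) g M.rewardSet φ ∧ ‖g‖ ≤ D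

end ParamMDP

/-- Projection of `ℝᵈ` onto the closed ball of radius `R ≥ 0` around the origin. -/
def ballProj {d : ℕ} (R : ℝ) (x : Euc d) : Euc d :=
  if ‖x‖ ≤ R then x else (R / ‖x‖) • x

/-- The random sequences produced by the algorithm. -/
structure Trajectory (Ω St Ac : Type*) (m k d : ℕ) where
  /-- state `s_t` -/
  s : ℕ → Ω → St
  /-- action `a_t` -/
  a : ℕ → Ω → Ac
  /-- next state `s'_t` used in the TD error -/
  s' : ℕ → Ω → St
  /-- actor parameter `θ_t` -/
  θ : ℕ → Ω → Euc m
  /-- critic parameter `ω_t` -/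
  ω : ℕ → Ω → Euc d
  /-- reward parameter `φ_t` -/
  φ : ℕ → Ω → Euc k

namespace Trajectory

variable {St Ac : Type*} [MeasurableSpace St] [MeasurableSpace Ac] {m k d : ℕ} {Ω : Type*}

/-- The TD error `δ̂_t = r̃_{φ_t,θ_t}(s_t,a_t) + (γ ϕ(s'_t) - ϕ(s_t))ᵀ ω_t`. -/
def tdError (X : Trajectory Ω St Ac m k d) (M : ParamMDP St Ac m k d) (t : ℕ) (w : Ω) : ℝ :=
  M.regReward (X.φ t w) (X.θ t w) (X.s t w) (X.a t w)
    + ⟪M.γ • M.feat (X.s' t w) - M.feat (X.s t w), X.ω t w⟫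

/-- `X` is a run of the actor-critic algorithm with evolving reward, with step sizes `ηθ`, `ηω`
and projection radius `Cω`. The σ-algebra `𝓕 t` contains everything known when `a_t` is sampled;
the reward parameter may be updated by any rule that uses only the past. -/
structure IsRun [MeasurableSpace Ω] (X : Trajectory Ω St Ac m k d) (M : ParamMDP St Ac m k d)
    (Pr : Measure Ω) (𝓕 : Filtration ℕ (inferInstance : MeasurableSpace Ω))
    (ηθ ηω : ℕ → ℝ) (Cω : ℝ) : Prop where
  meas_s : ∀ t, Measurable[𝓕 t] (X.s t)
  meas_θ : ∀ t, Measurable[𝓕 t] (X.θ t)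
  meas_ω : ∀ t, Measurable[𝓕 t] (X.ω t)
  meas_φ : ∀ t, Measurable[𝓕 t] (X.φ t)
  meas_a : ∀ t, Measurable[𝓕 (t + 1)] (X.a t)
  meas_s' : ∀ t, Measurable[𝓕 (t + 1)] (X.s' t)
  φ_mem : ∀ t w, X.φ t w ∈ M.rewardSet
  law_s_zero : Pr.map (X.s 0) = M.ρ
  /-- given the past, `a_t ∼ π_{θ_t}(·|s_t)`, `s'_t ∼ P(·|s_t,a_t)`, `s_{t+1} ∼ P̂(·|s_t,a_t)` -/
  sampling : ∀ t, ∀ B : Set Ω, MeasurableSet[𝓕 t] B → ∀ U : Set (Ac × St × St), MeasurableSet U →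
    Pr (B ∩ {w | (X.a t w, X.s' t w, X.s (t + 1) w) ∈ U})
      = ∫⁻ w in B, M.sampleStep (X.θ t w, X.s t w) U ∂Pr
  actor : ∀ t w, X.θ (t + 1) w
    = X.θ t w + (ηθ t * X.tdError M t w) • M.score (X.θ t w) (X.s t w) (X.a t w)
  critic : ∀ t w, X.ω (t + 1) w
    = ballProj Cω (X.ω t w + (ηω t * X.tdError M t w) • M.feat (X.s t w))

/-- `‖∇_θ J_{φ_t}(θ_t)‖²`. -/
def gradSq (X : Trajectory Ω St Ac m k d) (M : ParamMDP St Ac m k d) (t : ℕ) (w : Ω) : ℝ :=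
  ‖gradient (M.J (X.φ t w)) (X.θ t w)‖ ^ 2

/-- `‖ω_t - ω*(φ_t,θ_t)‖²`. -/
def criticSq (X : Trajectory Ω St Ac m k d) (M : ParamMDP St Ac m k d) (t : ℕ) (w : Ω) : ℝ :=
  ‖X.ω t w - M.omegaStar (X.φ t w) (X.θ t w)‖ ^ 2

/-- `‖φ_{t+1} - φ_t‖²`. -/
def rewardSq (X : Trajectory Ω St Ac m k d) (t : ℕ) (w : Ω) : ℝ :=
  ‖X.φ (t + 1) w - X.φ t w‖ ^ 2

variable [MeasurableSpace Ω]

/-- Actor error `G_T`. -/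
def actorError (X : Trajectory Ω St Ac m k d) (M : ParamMDP St Ac m k d) (Pr : Measure Ω)
    (T : ℕ) : ℝ :=
  1 / ((T : ℝ) / 2) * ∑ t ∈ Finset.Ico (T / 2) T, ∫ w, X.gradSq M t w ∂Pr

/-- Critic error `W_T`. -/
def criticError (X : Trajectory Ω St Ac m k d) (M : ParamMDP St Ac m k d) (Pr : Measure Ω)
    (T : ℕ) : ℝ :=
  1 / ((T : ℝ) / 2) * ∑ t ∈ Finset.Ico (T / 2) T, ∫ w, X.criticSq M t w ∂Pr

/-- Reward variation `F_T`. -/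
def rewardVariation (X : Trajectory Ω St Ac m k d) (Pr : Measure Ω) (T : ℕ) : ℝ :=
  1 / ((T : ℝ) / 2) * ∑ t ∈ Finset.Ico (T / 2) T, ∫ w, X.rewardSq t w ∂Pr

end Trajectory

end

open Filter Topology

set_option linter.unusedSectionVars false

/-! ### Bounded measurable functions, the resolvent of the policy chain and the visitation measure.
-/

noncomputable section

/-! With frozen parameters the sampled state moves by the kernel `γ P_θ + (1 - γ) ρ`, which leaves
`ν_θ` invariant. Its Poisson equation is solved explicitly by the discounted sum `u = ∑ γᵗ P_θᵗ f`:
one has `u - γ P_θ u = f`, and the constant `(1 - γ) ρ(u)` equals `ν_θ(f)`. Since `u` is bounded by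
`‖f‖ / (1 - γ)`, no mixing assumption is needed to control the Markovian noise.

The analysis uses three scalar functions of the parameters `x = (φ, θ, ω)` and the state: the
conditional means of the critic increment paired with the critic error `z = ω - ω*` (`critNoise`),
of the actor increment paired with `∇J` (`actorNoise`), and of the actor increment paired with the
pullback of `z` by the derivative of `ω*` (`starNoise`). By the Poisson equation (`poisson_eq`,
`integral_sub_mean`), replacing such a function by its `ν_θ`-mean costs a telescoping term plus the
change of `u` under one parameter step (`abs_sum_noise_le`). This needs moduli of continuity in the
parameters. Smoothness in `θ` is tracked through uniform quadratic Taylor remainders (`QuadApprox`),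
which pass through policy averages, visitation averages and the linear system `A_θ ω* = b`. In `φ`
the reward is only known to be Lipschitz, so by interpolation the `θ`-gradients are `1/2`-Hölder in
`φ`. Reward steps of order `1/t` thus count as `1/√t`, the size of the other steps.

The stationary means close the argument. The critic mean is at most `-λ‖z‖²`. The actor mean is `(1
- γ)‖∇J‖²` up to an error `L‖∇J‖(‖z‖ + ε)`, because replacing the critic by the true value function
gives the policy gradient exactly. The drift of the target `ω*` is of the same order as the critic
step and cannot be discarded as a remainder; its linear part is kept, and its mean is a multiple of
`‖z‖² + ‖∇J‖² + ε²`.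

Multiplying the one-step inequalities by `√t` and summing by parts over the second half of the run
leaves errors of order `√T`. What remains is a pair of coupled inequalities for the sums of `E‖∇J‖²`
and `E‖z‖²`, in which the actor sum feeds back into the critic with a gain proportional to `c_θ /
c_ω`. The claimed `L_ω` may be chosen larger than the true Lipschitz constant, so that the step size
condition makes this gain small enough (`coupled_bound`, `corollary1`). Dividing by `T / 2`, and
using the a priori bound on `ε` to replace `ε²` by a multiple of `ε`, gives the rates. -/

/-- A strongly measurable function bounded by `B`. -/
structure BddMeas {α E : Type*} [MeasurableSpace α] [NormedAddCommGroup E] (f : α → E) (B : ℝ) :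
    Prop where
  meas : StronglyMeasurable f
  bound : ∀ x, ‖f x‖ ≤ B

namespace BddMeas

variable {α β E F : Type*} [MeasurableSpace α] [MeasurableSpace β] [NormedAddCommGroup E]
  [NormedSpace ℝ E] [NormedAddCommGroup F] [NormedSpace ℝ F] {f g : α → E} {B B' : ℝ}

theorem integrable (hf : BddMeas f B) (μ : Measure α) [IsFiniteMeasure μ] : Integrable f μ :=
  Integrable.of_bound hf.meas.aestronglyMeasurable B (ae_of_all _ hf.bound)

theorem norm_integral_le (hf : BddMeas f B) (μ : Measure α) [IsProbabilityMeasure μ] :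
    ‖∫ x, f x ∂μ‖ ≤ B := by
  simpa using norm_integral_le_of_norm_le_const (μ := μ) (ae_of_all _ hf.bound)

theorem nonneg (hf : BddMeas f B) [h : Nonempty α] : 0 ≤ B :=
  h.elim fun x => (norm_nonneg _).trans (hf.bound x)

theorem mono (hf : BddMeas f B) (h : B ≤ B') : BddMeas f B' :=
  ⟨hf.meas, fun x => (hf.bound x).trans h⟩

theorem add (hf : BddMeas f B) (hg : BddMeas g B') : BddMeas (fun x => f x + g x) (B + B') :=
  ⟨hf.meas.add hg.meas, fun x => (norm_add_le _ _).trans (add_le_add (hf.bound x) (hg.bound x))⟩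

theorem sub (hf : BddMeas f B) (hg : BddMeas g B') : BddMeas (fun x => f x - g x) (B + B') :=
  ⟨hf.meas.sub hg.meas, fun x => (norm_sub_le _ _).trans (add_le_add (hf.bound x) (hg.bound x))⟩

theorem const_smul (hf : BddMeas f B) (c : ℝ) : BddMeas (fun x => c • f x) (|c| * B) :=
  ⟨hf.meas.const_smul c, fun x => by
    rw [norm_smul, Real.norm_eq_abs]
    exact mul_le_mul_of_nonneg_left (hf.bound x) (abs_nonneg c)⟩

theorem smul {c : α → ℝ} (hc : BddMeas c B') (hf : BddMeas f B) :
    BddMeas (fun x => c x • f x) (B' * B) :=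
  ⟨hc.meas.smul hf.meas, fun x => by
    rw [norm_smul]
    exact mul_le_mul (hc.bound x) (hf.bound x) (norm_nonneg _)
      ((norm_nonneg _).trans (hc.bound x))⟩

theorem clm_apply {T : α → E →L[ℝ] F} (hT : BddMeas T B) (v : E) :
    BddMeas (fun x => T x v) (B * ‖v‖) :=
  ⟨(ContinuousLinearMap.apply ℝ F v).continuous.comp_stronglyMeasurable hT.meas, fun x =>
    ((T x).le_opNorm _).trans (mul_le_mul_of_nonneg_right (hT.bound x) (norm_nonneg _))⟩

theorem comp {φ : β → α} (hf : BddMeas f B) (hφ : Measurable φ) : BddMeas (fun x => f (φ x)) B :=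
  ⟨hf.meas.comp_measurable hφ, fun _ => hf.bound _⟩

theorem norm (hf : BddMeas f B) : BddMeas (fun x => ‖f x‖) B :=
  ⟨hf.meas.norm, fun x => by simpa using hf.bound x⟩

theorem integral_kernel {κ : Kernel α β} [IsMarkovKernel κ] {f : α → β → E}
    (hf : BddMeas (Function.uncurry f) B) : BddMeas (fun x => ∫ y, f x y ∂κ x) B :=
  ⟨hf.meas.integral_kernel_prod_right, fun x => BddMeas.norm_integral_le
    ⟨hf.meas.comp_measurable measurable_prodMk_left, fun y => hf.bound (x, y)⟩ _⟩

end BddMeas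

theorem integral_bind_kernel {α β E : Type*} [MeasurableSpace α] [MeasurableSpace β]
    [NormedAddCommGroup E] [NormedSpace ℝ E] {μ : Measure α} {κ : Kernel α β}
    {f : β → E} (hf : Integrable f (μ.bind κ)) :
    ∫ y, f y ∂(μ.bind κ) = ∫ x, ∫ y, f y ∂κ x ∂μ := by
  rw [Measure.comp_eq_comp_const_apply] at hf ⊢
  rw [Kernel.integral_comp hf]
  simp

instance isMarkovKernel_pow {α : Type*} [MeasurableSpace α] (κ : Kernel α α) [IsMarkovKernel κ]
    (n : ℕ) : IsMarkovKernel (κ ^ n) := by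
  induction n with
  | zero => rw [pow_zero]; exact inferInstanceAs (IsMarkovKernel Kernel.id)
  | succ n ih => rw [pow_succ]; exact inferInstanceAs (IsMarkovKernel ((κ ^ n) ∘ₖ κ))

namespace ParamMDP

variable {St Ac : Type*} [MeasurableSpace St] [MeasurableSpace Ac] {m k d : ℕ}
  {E : Type*} [NormedAddCommGroup E] [NormedSpace ℝ E] [CompleteSpace E]
  (M : ParamMDP St Ac m k d)

theorem one_sub_gamma_pos : 0 < 1 - M.γ := sub_pos.2 M.γ_lt_one

instance instMarkovStateKernel (θ : Euc m) : IsMarkovKernel (M.stateKernel θ) := by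
  unfold stateKernel; infer_instance

instance instProbStateLaw (θ : Euc m) (t : ℕ) (s : St) :
    IsProbabilityMeasure (M.stateLaw θ t s) := by
  unfold stateLaw; infer_instance

/-- The operator `f ↦ E[f(s') | s, a]`. -/
def avgNext (f : St → E) (s : St) (a : Ac) : E := ∫ s', f s' ∂M.P (s, a)

/-- The operator `f ↦ E_{a ∼ π_θ(·|s)} f(a)`. -/
def avgAct (θ : Euc m) (s : St) (f : Ac → E) : E := ∫ a, f a ∂M.policy (θ, s)

/-- The one step operator of the chain under `π_θ`. -/
def trans (θ : Euc m) (f : St → E) (s : St) : E := M.avgAct θ s (M.avgNext f s)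

/-- The operator `∑ₜ γᵗ P_θᵗ`. -/
def resolv (θ : Euc m) (f : St → E) (s : St) : E :=
  ∑' t : ℕ, M.γ ^ t • ∫ y, f y ∂M.stateLaw θ t s

variable {M} {f g : St → E} {B δ : ℝ}

theorem bddMeas_avgNext (hf : BddMeas f B) : BddMeas (Function.uncurry (M.avgNext f)) B := by
  have : BddMeas (Function.uncurry fun (_ : St × Ac) (s' : St) => f s') B :=
    hf.comp measurable_snd
  exact this.integral_kernel (κ := M.P)

theorem bddMeas_avgNext_left (hf : BddMeas f B) (s : St) : BddMeas (M.avgNext f s) B :=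
  (bddMeas_avgNext hf).comp measurable_prodMk_left

theorem bddMeas_avgAct {f : St → Ac → E} (hf : BddMeas (Function.uncurry f) B) (θ : Euc m) :
    BddMeas (fun s => M.avgAct θ s (f s)) B :=
  hf.integral_kernel (κ := M.policy.comap (fun s : St => (θ, s)) (by fun_prop))

theorem bddMeas_trans (hf : BddMeas f B) (θ : Euc m) : BddMeas (M.trans θ f) B :=
  bddMeas_avgAct (bddMeas_avgNext hf) θ

theorem integral_stateKernel (hf : BddMeas f B) (θ : Euc m) (s : St) :
    ∫ y, f y ∂M.stateKernel θ s = M.trans θ f s := by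
  unfold stateKernel
  rw [Kernel.snd_apply, integral_map measurable_snd.aemeasurable hf.meas.aestronglyMeasurable,
    ProbabilityTheory.integral_compProd ((hf.comp measurable_snd).integrable _)]
  rfl

theorem integral_stateLaw_zero (hf : BddMeas f B) (θ : Euc m) (s : St) :
    ∫ y, f y ∂M.stateLaw θ 0 s = f s := by
  have : M.stateLaw θ 0 s = Measure.dirac s := by
    unfold stateLaw; rw [pow_zero]; exact Kernel.id_apply s
  rw [this, integral_dirac' _ _ hf.meas]

theorem bddMeas_integral_stateLaw (hf : BddMeas f B) (θ : Euc m) (t : ℕ) :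
    BddMeas (fun s => ∫ y, f y ∂M.stateLaw θ t s) B := by
  have : BddMeas (Function.uncurry fun (_ : St) (s' : St) => f s') B := hf.comp measurable_snd
  exact this.integral_kernel (κ := M.stateKernel θ ^ t)

theorem integral_stateLaw_succ (hf : BddMeas f B) (θ : Euc m) (t : ℕ) (s : St) :
    ∫ y, f y ∂M.stateLaw θ (t + 1) s = M.trans θ (fun x => ∫ y, f y ∂M.stateLaw θ t x) s := by
  have h : M.stateLaw θ (t + 1) s = ((M.stateKernel θ ^ t) ∘ₖ M.stateKernel θ) s := by
    unfold stateLaw; rw [pow_succ]; rfl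
  rw [h, Kernel.integral_comp (hf.integrable _),
    ← integral_stateKernel (bddMeas_integral_stateLaw hf θ t)]
  rfl

theorem trans_add {B'} (hf : BddMeas f B) (hg : BddMeas g B') (θ : Euc m) (s : St) :
    M.trans θ (fun x => f x + g x) s = M.trans θ f s + M.trans θ g s := by
  rw [← integral_stateKernel (hf.add hg), ← integral_stateKernel hf, ← integral_stateKernel hg]
  exact integral_add (hf.integrable _) (hg.integrable _)

theorem trans_sub {B'} (hf : BddMeas f B) (hg : BddMeas g B') (θ : Euc m) (s : St) :
    M.trans θ (fun x => f x - g x) s = M.trans θ f s - M.trans θ g s := by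
  rw [← integral_stateKernel (hf.sub hg), ← integral_stateKernel hf, ← integral_stateKernel hg]
  exact integral_sub (hf.integrable _) (hg.integrable _)

theorem norm_geom_le (hf : BddMeas f B) (θ : Euc m) (t : ℕ) (s : St) :
    ‖M.γ ^ t • ∫ y, f y ∂M.stateLaw θ t s‖ ≤ M.γ ^ t * B := by
  rw [norm_smul, norm_pow, Real.norm_of_nonneg M.γ_pos.le]
  exact mul_le_mul_of_nonneg_left (hf.norm_integral_le _) (pow_nonneg M.γ_pos.le _)

theorem summable_geom_mul (M : ParamMDP St Ac m k d) (B : ℝ) :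
    Summable fun t : ℕ => M.γ ^ t * B :=
  (summable_geometric_of_lt_one M.γ_pos.le M.γ_lt_one).mul_right B

theorem summable_resolv (hf : BddMeas f B) (θ : Euc m) (s : St) :
    Summable fun t : ℕ => M.γ ^ t • ∫ y, f y ∂M.stateLaw θ t s :=
  Summable.of_norm_bounded (M.summable_geom_mul B) fun t => norm_geom_le hf θ t s

theorem bddMeas_resolv (hf : BddMeas f B) (θ : Euc m) :
    BddMeas (M.resolv θ f) (B / (1 - M.γ)) := by
  refine ⟨?_, fun s => ?_⟩
  · refine stronglyMeasurable_of_tendsto atTop (f := fun n s =>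
      ∑ t ∈ Finset.range n, M.γ ^ t • ∫ y, f y ∂M.stateLaw θ t s) (fun n => ?_) ?_
    · exact Finset.stronglyMeasurable_fun_sum _ fun t _ =>
        (bddMeas_integral_stateLaw hf θ t).meas.const_smul _
    · exact tendsto_pi_nhds.2 fun s => (summable_resolv hf θ s).hasSum.tendsto_sum_nat
  · refine tsum_of_norm_bounded ?_ fun t => norm_geom_le hf θ t s
    rw [div_eq_inv_mul]
    exact (hasSum_geometric_of_lt_one M.γ_pos.le M.γ_lt_one).mul_right B

/-- Splitting off the term `t = 0` leaves `γ P_θ` applied to the same series; the geometric majorant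
justifies exchanging the series with the integral. -/
theorem resolv_eq (hf : BddMeas f B) (θ : Euc m) (s : St) :
    M.resolv θ f s = f s + M.γ • M.trans θ (M.resolv θ f) s := by
  conv_lhs => unfold resolv
  rw [(summable_resolv hf θ s).tsum_eq_zero_add]
  congr 1
  · simp [integral_stateLaw_zero hf]
  · rw [← integral_stateKernel (bddMeas_resolv hf θ)]
    unfold resolv
    rw [← (hasSum_integral_of_summable_integral_norm (fun t =>
      ((bddMeas_integral_stateLaw hf θ t).const_smul (M.γ ^ t)).integrable _) ?_).tsum_eq,
      ← tsum_const_smul'']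
    · refine tsum_congr fun t => ?_
      rw [integral_stateLaw_succ hf, integral_smul, smul_smul, ← pow_succ',
        integral_stateKernel (bddMeas_integral_stateLaw hf θ t)]
    · refine Summable.of_nonneg_of_le (fun t => integral_nonneg fun _ => norm_nonneg _)
        (fun t => ?_) (M.summable_geom_mul B)
      have := (((bddMeas_integral_stateLaw (M := M) hf θ t).const_smul (M.γ ^ t)).norm).norm_integral_le
        (M.stateKernel θ s)
      rw [abs_of_nonneg (pow_nonneg M.γ_pos.le _)] at this
      exact (le_abs_self _).trans this

/-- `I - γ P_θ` is bounded below in the supremum norm. -/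
theorem norm_le_of_norm_le_add_trans {w : St → E} (hw : BddMeas w B) {θ : Euc m}
    (h : ∀ s, ‖w s‖ ≤ δ + M.γ * ‖M.trans θ w s‖) (s : St) : ‖w s‖ ≤ δ / (1 - M.γ) := by
  have hb : BddAbove (Set.range fun s => ‖w s‖) := ⟨B, by rintro _ ⟨s, rfl⟩; exact hw.bound s⟩
  have : Nonempty St := ⟨s⟩
  set A := ⨆ s, ‖w s‖
  have hA : BddMeas w A := ⟨hw.meas, fun s => le_ciSup hb s⟩
  -- The averaging operator is a contraction for the supremum norm, so the supremum itself satisfies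
  -- the inequality and can be solved for.
  have : A ≤ δ + M.γ * A := ciSup_le fun s => (h s).trans (by
    gcongr
    · exact M.γ_pos.le
    · exact (bddMeas_trans hA θ).bound s)
  rw [le_div_iff₀ M.one_sub_gamma_pos]
  nlinarith [hA.bound s, M.one_sub_gamma_pos]

/-- An index shift in the defining series. It says that `ν_θ` is invariant for the chain that
follows `P_θ` with probability `γ` and restarts from `ρ` otherwise, which is the chain the algorithm
samples from. -/
theorem visit_eq (M : ParamMDP St Ac m k d) (θ : Euc m) :
    M.visit θ = ENNReal.ofReal (1 - M.γ) • M.ρ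
      + ENNReal.ofReal M.γ • (M.visit θ).bind (M.stateKernel θ) := by
  conv_lhs => unfold visit
  unfold visit
  rw [Measure.bind_sum _ _ (Kernel.aemeasurable _)]
  ext U hU
  rw [Measure.sum_apply _ hU, tsum_eq_zero_add' ENNReal.summable, Measure.add_apply,
    Measure.smul_apply (ENNReal.ofReal M.γ), Measure.sum_apply _ hU, smul_eq_mul,
    ← ENNReal.tsum_mul_left]
  congr 1
  · rw [pow_zero, mul_one, pow_zero]
    congr 3
    exact Measure.bind_dirac
  · refine tsum_congr fun t => ?_
    have h : (M.stateKernel θ ^ (t + 1) : Kernel St St)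
        = (M.stateKernel θ) ∘ₖ (M.stateKernel θ ^ t) := pow_succ' _ _
    rw [Measure.comp_smul, h, ← Measure.comp_assoc, Measure.smul_apply, Measure.smul_apply,
      smul_eq_mul, smul_eq_mul, ← mul_assoc, ← ENNReal.ofReal_mul M.γ_pos.le]
    congr 2
    ring

instance instProbVisit (M : ParamMDP St Ac m k d) (θ : Euc m) :
    IsProbabilityMeasure (M.visit θ) := by
  refine ⟨?_⟩
  unfold visit
  rw [Measure.sum_apply _ MeasurableSet.univ]
  have : ∀ t : ℕ, IsProbabilityMeasure (M.ρ.bind (M.stateKernel θ ^ t : Kernel St St)) :=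
    fun t => inferInstance
  simp only [Measure.smul_apply, measure_univ, smul_eq_mul, mul_one]
  have h1 := M.one_sub_gamma_pos
  rw [← ENNReal.ofReal_tsum_of_nonneg]
  · rw [tsum_mul_left, tsum_geometric_of_lt_one M.γ_pos.le M.γ_lt_one,
      mul_inv_cancel₀ h1.ne', ENNReal.ofReal_one]
  · exact fun t => mul_nonneg h1.le (pow_nonneg M.γ_pos.le _)
  · exact (summable_geometric_of_lt_one M.γ_pos.le M.γ_lt_one).mul_left _

theorem integral_visit_eq (hf : BddMeas f B) (θ : Euc m) :
    ∫ s, f s ∂M.visit θ = (1 - M.γ) • ∫ s, f s ∂M.ρ + M.γ • ∫ s, M.trans θ f s ∂M.visit θ := by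
  conv_lhs => rw [visit_eq]
  rw [integral_add_measure ((hf.integrable _).smul_measure ENNReal.ofReal_ne_top)
    ((hf.integrable _).smul_measure ENNReal.ofReal_ne_top), integral_smul_measure,
    integral_smul_measure, ENNReal.toReal_ofReal M.one_sub_gamma_pos.le,
    ENNReal.toReal_ofReal M.γ_pos.le, integral_bind_kernel (hf.integrable _)]
  simp_rw [integral_stateKernel hf]

theorem integral_visit_sub_trans (hf : BddMeas f B) (θ : Euc m) :
    ∫ s, (f s - M.γ • M.trans θ f s) ∂M.visit θ = (1 - M.γ) • ∫ s, f s ∂M.ρ := by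
  rw [integral_sub (hf.integrable _) (((bddMeas_trans hf θ).const_smul _).integrable _),
    integral_smul]
  exact sub_eq_of_eq_add (integral_visit_eq hf θ)

/-- Invariance tested on the resolvent `u`, for which `u - γ P_θ u = f`. -/
theorem integral_visit_eq_resolv (hf : BddMeas f B) (θ : Euc m) :
    ∫ s, f s ∂M.visit θ = (1 - M.γ) • ∫ s, M.resolv θ f s ∂M.ρ := by
  rw [← integral_visit_sub_trans (bddMeas_resolv hf θ) θ]
  refine integral_congr_ae (ae_of_all _ fun s => ?_)
  simp only
  rw [eq_sub_iff_add_eq]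
  exact (resolv_eq hf θ s).symm

/-- Averaging over the next state does not increase the visitation average by more than `1/γ`. -/
theorem integral_visit_trans_le {f : St → ℝ} (hf : BddMeas f B) (h0 : ∀ s, 0 ≤ f s) (θ : Euc m) :
    M.γ * ∫ s, M.trans θ f s ∂M.visit θ ≤ ∫ s, f s ∂M.visit θ := by
  rw [integral_visit_eq hf θ, smul_eq_mul, smul_eq_mul]
  have := mul_nonneg M.one_sub_gamma_pos.le (integral_nonneg (μ := M.ρ) h0)
  linarith

end ParamMDP

end

/-! ### Quadratic Taylor remainders and expansion of the policy density. -/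

noncomputable section

/-- `f'` is a derivative of `f` with a uniform quadratic bound on the remainder. -/
structure QuadApprox {E F : Type*} [NormedAddCommGroup E] [NormedSpace ℝ E]
    [NormedAddCommGroup F] [NormedSpace ℝ F] (f : E → F) (f' : E → E →L[ℝ] F) (K : ℝ) : Prop where
  nonneg : 0 ≤ K
  remainder : ∀ x y, ‖f y - f x - f' x (y - x)‖ ≤ K * ‖y - x‖ ^ 2

section QuadApprox

variable {E F : Type*} [NormedAddCommGroup E] [NormedSpace ℝ E] [NormedAddCommGroup F]
  [NormedSpace ℝ F] {f g : E → F} {f' g' : E → E →L[ℝ] F} {K B : ℝ}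

theorem hasFDerivAt_of_quadratic_remainder {A : E →L[ℝ] F} {x : E}
    (h : ∀ y, ‖y - x‖ ≤ 1 → ‖f y - f x - A (y - x)‖ ≤ K * ‖y - x‖ ^ 2) : HasFDerivAt f A x := by
  refine HasFDerivAt.of_isLittleO (Asymptotics.IsBigO.trans_isLittleO
    (g := fun y => ‖y - x‖ ^ 2) ?_ ?_)
  · refine Asymptotics.IsBigO.of_bound K ?_
    filter_upwards [Metric.closedBall_mem_nhds x one_pos] with y hy
    rw [Metric.mem_closedBall, dist_eq_norm] at hy
    simpa using h y hy
  · exact Asymptotics.isLittleO_norm_pow_id one_lt_two |>.comp_tendsto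
      (by simpa using (continuous_sub_right x).tendsto x)

theorem opNorm_le_of_sphere {A : E →L[ℝ] F} {r C : ℝ} (hr : 0 < r) (hC : 0 ≤ C)
    (h : ∀ v, ‖v‖ = r → ‖A v‖ ≤ C * r) : ‖A‖ ≤ C := by
  refine A.opNorm_le_bound hC fun v => ?_
  rcases eq_or_ne v 0 with rfl | hv
  · simp
  have hv' : 0 < ‖v‖ := norm_pos_iff.2 hv
  have h1 := h ((r / ‖v‖) • v) (by
    rw [norm_smul, Real.norm_of_nonneg (by positivity)]; field_simp)
  rw [map_smul, norm_smul, Real.norm_of_nonneg (by positivity), div_mul_eq_mul_div,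
    div_le_iff₀ hv'] at h1
  nlinarith

namespace QuadApprox

theorem hasFDerivAt (h : QuadApprox f f' K) (x : E) : HasFDerivAt f (f' x) x :=
  hasFDerivAt_of_quadratic_remainder fun y _ => h.remainder x y

theorem norm_sub_le (h : QuadApprox f f' K) (hB : ∀ x, ‖f' x‖ ≤ B) (x y : E) :
    ‖f y - f x‖ ≤ B * ‖y - x‖ :=
  convex_univ.norm_image_sub_le_of_norm_hasFDerivWithin_le
    (fun z _ => (h.hasFDerivAt z).hasFDerivWithinAt) (fun z _ => hB z) trivial trivial

/-- Expand `f (y + v)` around `x` and around `y` with `‖v‖ = ‖y - x‖`. The difference of the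
derivatives at `v` is a combination of three remainders of sizes `4K`, `K` and `K` times `‖y - x‖ ^
2`. -/
theorem deriv_sub_le (h : QuadApprox f f' K) (x y : E) : ‖f' y - f' x‖ ≤ 6 * K * ‖y - x‖ := by
  have hK := h.nonneg
  rcases eq_or_ne y x with rfl | hxy
  · simp
  have hr : 0 < ‖y - x‖ := norm_pos_iff.2 (sub_ne_zero.2 hxy)
  refine opNorm_le_of_sphere hr (by positivity) fun v hv => ?_
  have h1 := h.remainder x (y + v)
  have h2 := h.remainder y (y + v)
  have h3 := h.remainder x y
  have e : (f' y - f' x) v = (f (y + v) - f x - f' x (y + v - x))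
      - (f (y + v) - f y - f' y (y + v - y)) - (f y - f x - f' x (y - x)) := by
    rw [show y + v - x = (y - x) + v by abel, show y + v - y = v by abel, map_add,
      _root_.sub_apply]
    abel
  rw [e]
  have h4 : ‖y + v - x‖ ≤ 2 * ‖y - x‖ := by
    rw [show y + v - x = (y - x) + v by abel]
    exact (norm_add_le _ _).trans (by rw [hv]; linarith)
  have h5 : ‖y + v - x‖ ^ 2 ≤ (2 * ‖y - x‖) ^ 2 := by gcongr
  rw [show y + v - y = v by abel, hv] at h2
  rw [show y + v - y = v by abel]
  refine (_root_.norm_sub_le _ _).trans ((add_le_add (_root_.norm_sub_le _ _) le_rfl).trans ?_)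
  nlinarith

/-- Mean value inequality on the segment for `f` minus its linear part at `x`; the factor `1/2` of
Taylor's formula is given away. -/
theorem of_lipschitz_deriv (hf : ∀ x, HasFDerivAt f (f' x) x) (hK : 0 ≤ K)
    (hl : ∀ x y, ‖f' y - f' x‖ ≤ K * ‖y - x‖) : QuadApprox f f' K := by
  refine ⟨hK, fun x y => ?_⟩
  have := (convex_segment x y).norm_image_sub_le_of_norm_hasFDerivWithin_le
    (f := fun z => f z - f' x z) (f' := fun z => f' z - f' x) (C := K * ‖y - x‖)
    (fun z _ => ((hf z).sub (f' x).hasFDerivAt).hasFDerivWithinAt)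
    (fun z hz => (hl x z).trans (mul_le_mul_of_nonneg_left (by
      simpa [norm_sub_rev] using norm_sub_le_of_mem_segment hz) hK))
    (left_mem_segment ℝ x y) (right_mem_segment ℝ x y)
  rw [pow_two, ← mul_assoc, map_sub]
  convert this using 2
  abel

/-- Interpolation: functions with uniformly bounded second differences that are uniformly close
have close derivatives. -/
theorem deriv_sub_le_sqrt (hf : QuadApprox f f' K) (hg : QuadApprox g g' K) {δ : ℝ}
    (hδ : ∀ x, ‖f x - g x‖ ≤ δ) (x : E) : ‖f' x - g' x‖ ≤ (2 + 2 * K) * √δ := by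
  have hK := hf.nonneg
  -- On a vector of length `r` the two expansions give `2δ + 2K r²`, that is `2δ / r + 2K r` for the
  -- operator norm. The radius is free, and the balanced choice is `r = √δ`.
  have key : ∀ r : ℝ, 0 < r → δ ≤ r ^ 2 → ‖f' x - g' x‖ ≤ (2 + 2 * K) * r := by
    intro r hr hδr
    refine opNorm_le_of_sphere hr (by positivity) fun v hv => ?_
    have h1 := hf.remainder x (x + v)
    have h2 := hg.remainder x (x + v)
    rw [add_sub_cancel_left, hv] at h1 h2
    have e : (f' x - g' x) v = (f (x + v) - g (x + v)) - (f x - g x)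
      - (f (x + v) - f x - f' x v) + (g (x + v) - g x - g' x v) := by
      rw [_root_.sub_apply]; abel
    rw [e]
    refine (norm_add_le _ _).trans ((add_le_add (_root_.norm_sub_le _ _) le_rfl).trans
      ((add_le_add (add_le_add (_root_.norm_sub_le _ _) le_rfl) le_rfl).trans ?_))
    nlinarith [hδ x, hδ (x + v)]
  have h0 : 0 ≤ δ := (norm_nonneg _).trans (hδ x)
  refine le_of_forall_pos_le_add fun ε hε => ?_
  -- The radius is taken slightly above `√δ`, so that it is positive also when `δ = 0`.
  have hr : 0 < √δ + ε / (2 + 2 * K) := by positivity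
  refine (key _ hr ?_).trans (le_of_eq ?_)
  · nlinarith [Real.sq_sqrt h0, Real.sqrt_nonneg δ, div_pos hε (by positivity : 0 < 2 + 2 * K)]
  · field_simp

end QuadApprox

end QuadApprox

theorem abs_exp_sub_one_le_mul_exp (u : ℝ) : |Real.exp u - 1| ≤ |u| * Real.exp |u| := by
  have := Complex.norm_exp_sub_sum_le_norm_mul_exp (u : ℂ) 1
  rw [Finset.sum_range_one] at this
  norm_num at this
  rw [← Complex.ofReal_exp, ← Complex.ofReal_one, ← Complex.ofReal_sub, Complex.norm_real] at this
  exact this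

theorem abs_exp_sub_one_sub_le_mul_exp (u : ℝ) :
    |Real.exp u - 1 - u| ≤ u ^ 2 * Real.exp |u| := by
  have := Complex.norm_exp_sub_sum_le_norm_mul_exp (u : ℂ) 2
  rw [Finset.sum_range_succ, Finset.sum_range_one] at this
  norm_num at this
  rw [← Complex.ofReal_exp, ← sub_sub, ← Complex.ofReal_one, ← Complex.ofReal_sub,
    ← Complex.ofReal_sub, Complex.norm_real] at this
  exact this

namespace ParamMDP

/-- Lipschitz constant of `θ ↦ π_θ` in total variation. -/
def polLip (L : ℝ) : ℝ := 2 + L * Real.exp L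

/-- Bound for the second order remainder of `θ ↦ π_θ` in total variation. -/
def polQuad (L S : ℝ) : ℝ := 2 + L + S + L ^ 2 * Real.exp L

theorem polLip_nonneg {L : ℝ} (hL : 0 ≤ L) : 0 ≤ polLip L := by unfold polLip; positivity

theorem polQuad_nonneg {L S : ℝ} (hL : 0 ≤ L) (hS : 0 ≤ S) : 0 ≤ polQuad L S := by
  unfold polQuad; positivity

variable {St Ac : Type*} [MeasurableSpace St] [MeasurableSpace Ac] {m k d : ℕ}
  {E : Type*} [NormedAddCommGroup E] [NormedSpace ℝ E] [CompleteSpace E]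
  {M : ParamMDP St Ac m k d} {L S B : ℝ}

/-- Each coordinate of the score is a pointwise limit of difference quotients of `log π` with
increments `1/n`, and these are jointly measurable. -/
theorem measurable_score (h : M.LipschitzPolicy L S) :
    Measurable fun x : (Euc m × St) × Ac => M.score x.1.1 x.1.2 x.2 := by
  suffices h : Measurable fun (x : (Euc m × St) × Ac) (i : Fin m) => M.score x.1.1 x.1.2 x.2 i from
    (MeasurableEquiv.toLp 2 (Fin m → ℝ)).measurable.comp h
  refine measurable_pi_iff.2 fun i => ?_
  let e : Euc m := EuclideanSpace.single i 1
  refine measurable_of_tendsto_metrizable (f := fun (n : ℕ) (x : (Euc m × St) × Ac) =>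
    (n : ℝ) • (Real.log (M.pol (x.1.1 + (n : ℝ)⁻¹ • e) x.1.2 x.2)
      - Real.log (M.pol x.1.1 x.1.2 x.2))) (fun n => ?_) ?_
  · have h1 : Measurable fun x : (Euc m × St) × Ac =>
        M.pol (x.1.1 + (n : ℝ)⁻¹ • e) x.1.2 x.2 :=
      M.pol_meas.comp (g := fun x : (Euc m × St) × Ac => M.pol x.1.1 x.1.2 x.2)
        (f := fun x : (Euc m × St) × Ac => ((x.1.1 + (n : ℝ)⁻¹ • e, x.1.2), x.2)) (by fun_prop)
    exact (h1.log.sub M.pol_meas.log).const_smul (n : ℝ)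
  · refine tendsto_pi_nhds.2 fun x => ?_
    have h1 := (h.diff x.1.2 x.2 x.1.1).hasFDerivAt.lim e (c := fun n : ℕ => (n : ℝ))
      (l := atTop) (by simpa using tendsto_natCast_atTop_atTop (R := ℝ))
    convert h1 using 2
    have h2 : fderiv ℝ (fun θ => Real.log (M.pol θ x.1.2 x.2)) x.1.1 e
        = ⟪M.score x.1.1 x.1.2 x.2, e⟫ := by
      unfold score gradient
      rw [InnerProductSpace.toDual_symm_apply]
    rw [h2]
    simp [e, EuclideanSpace.inner_single_right]

theorem hasFDerivAt_log_pol (h : M.LipschitzPolicy L S) (θ : Euc m) (s : St) (a : Ac) :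
    HasFDerivAt (fun ϑ => Real.log (M.pol ϑ s a)) (innerSL ℝ (M.score θ s a)) θ :=
  ((h.diff s a θ).hasGradientAt).hasFDerivAt

theorem quadApprox_log_pol (h : M.LipschitzPolicy L S) (hS : 0 ≤ S) (s : St) (a : Ac) :
    QuadApprox (fun ϑ => Real.log (M.pol ϑ s a)) (fun θ => innerSL ℝ (M.score θ s a)) S := by
  refine .of_lipschitz_deriv (fun θ => hasFDerivAt_log_pol h θ s a) hS fun x y => ?_
  rw [← map_sub, innerSL_apply_norm]
  exact convex_univ.norm_image_sub_le_of_norm_fderiv_le (𝕜 := ℝ)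
    (f := fun θ => M.score θ s a) (fun z _ => h.diff_score s a z) (fun z _ => h.hess_le z s a)
    trivial trivial

theorem abs_log_pol_sub_le (h : M.LipschitzPolicy L S) (hS : 0 ≤ S) (θ θ' : Euc m) (s : St)
    (a : Ac) : |Real.log (M.pol θ' s a) - Real.log (M.pol θ s a)| ≤ L * ‖θ' - θ‖ :=
  (quadApprox_log_pol h hS s a).norm_sub_le
    (fun x => (innerSL_apply_norm ℝ (M.score x s a)).trans_le (h.score_le x s a)) θ θ'

theorem pol_eq_mul_exp (M : ParamMDP St Ac m k d) (θ θ' : Euc m) (s : St) (a : Ac) :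
    M.pol θ' s a
      = M.pol θ s a * Real.exp (Real.log (M.pol θ' s a) - Real.log (M.pol θ s a)) := by
  rw [Real.exp_sub, Real.exp_log (M.pol_pos _ _ _), Real.exp_log (M.pol_pos _ _ _),
    mul_div_cancel₀ _ (M.pol_pos θ s a).ne']

/-- The density ratio is `exp u` with `|u| ≤ L‖θ' - θ‖ ≤ L`. The bound is kept relative to
`π_θ(a|s)`, so that integration against the base measure turns it into an expectation under the
policy. -/
theorem abs_pol_sub_le (h : M.LipschitzPolicy L S) (hL : 0 ≤ L) (hS : 0 ≤ S) {θ θ' : Euc m}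
    (hθ : ‖θ' - θ‖ ≤ 1) (s : St) (a : Ac) :
    |M.pol θ' s a - M.pol θ s a| ≤ M.pol θ s a * (L * Real.exp L * ‖θ' - θ‖) := by
  have hp := M.pol_pos θ s a
  have hu := abs_log_pol_sub_le h hS θ θ' s a
  rw [M.pol_eq_mul_exp θ θ' s a]
  set u := Real.log (M.pol θ' s a) - Real.log (M.pol θ s a)
  rw [show M.pol θ s a * Real.exp u - M.pol θ s a = M.pol θ s a * (Real.exp u - 1) by ring,
    abs_mul, abs_of_pos hp]
  gcongr
  refine (abs_exp_sub_one_le_mul_exp u).trans ?_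
  have : |u| ≤ L := hu.trans (by nlinarith)
  calc |u| * Real.exp |u| ≤ (L * ‖θ' - θ‖) * Real.exp L := by gcongr
    _ = _ := by ring

/-- With `w` the linear part of `u`, the relative remainder is `(exp u - 1 - u) + (u - w)`. The
first bracket is quadratic because `u` is Lipschitz in `θ`, the second by the Hessian bound. -/
theorem abs_pol_sub_sub_le (h : M.LipschitzPolicy L S) (hL : 0 ≤ L) (hS : 0 ≤ S) {θ θ' : Euc m}
    (hθ : ‖θ' - θ‖ ≤ 1) (s : St) (a : Ac) :
    |M.pol θ' s a - M.pol θ s a - M.pol θ s a * ⟪M.score θ s a, θ' - θ⟫|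
      ≤ M.pol θ s a * ((S + L ^ 2 * Real.exp L) * ‖θ' - θ‖ ^ 2) := by
  have hp := M.pol_pos θ s a
  have hu := abs_log_pol_sub_le h hS θ θ' s a
  have hq := (quadApprox_log_pol h hS s a).remainder θ θ'
  rw [M.pol_eq_mul_exp θ θ' s a]
  set u := Real.log (M.pol θ' s a) - Real.log (M.pol θ s a)
  rw [innerSL_apply_apply, Real.norm_eq_abs] at hq
  set w := ⟪M.score θ s a, θ' - θ⟫
  rw [show M.pol θ s a * Real.exp u - M.pol θ s a - M.pol θ s a * w
    = M.pol θ s a * ((Real.exp u - 1 - u) + (u - w)) by ring, abs_mul, abs_of_pos hp]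
  gcongr
  refine (abs_add_le _ _).trans ?_
  have h1 : |u| ≤ L := hu.trans (by nlinarith)
  have h2 := abs_exp_sub_one_sub_le_mul_exp u
  have h3 : u ^ 2 * Real.exp |u| ≤ (L * ‖θ' - θ‖) ^ 2 * Real.exp L := by
    rw [← sq_abs u]
    gcongr
  nlinarith

end ParamMDP

end

/-! ### Smoothness of policy averages and of visitation averages. -/

noncomputable section

namespace ParamMDP

variable {St Ac : Type*} [MeasurableSpace St] [MeasurableSpace Ac] {m k d : ℕ}
  {E F : Type*} [NormedAddCommGroup E] [NormedSpace ℝ E] [CompleteSpace E]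
  [NormedAddCommGroup F] [NormedSpace ℝ F] [CompleteSpace F]
  {M : ParamMDP St Ac m k d} {L S B δ : ℝ}

theorem nonempty_state (M : ParamMDP St Ac m k d) : Nonempty St :=
  M.ρ.nonempty_of_neZero

theorem measurable_pol_right (M : ParamMDP St Ac m k d) (θ : Euc m) (s : St) :
    Measurable (M.pol θ s) :=
  M.pol_meas.comp (measurable_prodMk_left (x := (θ, s)))

theorem avgAct_eq_integral_base (θ : Euc m) (s : St) (f : Ac → E) :
    M.avgAct θ s f = ∫ a, M.pol θ s a • f a ∂M.base := by
  unfold avgAct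
  rw [policy_apply, integral_withDensity_eq_integral_toReal_smul
    (M.measurable_pol_right θ s).ennreal_ofReal
    (ae_of_all _ fun _ => ENNReal.ofReal_lt_top)]
  simp_rw [ENNReal.toReal_ofReal (M.pol_pos _ _ _).le]

theorem integrable_policy_iff {θ : Euc m} {s : St} {f : Ac → E} :
    Integrable f (M.policy (θ, s)) ↔ Integrable (fun a => M.pol θ s a • f a) M.base := by
  rw [policy_apply, integrable_withDensity_iff_integrable_smul'
    (M.measurable_pol_right θ s).ennreal_ofReal
    (ae_of_all _ fun _ => ENNReal.ofReal_lt_top)]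
  simp_rw [ENNReal.toReal_ofReal (M.pol_pos _ _ _).le]

theorem norm_avgAct_le {f : Ac → E} (hf : BddMeas f B) (θ : Euc m) (s : St) :
    ‖M.avgAct θ s f‖ ≤ B := hf.norm_integral_le _

theorem norm_integral_smul_base_le {θ : Euc m} {s : St} {f : Ac → ℝ} {h : Ac → E} {c : ℝ}
    (hf : ∀ a, ‖h a‖ ≤ M.pol θ s a * c * f a) (hfi : Integrable f (M.policy (θ, s))) :
    ‖∫ a, h a ∂M.base‖ ≤ c * ∫ a, f a ∂M.policy (θ, s) := by
  have h1 : ∫ a, f a ∂M.policy (θ, s) = ∫ a, M.pol θ s a • f a ∂M.base :=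
    avgAct_eq_integral_base θ s f
  rw [h1, ← integral_const_mul]
  refine norm_integral_le_of_norm_le ((integrable_policy_iff.1 hfi).const_mul c)
    (ae_of_all _ fun a => (hf a).trans (le_of_eq ?_))
  rw [smul_eq_mul]; ring

theorem norm_avgAct_sub_le (h : M.LipschitzPolicy L S) (hL : 0 ≤ L) (hS : 0 ≤ S) {f : Ac → E}
    (hf : BddMeas f B) (θ θ' : Euc m) (s : St) :
    ‖M.avgAct θ' s f - M.avgAct θ s f‖ ≤ polLip L * B * ‖θ' - θ‖ := by
  have hB : 0 ≤ B := (norm_nonneg _).trans (norm_avgAct_le (M := M) hf θ s)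
  have he : 0 ≤ L * Real.exp L := by positivity
  -- The exponential estimate serves parameters at distance at most one. Farther away the trivial
  -- bound `2B ≤ 2B‖θ' - θ‖` suffices; this is the summand `2` of `polLip`.
  rcases le_total ‖θ' - θ‖ 1 with h1 | h1
  · rw [avgAct_eq_integral_base, avgAct_eq_integral_base, ← integral_sub
      (integrable_policy_iff.1 (hf.integrable _)) (integrable_policy_iff.1 (hf.integrable _))]
    have := norm_integral_smul_base_le (M := M) (θ := θ) (s := s) (f := fun _ => B)
      (h := fun a => M.pol θ' s a • f a - M.pol θ s a • f a) (c := L * Real.exp L * ‖θ' - θ‖)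
      (fun a => by
        rw [← sub_smul, norm_smul, Real.norm_eq_abs]
        exact mul_le_mul (abs_pol_sub_le h hL hS h1 s a) (hf.bound a) (norm_nonneg _)
          (mul_nonneg (M.pol_pos _ _ _).le (by positivity))) (integrable_const _)
    refine this.trans ?_
    rw [integral_const, probReal_univ, one_smul]
    unfold polLip
    nlinarith [mul_nonneg hB (norm_nonneg (θ' - θ))]
  · refine (norm_sub_le _ _).trans
      ((add_le_add (norm_avgAct_le hf _ _) (norm_avgAct_le hf _ _)).trans ?_)
    unfold polLip
    nlinarith [mul_nonneg he (mul_nonneg hB (norm_nonneg (θ' - θ)))]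

/-- The derivative of `θ ↦ E_{a ∼ π_θ(·|s)} f(a)`, as an expectation against the score. -/
def dAct (M : ParamMDP St Ac m k d) (θ : Euc m) (s : St) (f : Ac → E) : Euc m →L[ℝ] E :=
  ∫ a, (innerSL ℝ (M.score θ s a)).smulRight (f a) ∂M.policy (θ, s)

theorem stronglyMeasurable_smulRight {α : Type*} [MeasurableSpace α] {g : α → Euc m} {f : α → E}
    (hg : StronglyMeasurable g) (hf : StronglyMeasurable f) :
    StronglyMeasurable fun x => (innerSL ℝ (g x)).smulRight (f x) := by
  have hc : Continuous fun p : (Euc m →L[ℝ] ℝ) × E => p.1.smulRight p.2 :=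
    isBoundedBilinearMap_smulRight.continuous
  have h1 : StronglyMeasurable fun x => innerSL ℝ (g x) :=
    (innerSL ℝ).continuous.comp_stronglyMeasurable hg
  exact hc.comp_stronglyMeasurable (h1.prodMk hf)

theorem norm_innerSL_smulRight_le {x : Euc m} {y : E} (hx : ‖x‖ ≤ L) (hy : ‖y‖ ≤ B) :
    ‖(innerSL ℝ x).smulRight y‖ ≤ L * B := by
  rw [ContinuousLinearMap.norm_smulRight_apply, innerSL_apply_norm]
  exact mul_le_mul hx hy (norm_nonneg _) ((norm_nonneg _).trans hx)

theorem bddMeas_score_smulRight (h : M.LipschitzPolicy L S) (θ : Euc m) {f : St → Ac → E}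
    (hf : BddMeas (Function.uncurry f) B) :
    BddMeas (Function.uncurry fun s a => (innerSL ℝ (M.score θ s a)).smulRight (f s a))
      (L * B) := by
  have hm : Measurable fun x : St × Ac => M.score θ x.1 x.2 :=
    (measurable_score h).comp (f := fun x : St × Ac => ((θ, x.1), x.2)) (by fun_prop)
  exact ⟨stronglyMeasurable_smulRight hm.stronglyMeasurable hf.meas,
    fun x => norm_innerSL_smulRight_le (h.score_le _ _ _) (hf.bound x)⟩

theorem measurable_score_right (h : M.LipschitzPolicy L S) (θ : Euc m) (s : St) :
    Measurable (M.score θ s) :=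
  (measurable_score h).comp (measurable_prodMk_left (x := (θ, s)))

theorem bddMeas_score_smulRight_left (h : M.LipschitzPolicy L S) (θ : Euc m) (s : St) {f : Ac → E}
    (hf : BddMeas f B) :
    BddMeas (fun a => (innerSL ℝ (M.score θ s a)).smulRight (f a)) (L * B) :=
  ⟨stronglyMeasurable_smulRight (measurable_score_right h θ s).stronglyMeasurable hf.meas,
    fun a => norm_innerSL_smulRight_le (h.score_le _ _ _) (hf.bound a)⟩

theorem bddMeas_dAct (h : M.LipschitzPolicy L S) (θ : Euc m) {f : St → Ac → E}
    (hf : BddMeas (Function.uncurry f) B) : BddMeas (fun s => M.dAct θ s (f s)) (L * B) :=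
  bddMeas_avgAct (bddMeas_score_smulRight h θ hf) θ

theorem norm_dAct_le (h : M.LipschitzPolicy L S) (θ : Euc m) (s : St) {f : Ac → E}
    (hf : BddMeas f B) : ‖M.dAct θ s f‖ ≤ L * B :=
  norm_avgAct_le (bddMeas_score_smulRight_left h θ s hf) θ s

theorem dAct_apply (h : M.LipschitzPolicy L S) (θ : Euc m) (s : St) {f : Ac → E}
    (hf : BddMeas f B) (v : Euc m) :
    M.dAct θ s f v = ∫ a, ⟪M.score θ s a, v⟫ • f a ∂M.policy (θ, s) := by
  unfold dAct
  rw [ContinuousLinearMap.integral_apply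
    ((bddMeas_score_smulRight_left h θ s hf).integrable _)]
  rfl

/-- The relative expansion of the density is integrated directly, so nothing has to be
differentiated under the integral sign. At distance at least one the crude bound `2B + L B‖θ' - θ‖`
is used, whence the summand `2 + L` of `polQuad`. -/
theorem quadApprox_avgAct (h : M.LipschitzPolicy L S) (hL : 0 ≤ L) (hS : 0 ≤ S) {f : Ac → E}
    (hf : BddMeas f B) (s : St) :
    QuadApprox (fun θ => M.avgAct θ s f) (fun θ => M.dAct θ s f) (polQuad L S * B) := by
  have hB : 0 ≤ B := (norm_nonneg _).trans (norm_avgAct_le (M := M) hf 0 s)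
  have he : 0 ≤ L ^ 2 * Real.exp L := by positivity
  refine ⟨mul_nonneg (polQuad_nonneg hL hS) hB, fun θ θ' => ?_⟩
  rcases le_total ‖θ' - θ‖ 1 with h1 | h1
  · have hi : Integrable (fun a => ⟪M.score θ s a, θ' - θ⟫ • f a) (M.policy (θ, s)) :=
      ((bddMeas_score_smulRight_left h θ s hf).clm_apply (θ' - θ)).integrable _
    have hi1 := integrable_policy_iff.1 (hf.integrable (M.policy (θ', s)))
    have hi2 := integrable_policy_iff.1 (hf.integrable (M.policy (θ, s)))
    rw [dAct_apply h θ s hf]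
    change ‖_ - _ - M.avgAct θ s _‖ ≤ _
    simp_rw [avgAct_eq_integral_base]
    rw [← integral_sub hi1 hi2, ← integral_sub (f := fun a => M.pol θ' s a • f a - M.pol θ s a • f a) (hi1.sub hi2)
        (integrable_policy_iff.1 hi)]
    have := norm_integral_smul_base_le (M := M) (θ := θ) (s := s) (f := fun _ => B)
      (h := fun a => M.pol θ' s a • f a - M.pol θ s a • f a
        - M.pol θ s a • ⟪M.score θ s a, θ' - θ⟫ • f a)
      (c := (S + L ^ 2 * Real.exp L) * ‖θ' - θ‖ ^ 2)
      (fun a => by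
        rw [smul_smul, ← sub_smul, ← sub_smul, norm_smul, Real.norm_eq_abs]
        exact mul_le_mul (abs_pol_sub_sub_le h hL hS h1 s a) (hf.bound a) (norm_nonneg _)
          (mul_nonneg (M.pol_pos _ _ _).le (by positivity))) (integrable_const _)
    refine this.trans ?_
    rw [integral_const, probReal_univ, one_smul]
    unfold polQuad
    nlinarith [mul_nonneg hB (sq_nonneg ‖θ' - θ‖), mul_nonneg hL (mul_nonneg hB (sq_nonneg ‖θ' - θ‖))]
  · have h2 := (M.dAct θ s f).le_opNorm (θ' - θ)
    have h3 := norm_dAct_le h θ s hf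
    have h4 : ‖M.dAct θ s f (θ' - θ)‖ ≤ L * B * ‖θ' - θ‖ := h2.trans (by gcongr)
    refine (norm_sub_le _ _).trans ((add_le_add (norm_sub_le _ _) h4).trans
      ((add_le_add (add_le_add (norm_avgAct_le hf _ _) (norm_avgAct_le hf _ _)) le_rfl).trans ?_))
    unfold polQuad
    have h5 : 1 ≤ ‖θ' - θ‖ ^ 2 := one_le_pow₀ h1
    have h6 : ‖θ' - θ‖ ≤ ‖θ' - θ‖ ^ 2 := by nlinarith
    have h7 : L * B * ‖θ' - θ‖ ≤ L * B * ‖θ' - θ‖ ^ 2 := by gcongr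
    have h8 : B * 1 ≤ B * ‖θ' - θ‖ ^ 2 := by gcongr
    have h9 : 0 ≤ (S + L ^ 2 * Real.exp L) * (B * ‖θ' - θ‖ ^ 2) := by positivity
    nlinarith

/-- The score has mean zero. -/
theorem integral_inner_score (h : M.LipschitzPolicy L S) (hL : 0 ≤ L) (hS : 0 ≤ S) (θ : Euc m)
    (s : St) (v : Euc m) : ∫ a, ⟪M.score θ s a, v⟫ ∂M.policy (θ, s) = 0 := by
  have hb : BddMeas (fun _ : Ac => (1 : ℝ)) 1 := ⟨stronglyMeasurable_const, by simp⟩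
  -- The average of the constant `1` does not depend on the policy, so its derivative vanishes; by
  -- the score formula this derivative is the mean of the score.
  have h1 := (quadApprox_avgAct h hL hS hb s).hasFDerivAt θ
  have h2 : (fun θ => M.avgAct θ s fun _ => (1 : ℝ)) = fun _ => 1 := by
    funext θ; simp [avgAct]
  rw [h2] at h1
  have h3 := dAct_apply h θ s hb v
  rw [h1.unique (hasFDerivAt_const 1 θ)] at h3
  simpa using h3.symm

theorem norm_trans_sub_le (h : M.LipschitzPolicy L S) (hL : 0 ≤ L) (hS : 0 ≤ S) {f : St → E}
    (hf : BddMeas f B) (θ θ' : Euc m) (s : St) :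
    ‖M.trans θ' f s - M.trans θ f s‖ ≤ polLip L * B * ‖θ' - θ‖ :=
  norm_avgAct_sub_le h hL hS (bddMeas_avgNext_left hf s) θ θ' s

/-- The difference `w` of the resolvents solves `w = (f' - f) + γ (P_θ' - P_θ) u' + γ P_θ w`, where
`u'` is the resolvent of `f'` at `θ'`; the lower bound for `I - γ P_θ` finishes. -/
theorem norm_resolv_sub_le (h : M.LipschitzPolicy L S) (hL : 0 ≤ L) (hS : 0 ≤ S) {f f' : St → E}
    (hf : BddMeas f B) (hf' : BddMeas f' B) (hδ : ∀ s, ‖f' s - f s‖ ≤ δ) (θ θ' : Euc m) (s : St) :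
    ‖M.resolv θ' f' s - M.resolv θ f s‖
      ≤ (δ + polLip L * (B / (1 - M.γ)) * ‖θ' - θ‖) / (1 - M.γ) := by
  have hu := bddMeas_resolv (M := M) hf θ
  have hu' := bddMeas_resolv (M := M) hf' θ'
  refine norm_le_of_norm_le_add_trans (hu'.sub hu) (θ := θ) (fun s => ?_) s
  have e : M.resolv θ' f' s - M.resolv θ f s = (f' s - f s)
      + M.γ • (M.trans θ' (M.resolv θ' f') s - M.trans θ (M.resolv θ' f') s)
      + M.γ • M.trans θ (fun s => M.resolv θ' f' s - M.resolv θ f s) s := by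
    rw [trans_sub hu' hu, resolv_eq hf', resolv_eq hf, smul_sub, smul_sub]
    abel
  have h1 := norm_trans_sub_le h hL hS hu' θ θ' s
  rw [e]
  refine (norm_add_le _ _).trans (add_le_add ((norm_add_le _ _).trans (add_le_add (hδ s) ?_)) ?_)
  · rw [norm_smul, Real.norm_of_nonneg M.γ_pos.le]
    nlinarith [M.γ_lt_one, M.γ_pos, norm_nonneg (M.trans θ' (M.resolv θ' f') s - M.trans θ (M.resolv θ' f') s)]
  · rw [norm_smul, Real.norm_of_nonneg M.γ_pos.le]

/-- The performance difference identity: `f = u - γ P_θ u`, while `ν_θ'` applied to `u - γ P_θ' u`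
is `(1 - γ) ρ(u) = ν_θ(f)`. It is exact, with the old resolvent and the new measure. -/
theorem integral_visit_sub (θ θ' : Euc m) {f : St → E} (hf : BddMeas f B) :
    ∫ s, f s ∂M.visit θ' - ∫ s, f s ∂M.visit θ
      = M.γ • ∫ s, (M.trans θ' (M.resolv θ f) s - M.trans θ (M.resolv θ f) s) ∂M.visit θ' := by
  have hu := bddMeas_resolv (M := M) hf θ
  rw [integral_visit_eq_resolv hf θ, ← integral_visit_sub_trans hu θ', ← integral_smul,
    ← integral_sub (hf.integrable _)
      ((hu.sub ((bddMeas_trans hu θ').const_smul M.γ)).integrable _)]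
  refine integral_congr_ae (ae_of_all _ fun s => ?_)
  simp only
  rw [resolv_eq hf θ s, smul_sub]
  abel

theorem norm_integral_visit_sub_le (h : M.LipschitzPolicy L S) (hL : 0 ≤ L) (hS : 0 ≤ S)
    (θ θ' : Euc m) {f : St → E} (hf : BddMeas f B) :
    ‖∫ s, f s ∂M.visit θ' - ∫ s, f s ∂M.visit θ‖
      ≤ polLip L * (B / (1 - M.γ)) * ‖θ' - θ‖ := by
  have hu := bddMeas_resolv (M := M) hf θ
  have hb : BddMeas (fun s => M.trans θ' (M.resolv θ f) s - M.trans θ (M.resolv θ f) s)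
      (polLip L * (B / (1 - M.γ)) * ‖θ' - θ‖) :=
    ⟨((bddMeas_trans hu θ').sub (bddMeas_trans hu θ)).meas,
      fun s => norm_trans_sub_le h hL hS hu θ θ' s⟩
  rw [integral_visit_sub θ θ' hf, norm_smul, Real.norm_of_nonneg M.γ_pos.le]
  have := hb.norm_integral_le (M.visit θ')
  nlinarith [M.γ_lt_one, M.γ_pos, norm_nonneg (∫ s, (M.trans θ' (M.resolv θ f) s
    - M.trans θ (M.resolv θ f) s) ∂M.visit θ')]

/-- A family of functions on the state space, bounded and twice differentiable in the policy
parameter, in the sense of uniform quadratic approximation. -/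
structure SmoothFamily (M : ParamMDP St Ac m k d) (h : Euc m → St → E)
    (h' : Euc m → St → Euc m →L[ℝ] E) (B₀ B₁ B₂ : ℝ) : Prop where
  bdd : ∀ θ, BddMeas (h θ) B₀
  bdd_deriv : ∀ θ, BddMeas (h' θ) B₁
  quad : ∀ s, QuadApprox (fun θ => h θ s) (fun θ => h' θ s) B₂

/-- The derivative of `θ ↦ E_{s ∼ ν_θ} h_θ(s)`. -/
def visitDeriv (M : ParamMDP St Ac m k d) (h : Euc m → St → E) (h' : Euc m → St → Euc m →L[ℝ] E)
    (θ : Euc m) : Euc m →L[ℝ] E :=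
  ∫ s, (h' θ s + M.γ • M.dAct θ s (M.avgNext (M.resolv θ (h θ)) s)) ∂M.visit θ

/-- Remainder constant of `θ ↦ E_{s ∼ ν_θ} h_θ(s)`. -/
def visitQuad (γ L S B₀ B₁ B₂ : ℝ) : ℝ :=
  B₂ + polLip L * (B₁ / (1 - γ)) + polQuad L S * (B₀ / (1 - γ))
    + polLip L * (polLip L * (B₀ / (1 - γ)) / (1 - γ))

namespace SmoothFamily

variable {h : Euc m → St → E} {h' : Euc m → St → Euc m →L[ℝ] E} {B₀ B₁ B₂ : ℝ}

theorem bddMeas_deriv (hp : M.LipschitzPolicy L S) (hh : M.SmoothFamily h h' B₀ B₁ B₂)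
    (θ : Euc m) : BddMeas (fun s => h' θ s + M.γ • M.dAct θ s (M.avgNext (M.resolv θ (h θ)) s))
      (B₁ + M.γ * (L * (B₀ / (1 - M.γ)))) := by
  have := (bddMeas_dAct hp θ (bddMeas_avgNext (M := M)
    (bddMeas_resolv (M := M) (hh.bdd θ) θ))).const_smul M.γ
  rw [abs_of_pos M.γ_pos] at this
  exact (hh.bdd_deriv θ).add this

theorem norm_visitDeriv_le (hp : M.LipschitzPolicy L S) (hh : M.SmoothFamily h h' B₀ B₁ B₂)
    (θ : Euc m) : ‖M.visitDeriv h h' θ‖ ≤ B₁ + M.γ * (L * (B₀ / (1 - M.γ))) :=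
  (hh.bddMeas_deriv hp θ).norm_integral_le _

theorem visitDeriv_apply (hp : M.LipschitzPolicy L S) (hh : M.SmoothFamily h h' B₀ B₁ B₂)
    (θ v : Euc m) : M.visitDeriv h h' θ v
      = ∫ s, (h' θ s v + M.γ • M.dAct θ s (M.avgNext (M.resolv θ (h θ)) s) v) ∂M.visit θ := by
  unfold visitDeriv
  rw [ContinuousLinearMap.integral_apply ((hh.bddMeas_deriv hp θ).integrable _)]
  rfl

/-- The policy gradient theorem with a uniform second order remainder, also for an integrand that
depends on `θ`. -/
theorem quadApprox_visit (hp : M.LipschitzPolicy L S) (hL : 0 ≤ L) (hS : 0 ≤ S)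
    (hh : M.SmoothFamily h h' B₀ B₁ B₂) :
    QuadApprox (fun θ => ∫ s, h θ s ∂M.visit θ) (M.visitDeriv h h')
      (visitQuad M.γ L S B₀ B₁ B₂) := by
  have := M.nonempty_state
  have hB₀ := (hh.bdd 0).nonneg
  have hB₁ := (hh.bdd_deriv 0).nonneg
  have hB₂ := (hh.quad (Classical.arbitrary St)).nonneg
  have h1γ := M.one_sub_gamma_pos
  have hγ := M.γ_pos
  have hpl := polLip_nonneg hL
  have hpq := polQuad_nonneg hL hS
  refine ⟨by unfold visitQuad; positivity, fun θ θ' => ?_⟩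
  set Δ := θ' - θ with hΔ
  have hu := bddMeas_resolv (M := M) (hh.bdd θ) θ
  set u := M.resolv θ (h θ)
  set w : St → E := fun s => M.trans θ' u s - M.trans θ u s
  have hw : BddMeas w (polLip L * (B₀ / (1 - M.γ)) * ‖Δ‖) :=
    ⟨((bddMeas_trans hu θ').sub (bddMeas_trans hu θ)).meas,
      fun s => norm_trans_sub_le hp hL hS hu θ θ' s⟩
  have hd : BddMeas (fun s => h θ' s - h θ s) (B₁ * ‖Δ‖) :=
    ⟨((hh.bdd θ').sub (hh.bdd θ)).meas,
      fun s => (hh.quad s).norm_sub_le (fun θ => (hh.bdd_deriv θ).bound s) θ θ'⟩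
  have hr1 : BddMeas (fun s => h θ' s - h θ s - h' θ s Δ) (B₂ * ‖Δ‖ ^ 2) :=
    ⟨(hd.sub ((hh.bdd_deriv θ).clm_apply Δ)).meas, fun s => (hh.quad s).remainder θ θ'⟩
  have hD := bddMeas_dAct hp θ (bddMeas_avgNext (M := M) hu)
  have hr2 : BddMeas (fun s => w s - M.dAct θ s (M.avgNext u s) Δ)
      (polQuad L S * (B₀ / (1 - M.γ)) * ‖Δ‖ ^ 2) :=
    ⟨(hw.sub (hD.clm_apply Δ)).meas,
      fun s => (quadApprox_avgAct hp hL hS (bddMeas_avgNext_left hu s) s).remainder θ θ'⟩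
  -- Four terms of second order. Two are Taylor remainders, of `h` and of the transition operator.
  -- The other two change the measure on a function that is already `O(‖Δ‖)`, which gains another
  -- factor `‖Δ‖`.
  have e : ∫ s, h θ' s ∂M.visit θ' - ∫ s, h θ s ∂M.visit θ - M.visitDeriv h h' θ Δ
      = (∫ s, (h θ' s - h θ s) ∂M.visit θ' - ∫ s, (h θ' s - h θ s) ∂M.visit θ)
        + ∫ s, (h θ' s - h θ s - h' θ s Δ) ∂M.visit θ
        + M.γ • (∫ s, w s ∂M.visit θ' - ∫ s, w s ∂M.visit θ)
        + M.γ • ∫ s, (w s - M.dAct θ s (M.avgNext u s) Δ) ∂M.visit θ := by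
    have e1 := integral_visit_sub (M := M) θ θ' (hh.bdd θ)
    change _ = M.γ • ∫ s, w s ∂M.visit θ' at e1
    rw [hh.visitDeriv_apply hp, integral_add (((hh.bdd_deriv θ).clm_apply Δ).integrable _)
      (((hD.clm_apply Δ).const_smul M.γ).integrable _), integral_smul,
      integral_sub (hd.integrable _) (((hh.bdd_deriv θ).clm_apply Δ).integrable _),
      integral_sub (hw.integrable _) ((hD.clm_apply Δ).integrable _),
      integral_sub ((hh.bdd θ').integrable (M.visit θ')) ((hh.bdd θ).integrable _), smul_sub,
      smul_sub, ← e1]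
    abel
  rw [e]
  refine (norm_add_le _ _).trans ((add_le_add ((norm_add_le _ _).trans (add_le_add
    (norm_add_le _ _) le_rfl)) le_rfl).trans ?_)
  have b1 := norm_integral_visit_sub_le hp hL hS θ θ' hd
  have b2 := hr1.norm_integral_le (M.visit θ)
  have b3 := norm_integral_visit_sub_le hp hL hS θ θ' hw
  have b4 := hr2.norm_integral_le (M.visit θ)
  rw [norm_smul, norm_smul, Real.norm_of_nonneg hγ.le]
  have g1 : M.γ * ‖∫ s, w s ∂M.visit θ' - ∫ s, w s ∂M.visit θ‖
      ≤ ‖∫ s, w s ∂M.visit θ' - ∫ s, w s ∂M.visit θ‖ :=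
    mul_le_of_le_one_left (norm_nonneg _) M.γ_lt_one.le
  have g2 : M.γ * ‖∫ s, (w s - M.dAct θ s (M.avgNext u s) Δ) ∂M.visit θ‖
      ≤ ‖∫ s, (w s - M.dAct θ s (M.avgNext u s) Δ) ∂M.visit θ‖ :=
    mul_le_of_le_one_left (norm_nonneg _) M.γ_lt_one.le
  refine (add_le_add (add_le_add (add_le_add b1 b2) (g1.trans b3)) (g2.trans b4)).trans
    (le_of_eq ?_)
  unfold visitQuad
  ring

end SmoothFamily

end ParamMDP

end

/-! ### The expected regularised reward, its score formula, and `J` as a visitation average. -/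

noncomputable section

namespace ParamMDP

variable {St Ac : Type*} [MeasurableSpace St] [MeasurableSpace Ac] {m k d : ℕ}
  {M : ParamMDP St Ac m k d} {L S C D : ℝ} {φ φ' : Euc k}

theorem measurable_regReward (M : ParamMDP St Ac m k d) :
    Measurable fun x : Euc k × (Euc m × St) × Ac => M.regReward x.1 x.2.1.1 x.2.1.2 x.2.2 := by
  have h1 : Measurable fun x : Euc k × (Euc m × St) × Ac => M.r x.1 x.2.1.2 x.2.2 :=
    M.r_meas.comp (f := fun x : Euc k × (Euc m × St) × Ac => (x.1, x.2.1.2, x.2.2)) (by fun_prop)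
  have h2 : Measurable fun x : Euc k × (Euc m × St) × Ac => M.pol x.2.1.1 x.2.1.2 x.2.2 :=
    M.pol_meas.comp measurable_snd
  exact h1.sub ((M.α_meas.comp measurable_fst).mul h2.log)

theorem measurable_regReward_right (M : ParamMDP St Ac m k d) (φ : Euc k) (θ : Euc m) :
    Measurable fun x : St × Ac => M.regReward φ θ x.1 x.2 :=
  M.measurable_regReward.comp (f := fun x : St × Ac => (φ, (θ, x.1), x.2)) (by fun_prop)

theorem bddMeas_expReward (hr : M.LipschitzReward L S C D) (hφ : φ ∈ M.rewardSet) (θ : Euc m) :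
    BddMeas (M.expReward φ θ) C :=
  ⟨(M.measurable_regReward_right φ θ).stronglyMeasurable.integral_kernel_prod_right
    (f := fun s a => M.regReward φ θ s a)
    (κ := M.policy.comap (fun s : St => (θ, s)) (by fun_prop)), hr.bounded φ hφ θ⟩

/-- The gradient `∇_θ E_{a ∼ π_θ(·|s)} r̃_{φ,θ}(s,a)`. -/
def gradReward (M : ParamMDP St Ac m k d) (φ : Euc k) (θ : Euc m) (s : St) : Euc m :=
  gradient (fun ϑ => M.expReward φ ϑ s) θ

theorem hasFDerivAt_expReward (hr : M.LipschitzReward L S C D) (hφ : φ ∈ M.rewardSet)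
    (θ : Euc m) (s : St) :
    HasFDerivAt (fun ϑ => M.expReward φ ϑ s) (innerSL ℝ (M.gradReward φ θ s)) θ :=
  (hr.diff φ hφ s θ).hasGradientAt.hasFDerivAt

theorem quadApprox_expReward (hr : M.LipschitzReward L S C D) (hC : 0 ≤ C) (hS : 0 ≤ S)
    (hφ : φ ∈ M.rewardSet) (s : St) :
    QuadApprox (fun θ => M.expReward φ θ s) (fun θ => innerSL ℝ (M.gradReward φ θ s))
      (C * (L ^ 2 + S)) := by
  refine .of_lipschitz_deriv (fun θ => hasFDerivAt_expReward hr hφ θ s) (by positivity)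
    fun x y => ?_
  rw [← map_sub, innerSL_apply_norm]
  exact convex_univ.norm_image_sub_le_of_norm_fderiv_le (𝕜 := ℝ)
    (f := fun θ => M.gradReward φ θ s) (fun z _ => hr.diff_grad φ hφ s z)
    (fun z _ => hr.hess_le φ hφ z s) trivial trivial

theorem integrable_regReward (hr : M.LipschitzReward L S C D) (hφ : φ ∈ M.rewardSet)
    (θ : Euc m) (s : St) : Integrable (M.regReward φ θ s) (M.policy (θ, s)) :=
  (hr.memLp φ hφ θ s).integrable (by norm_num)

theorem integrable_regReward_smul_score (hp : M.LipschitzPolicy L S)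
    (hr : M.LipschitzReward L S C D) (hφ : φ ∈ M.rewardSet) (θ : Euc m) (s : St) :
    Integrable (fun a => M.regReward φ θ s a • M.score θ s a) (M.policy (θ, s)) := by
  refine ((integrable_regReward hr hφ θ s).norm.mul_const L).mono'
    ((integrable_regReward hr hφ θ s).aestronglyMeasurable.smul
      (measurable_score_right hp θ s).aestronglyMeasurable) (ae_of_all _ fun a => ?_)
  rw [norm_smul]
  exact mul_le_mul_of_nonneg_left (hp.score_le _ _ _) (norm_nonneg _)

/-- The gradient of the expected regularised reward is the correlation of reward and score. -/
theorem gradReward_eq (hp : M.LipschitzPolicy L S) (hL : 0 ≤ L) (hS : 0 ≤ S)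
    (hr : M.LipschitzReward L S C D) (hφ : φ ∈ M.rewardSet) (θ : Euc m) (s : St) :
    M.gradReward φ θ s = ∫ a, M.regReward φ θ s a • M.score θ s a ∂M.policy (θ, s) := by
  set G := ∫ a, M.regReward φ θ s a • M.score θ s a ∂M.policy (θ, s) with hG
  have hi := integrable_regReward hr hφ θ s
  have hiG := integrable_regReward_smul_score hp hr hφ θ s
  have hpi := integrable_policy_iff.1 hi
  set K := (S + L ^ 2 * Real.exp L) * ∫ a, |M.regReward φ θ s a| ∂M.policy (θ, s)
    + |M.α φ| * (L * Real.exp L * L + S)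
  -- Existence of the derivative is assumed, so it is enough to identify it. A quadratic remainder
  -- near `θ` does this, and its constant may depend on `θ` and `s`.
  suffices h : HasFDerivAt (fun ϑ => M.expReward φ ϑ s) (innerSL ℝ G) θ by
    have := (hasFDerivAt_expReward hr hφ θ s).unique h
    exact (innerSL_inj (𝕜 := ℝ)).1 this
  refine hasFDerivAt_of_quadratic_remainder (K := K) fun θ' h1 => ?_
  set Δ := θ' - θ with hΔ
  have hinner : ⟪G, Δ⟫ = ∫ a, M.regReward φ θ s a * ⟪M.score θ s a, Δ⟫ ∂M.policy (θ, s) := by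
    rw [hG, real_inner_comm, ← integral_inner hiG]
    refine integral_congr_ae (ae_of_all _ fun a => ?_)
    simp only
    rw [real_inner_smul_right, real_inner_comm]
  have hiw : Integrable (fun a => ⟪M.score θ s a, Δ⟫) (M.policy (θ, s)) := by
    refine BddMeas.integrable (B := L * ‖Δ‖) ⟨?_, fun a => ?_⟩ _
    · exact ((measurable_score_right hp θ s).inner_const).stronglyMeasurable
    · exact (norm_inner_le_norm _ _).trans (by gcongr; exact hp.score_le _ _ _)
  have hirw : Integrable (fun a => M.regReward φ θ s a * ⟪M.score θ s a, Δ⟫)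
      (M.policy (θ, s)) := by
    have := hiG.inner_const (𝕜 := ℝ) Δ
    simp_rw [real_inner_smul_left] at this
    exact this
  -- The policy also enters the reward through `log π`, which adds a first order term `-α E[⟨score,
  -- Δ⟩] = 0`. Adding it to the integrand below makes the integrand of second order pointwise.
  have h0 : ∫ a, M.pol θ s a • ⟪M.score θ s a, Δ⟫ ∂M.base = 0 := by
    rw [← avgAct_eq_integral_base]; exact integral_inner_score hp hL hS θ s Δ
  have e : M.expReward φ θ' s - M.expReward φ θ s - innerSL ℝ G Δ
      = ∫ a, (M.pol θ' s a • M.regReward φ θ' s a - M.pol θ s a • M.regReward φ θ s a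
        - M.pol θ s a • (M.regReward φ θ s a * ⟪M.score θ s a, Δ⟫)
        + M.α φ * (M.pol θ s a • ⟪M.score θ s a, Δ⟫)) ∂M.base := by
    have i1 := integrable_policy_iff.1 (integrable_regReward hr hφ θ' s)
    have i2 := integrable_policy_iff.1 hirw
    have i3 := (integrable_policy_iff.1 hiw).const_mul (M.α φ)
    rw [integral_add (f := fun a => M.pol θ' s a • M.regReward φ θ' s a
        - M.pol θ s a • M.regReward φ θ s a
        - M.pol θ s a • (M.regReward φ θ s a * ⟪M.score θ s a, Δ⟫)) ((i1.sub hpi).sub i2) i3,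
      integral_const_mul, h0, mul_zero, add_zero,
      integral_sub (f := fun a => M.pol θ' s a • M.regReward φ θ' s a
        - M.pol θ s a • M.regReward φ θ s a) (i1.sub hpi) i2, integral_sub i1 hpi,
      innerSL_apply_apply, hinner, ← avgAct_eq_integral_base, ← avgAct_eq_integral_base,
      ← avgAct_eq_integral_base]
    rfl
  rw [e]
  refine (norm_integral_smul_base_le (M := M) (θ := θ) (s := s) (c := ‖Δ‖ ^ 2)
    (f := fun a => (S + L ^ 2 * Real.exp L) * |M.regReward φ θ s a|
      + |M.α φ| * (L * Real.exp L * L + S)) (fun a => ?_) ?_).trans (le_of_eq ?_)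
  · have hpos := M.pol_pos θ s a
    have b1 := abs_pol_sub_sub_le hp hL hS h1 s a
    have b2 := abs_pol_sub_le hp hL hS h1 s a
    have b3 := abs_log_pol_sub_le hp hS θ θ' s a
    have b4 := (quadApprox_log_pol hp hS s a).remainder θ θ'
    rw [innerSL_apply_apply, Real.norm_eq_abs] at b4
    rw [← hΔ] at b1 b2 b3 b4
    set u := Real.log (M.pol θ' s a) - Real.log (M.pol θ s a) with hu
    have hr' : M.regReward φ θ' s a = M.regReward φ θ s a - M.α φ * u := by
      unfold regReward; rw [hu]; ring
    set w := ⟪M.score θ s a, Δ⟫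
    set p := M.pol θ s a
    set p' := M.pol θ' s a
    set r := M.regReward φ θ s a
    rw [hr', show p' • (r - M.α φ * u) - p • r - p • (r * w) + M.α φ * p • w
      = (p' - p - p * w) * r - M.α φ * ((p' - p) * u + p * (u - w)) by
        simp only [smul_eq_mul]; ring, Real.norm_eq_abs]
    have c1 : |(p' - p - p * w) * r| ≤ p * ((S + L ^ 2 * Real.exp L) * ‖Δ‖ ^ 2) * |r| := by
      rw [abs_mul]; gcongr
    have c2 : |(p' - p) * u| ≤ p * (L * Real.exp L * ‖Δ‖) * (L * ‖Δ‖) := by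
      rw [abs_mul]; gcongr
    have c3 : |p * (u - w)| ≤ p * (S * ‖Δ‖ ^ 2) := by
      rw [abs_mul, abs_of_pos hpos]; gcongr
    have c4 : |M.α φ * ((p' - p) * u + p * (u - w))|
        ≤ |M.α φ| * (p * (L * Real.exp L * ‖Δ‖) * (L * ‖Δ‖) + p * (S * ‖Δ‖ ^ 2)) := by
      rw [abs_mul]
      gcongr
      exact (abs_add_le _ _).trans (add_le_add c2 c3)
    refine (abs_sub _ _).trans ((add_le_add c1 c4).trans (le_of_eq ?_))
    ring
  · exact (hi.abs.const_mul _).add (integrable_const _)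
  · rw [integral_add (hi.abs.const_mul _) (integrable_const _), integral_const_mul, integral_const,
      probReal_univ, one_smul]
    ring

/-- A gradient taken separately at each state has no evident measurability in the state; the score
formula provides it. -/
theorem bddMeas_gradReward (hp : M.LipschitzPolicy L S) (hL : 0 ≤ L) (hS : 0 ≤ S)
    (hr : M.LipschitzReward L S C D) (hφ : φ ∈ M.rewardSet) (θ : Euc m) :
    BddMeas (M.gradReward φ θ) (C * L) := by
  refine ⟨?_, hr.grad_le φ hφ θ⟩
  have h1 : M.gradReward φ θ
      = fun s => ∫ a, M.regReward φ θ s a • M.score θ s a ∂M.policy (θ, s) :=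
    funext fun s => gradReward_eq hp hL hS hr hφ θ s
  rw [h1]
  have hm : Measurable fun x : St × Ac => M.score θ x.1 x.2 :=
    (measurable_score hp).comp (f := fun x : St × Ac => ((θ, x.1), x.2)) (by fun_prop)
  exact ((M.measurable_regReward_right φ θ).stronglyMeasurable.smul
    hm.stronglyMeasurable).integral_kernel_prod_right (f := fun s a =>
      M.regReward φ θ s a • M.score θ s a)
    (κ := M.policy.comap (fun s : St => (θ, s)) (by fun_prop))

/-- Mean value inequality on the convex set of reward parameters, with derivatives relative to that
set. -/
theorem abs_expReward_sub_le (hr : M.LipschitzReward L S C D) (hφ : φ ∈ M.rewardSet)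
    (hφ' : φ' ∈ M.rewardSet) (θ : Euc m) (s : St) :
    |M.expReward φ' θ s - M.expReward φ θ s| ≤ D * ‖φ' - φ‖ := by
  choose! g hg hgD using fun ψ hψ => hr.grad_reward_le ψ hψ θ s
  refine M.convex_rewardSet.norm_image_sub_le_of_norm_hasFDerivWithin_le
    (f := fun ψ => M.expReward ψ θ s) (fun ψ hψ => (hg ψ hψ).hasFDerivWithinAt)
    (fun ψ hψ => ?_) hφ hφ'
  rw [LinearIsometryEquiv.norm_map]
  exact hgD ψ hψ

theorem smoothFamily_expReward (hp : M.LipschitzPolicy L S) (hL : 0 ≤ L) (hS : 0 ≤ S)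
    (hC : 0 ≤ C) (hr : M.LipschitzReward L S C D) (hφ : φ ∈ M.rewardSet) :
    M.SmoothFamily (fun θ => M.expReward φ θ) (fun θ s => innerSL ℝ (M.gradReward φ θ s))
      C (C * L) (C * (L ^ 2 + S)) where
  bdd := bddMeas_expReward hr hφ
  bdd_deriv θ := by
    have := bddMeas_gradReward hp hL hS hr hφ θ
    exact ⟨(innerSL ℝ).continuous.comp_stronglyMeasurable this.meas,
      fun s => (innerSL_apply_norm ℝ _).trans_le (this.bound s)⟩
  quad := quadApprox_expReward hr hC hS hφ

theorem J_eq (hr : M.LipschitzReward L S C D) (hφ : φ ∈ M.rewardSet) (θ : Euc m) :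
    M.J φ θ = (1 - M.γ)⁻¹ * ∫ s, M.expReward φ θ s ∂M.visit θ := by
  rw [integral_visit_eq_resolv (bddMeas_expReward hr hφ θ), smul_eq_mul, ← mul_assoc,
    inv_mul_cancel₀ M.one_sub_gamma_pos.ne', one_mul]
  rfl

end ParamMDP

end

/-! ### Smoothness of `A_θ`, of `ω*` and of `J`. -/

noncomputable section

section LinearSolve

variable {E F : Type*} [NormedAddCommGroup E] [NormedSpace ℝ E] [NormedAddCommGroup F]
  [NormedSpace ℝ F] {A : E → F →L[ℝ] F} {A' : E → E →L[ℝ] F →L[ℝ] F}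
  {b x : E → F} {b' : E → E →L[ℝ] F} {I : E → F →L[ℝ] F} {KA Kb LA Lb lam W : ℝ}

/-- Differentiating `A x = b` gives `A x' = b' - A' x`. The operator estimated here is the solution
of this equation, obtained through the right inverse `I`. -/
theorem norm_linear_solve_deriv_le (hA' : ∀ z, ‖A' z‖ ≤ LA) (hb' : ∀ z, ‖b' z‖ ≤ Lb)
    (hlam : 0 < lam) (hinv : ∀ z v, lam * ‖v‖ ≤ ‖A z v‖) (hI : ∀ z v, A z (I z v) = v)
    (hW : ∀ z, ‖x z‖ ≤ W) (z : E) :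
    ‖I z ∘L (b' z - (A' z).flip (x z))‖ ≤ (Lb + LA * W) / lam := by
  have hW0 : 0 ≤ W := (norm_nonneg _).trans (hW 0)
  have hLA : 0 ≤ LA := (norm_nonneg (A' 0)).trans (hA' 0)
  have hLb : 0 ≤ Lb := (norm_nonneg (b' 0)).trans (hb' 0)
  refine ContinuousLinearMap.opNorm_le_bound _ (by positivity) fun v => ?_
  rw [div_mul_eq_mul_div, le_div_iff₀ hlam, mul_comm]
  refine (hinv z _).trans ?_
  rw [ContinuousLinearMap.comp_apply, hI]
  refine (ContinuousLinearMap.le_opNorm _ _).trans ?_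
  gcongr
  refine (_root_.norm_sub_le _ _).trans (add_le_add (hb' z) ?_)
  refine ((A' z).flip.le_opNorm _).trans ?_
  rw [ContinuousLinearMap.opNorm_flip]
  exact mul_le_mul (hA' z) (hW z) (norm_nonneg _) hLA

/-- The solution of a uniformly invertible linear system with smooth coefficients is smooth. -/
theorem QuadApprox.linear_solve
    (hA : QuadApprox A A' KA) (hb : QuadApprox b b' Kb) (hA' : ∀ z, ‖A' z‖ ≤ LA)
    (hb' : ∀ z, ‖b' z‖ ≤ Lb)
    (hlam : 0 < lam) (hinv : ∀ z v, lam * ‖v‖ ≤ ‖A z v‖) (hI : ∀ z v, A z (I z v) = v)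
    (hx : ∀ z, A z (x z) = b z) (hW : ∀ z, ‖x z‖ ≤ W) :
    QuadApprox x (fun z => I z ∘L (b' z - (A' z).flip (x z)))
      ((Kb + KA * W + LA * ((Lb + LA * W) / lam)) / lam) := by
  have hKA := hA.nonneg
  have hKb := hb.nonneg
  have hW0 : 0 ≤ W := (norm_nonneg _).trans (hW 0)
  have hLA : 0 ≤ LA := (norm_nonneg (A' 0)).trans (hA' 0)
  have hLb : 0 ≤ Lb := (norm_nonneg (b' 0)).trans (hb' 0)
  have hLx : ∀ z w, ‖x w - x z‖ ≤ (Lb + LA * W) / lam * ‖w - z‖ := by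
    intro z w
    rw [div_mul_eq_mul_div, le_div_iff₀ hlam, mul_comm]
    refine (hinv w _).trans ?_
    have e : A w (x w - x z) = (b w - b z) - (A w - A z) (x z) := by
      simp only [map_sub, _root_.sub_apply, hx]
      abel
    have h1 := hb.norm_sub_le hb' z w
    have hAl := hA.norm_sub_le hA' z w
    have h3 : ‖(A w - A z) (x z)‖ ≤ LA * ‖w - z‖ * W :=
      (ContinuousLinearMap.le_opNorm _ _).trans
        (mul_le_mul hAl (hW z) (norm_nonneg _) (by positivity))
    rw [e]
    refine (_root_.norm_sub_le _ _).trans ((add_le_add h1 h3).trans (le_of_eq ?_))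
    ring
  set Lx := (Lb + LA * W) / lam
  refine ⟨by positivity, fun z w => ?_⟩
  rw [div_mul_eq_mul_div, le_div_iff₀ hlam, mul_comm]
  refine (hinv z _).trans ?_
  -- After applying `A z`, the remainder of `x` consists of the remainders of `b` and of `A` (the
  -- latter applied to `x z`) and a product of two Lipschitz increments.
  have e : A z (x w - x z - (I z ∘L (b' z - (A' z).flip (x z))) (w - z))
      = (b w - b z - b' z (w - z)) - (A w - A z - A' z (w - z)) (x z)
        - (A w - A z) (x w - x z) := by
    simp only [map_sub, ContinuousLinearMap.comp_apply, hI, _root_.sub_apply,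
      ContinuousLinearMap.flip_apply, hx]
    abel
  have h1 := hb.remainder z w
  have h2 : ‖(A w - A z - A' z (w - z)) (x z)‖ ≤ KA * ‖w - z‖ ^ 2 * W :=
    (ContinuousLinearMap.le_opNorm _ _).trans
      (mul_le_mul (hA.remainder z w) (hW z) (norm_nonneg _) (by positivity))
  have hAl := hA.norm_sub_le hA' z w
  have h3 : ‖(A w - A z) (x w - x z)‖ ≤ LA * ‖w - z‖ * (Lx * ‖w - z‖) :=
    (ContinuousLinearMap.le_opNorm _ _).trans
      (mul_le_mul hAl (hLx z w) (norm_nonneg _) (by positivity))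
  rw [e]
  refine (_root_.norm_sub_le _ _).trans ((add_le_add (_root_.norm_sub_le _ _) le_rfl).trans
    ((add_le_add (add_le_add h1 h2) h3).trans (le_of_eq ?_)))
  ring

end LinearSolve

namespace ParamMDP

variable {St Ac : Type*} [MeasurableSpace St] [MeasurableSpace Ac] {m k d : ℕ}
  {M : ParamMDP St Ac m k d} {L S C D lam : ℝ} {φ φ' : Euc k}

/-- Bound for the derivative of a visitation average of a smooth family. -/
def visitLip (γ L B₀ B₁ : ℝ) : ℝ := B₁ + γ * (L * (B₀ / (1 - γ)))

/-- Remainder constant of `θ ↦ (1 - γ) J_φ(θ)` and of `θ ↦ b_{φ,θ}`. -/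
def rewardQuad (γ L S C : ℝ) : ℝ := visitQuad γ L S C (C * L) (C * (L ^ 2 + S))

/-- Bound for the derivatives of `θ ↦ (1 - γ) J_φ(θ)` and of `θ ↦ b_{φ,θ}`. -/
def rewardLip (γ L C : ℝ) : ℝ := visitLip γ L C (C * L)

/-- Remainder constant of `θ ↦ A_θ`. -/
def matQuad (γ L S : ℝ) : ℝ := visitQuad γ L S 2 (L * 2) (polQuad L S * 2)

/-- Bound for the derivative of `θ ↦ A_θ`. -/
def matLip (γ L : ℝ) : ℝ := visitLip γ L 2 (L * 2)

/-- Bound for the derivative of `ω*` in the policy parameter. -/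
def starLip (γ lam L C : ℝ) : ℝ := (rewardLip γ L C + matLip γ L * (C / lam)) / lam

/-- Remainder constant of `ω*` in the policy parameter. -/
def starQuad (γ lam L S C : ℝ) : ℝ :=
  (rewardQuad γ L S C + matQuad γ L S * (C / lam) + matLip γ L * starLip γ lam L C) / lam

/-- The conditional expectation of `ϕ(s) (ϕ(s) - γ ϕ(s'))ᵀ` given `s` and `a`. -/
def featOp (M : ParamMDP St Ac m k d) (s : St) (a : Ac) : Euc d →L[ℝ] Euc d :=
  ∫ s', InnerProductSpace.rankOne ℝ (M.feat s) (M.feat s - M.γ • M.feat s') ∂M.P (s, a)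

theorem norm_feat_sub_le (M : ParamMDP St Ac m k d) (s s' : St) :
    ‖M.feat s - M.γ • M.feat s'‖ ≤ 2 := by
  refine (norm_sub_le _ _).trans ?_
  rw [norm_smul, Real.norm_of_nonneg M.γ_pos.le]
  nlinarith [M.norm_feat_le s, M.norm_feat_le s', M.γ_lt_one, M.γ_pos, norm_nonneg (M.feat s')]

theorem bddMeas_rankOne (M : ParamMDP St Ac m k d) :
    BddMeas (fun x : (St × Ac) × St => InnerProductSpace.rankOne ℝ (M.feat x.1.1)
      (M.feat x.1.1 - M.γ • M.feat x.2)) 2 := by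
  refine ⟨?_, fun x => ?_⟩
  · have h1 : Measurable fun x : (St × Ac) × St => M.feat x.1.1 :=
      M.feat_meas.comp (measurable_fst.comp measurable_fst)
    have h2 : Measurable fun x : (St × Ac) × St => M.feat x.1.1 - M.γ • M.feat x.2 :=
      h1.sub ((M.feat_meas.comp measurable_snd).const_smul M.γ)
    have h3 : (fun x : (St × Ac) × St => InnerProductSpace.rankOne ℝ (M.feat x.1.1)
        (M.feat x.1.1 - M.γ • M.feat x.2)) = fun x =>
          (innerSL ℝ (M.feat x.1.1 - M.γ • M.feat x.2)).smulRight (M.feat x.1.1) := by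
      ext x : 2
      simp [sub_smul, smul_smul]
    rw [h3]
    exact stronglyMeasurable_smulRight h2.stronglyMeasurable h1.stronglyMeasurable
  · rw [InnerProductSpace.norm_rankOne]
    nlinarith [M.norm_feat_sub_le x.1.1 x.2, M.norm_feat_le x.1.1, norm_nonneg (M.feat x.1.1),
      norm_nonneg (M.feat x.1.1 - M.γ • M.feat x.2)]

theorem bddMeas_featOp (M : ParamMDP St Ac m k d) : BddMeas (Function.uncurry M.featOp) 2 :=
  BddMeas.integral_kernel (κ := M.P) (f := fun (y : St × Ac) (s' : St) =>
    InnerProductSpace.rankOne ℝ (M.feat y.1) (M.feat y.1 - M.γ • M.feat s')) M.bddMeas_rankOne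

theorem bddMeas_featOp_left (M : ParamMDP St Ac m k d) (s : St) : BddMeas (M.featOp s) 2 :=
  ⟨M.bddMeas_featOp.meas.comp_measurable (measurable_prodMk_left (x := s)),
    fun a => M.bddMeas_featOp.bound (s, a)⟩

theorem smoothFamily_featOp (hp : M.LipschitzPolicy L S) (hL : 0 ≤ L) (hS : 0 ≤ S) :
    M.SmoothFamily (fun θ s => M.avgAct θ s (M.featOp s)) (fun θ s => M.dAct θ s (M.featOp s))
      2 (L * 2) (polQuad L S * 2) where
  bdd θ := bddMeas_avgAct M.bddMeas_featOp θ
  bdd_deriv θ := bddMeas_dAct hp θ M.bddMeas_featOp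
  quad s := quadApprox_avgAct hp hL hS (M.bddMeas_featOp_left s) s

theorem A_eq (M : ParamMDP St Ac m k d) (θ : Euc m) :
    M.A θ = ∫ s, M.avgAct θ s (M.featOp s) ∂M.visit θ := rfl

theorem b_eq (M : ParamMDP St Ac m k d) (φ : Euc k) (θ : Euc m) :
    M.b φ θ = ∫ s, M.expReward φ θ s • M.feat s ∂M.visit θ := by
  unfold b expReward
  simp_rw [integral_smul_const]

theorem bddMeas_feat (M : ParamMDP St Ac m k d) : BddMeas M.feat 1 :=
  ⟨M.feat_meas.stronglyMeasurable, M.norm_feat_le⟩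

theorem smoothFamily_expReward_smul_feat (hp : M.LipschitzPolicy L S) (hL : 0 ≤ L) (hS : 0 ≤ S)
    (hC : 0 ≤ C) (hr : M.LipschitzReward L S C D) (hφ : φ ∈ M.rewardSet) :
    M.SmoothFamily (fun θ s => M.expReward φ θ s • M.feat s)
      (fun θ s => (innerSL ℝ (M.gradReward φ θ s)).smulRight (M.feat s))
      C (C * L) (C * (L ^ 2 + S)) where
  bdd θ := by simpa using (bddMeas_expReward hr hφ θ).smul M.bddMeas_feat
  bdd_deriv θ := by
    have := bddMeas_gradReward hp hL hS hr hφ θ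
    refine ⟨stronglyMeasurable_smulRight this.meas M.bddMeas_feat.meas, fun s => ?_⟩
    simpa using norm_innerSL_smulRight_le (this.bound s) (M.norm_feat_le s)
  quad s := by
    have h := quadApprox_expReward hr hC hS hφ s
    refine ⟨h.nonneg, fun x y => ?_⟩
    rw [ContinuousLinearMap.smulRight_apply, ← sub_smul, ← sub_smul, norm_smul]
    exact (mul_le_of_le_one_right (norm_nonneg _) (M.norm_feat_le s)).trans (h.remainder x y)

theorem le_norm_A (hA : M.SufficientExploration lam) (θ : Euc m) (x : Euc d) :
    lam * ‖x‖ ≤ ‖M.A θ x‖ := by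
  rcases eq_or_ne x 0 with rfl | hx
  · simp
  have h1 : 0 < ‖x‖ := norm_pos_iff.2 hx
  have h2 := (hA θ x).trans (real_inner_le_norm _ _)
  nlinarith

/-- In finite dimension coercivity gives invertibility. It is needed because `Ring.inverse` is zero
off the units, so only now does `omegaStar` solve its linear system. -/
theorem isUnit_A (hlam : 0 < lam) (hA : M.SufficientExploration lam) (θ : Euc m) :
    IsUnit (M.A θ) := by
  have hinj : Function.Injective (M.A θ : Euc d →ₗ[ℝ] Euc d) := by
    refine (injective_iff_map_eq_zero _).2 fun x hx => ?_
    have h1 := le_norm_A hA θ x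
    rw [ContinuousLinearMap.coe_coe] at hx
    rw [hx, norm_zero] at h1
    exact norm_le_zero_iff.1 (nonpos_of_mul_nonpos_right h1 hlam)
  exact ⟨ContinuousLinearEquiv.toUnit
    (LinearEquiv.ofInjectiveEndo _ hinj).toContinuousLinearEquiv, by ext x; rfl⟩

theorem A_inverse_apply (hlam : 0 < lam) (hA : M.SufficientExploration lam) (θ : Euc m)
    (x : Euc d) : M.A θ (Ring.inverse (M.A θ) x) = x :=
  congrArg (fun T : Euc d →L[ℝ] Euc d => T x) (Ring.mul_inverse_cancel _ (isUnit_A hlam hA θ))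

theorem A_omegaStar (hlam : 0 < lam) (hA : M.SufficientExploration lam) (φ : Euc k)
    (θ : Euc m) : M.A θ (M.omegaStar φ θ) = M.b φ θ :=
  A_inverse_apply hlam hA θ _

theorem norm_b_le (hr : M.LipschitzReward L S C D) (hφ : φ ∈ M.rewardSet) (θ : Euc m) :
    ‖M.b φ θ‖ ≤ C := by
  rw [b_eq]
  simpa using ((bddMeas_expReward hr hφ θ).smul M.bddMeas_feat).norm_integral_le (M.visit θ)

theorem norm_omegaStar_le (hlam : 0 < lam) (hA : M.SufficientExploration lam)
    (hr : M.LipschitzReward L S C D) (hφ : φ ∈ M.rewardSet) (θ : Euc m) :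
    ‖M.omegaStar φ θ‖ ≤ C / lam := by
  rw [le_div_iff₀ hlam, mul_comm]
  refine (le_norm_A hA θ _).trans ?_
  rw [A_omegaStar hlam hA]
  exact norm_b_le hr hφ θ

/-- The matrix does not involve the reward parameter, so only `b` moves. -/
theorem norm_omegaStar_sub_le (hlam : 0 < lam) (hA : M.SufficientExploration lam)
    (hr : M.LipschitzReward L S C D) (hφ : φ ∈ M.rewardSet) (hφ' : φ' ∈ M.rewardSet)
    (θ : Euc m) : ‖M.omegaStar φ' θ - M.omegaStar φ θ‖ ≤ D / lam * ‖φ' - φ‖ := by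
  rw [div_mul_eq_mul_div, le_div_iff₀ hlam, mul_comm]
  refine (le_norm_A hA θ _).trans ?_
  have h1 := (bddMeas_expReward hr hφ θ).smul M.bddMeas_feat
  have h2 := (bddMeas_expReward hr hφ' θ).smul M.bddMeas_feat
  rw [map_sub, A_omegaStar hlam hA, A_omegaStar hlam hA, b_eq, b_eq,
    ← integral_sub (h2.integrable _) (h1.integrable _)]
  refine BddMeas.norm_integral_le ⟨(h2.sub h1).meas, fun s => ?_⟩ _
  rw [← sub_smul, norm_smul]
  exact (mul_le_of_le_one_right (norm_nonneg _) (M.norm_feat_le s)).trans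
    (abs_expReward_sub_le hr hφ hφ' θ s)

/-- The derivative of `ω*(φ,·)`. -/
def starDeriv (M : ParamMDP St Ac m k d) (φ : Euc k) (θ : Euc m) : Euc m →L[ℝ] Euc d :=
  Ring.inverse (M.A θ) ∘L
    (M.visitDeriv (fun θ s => M.expReward φ θ s • M.feat s)
      (fun θ s => (innerSL ℝ (M.gradReward φ θ s)).smulRight (M.feat s)) θ
    - (M.visitDeriv (fun θ s => M.avgAct θ s (M.featOp s))
        (fun θ s => M.dAct θ s (M.featOp s)) θ).flip (M.omegaStar φ θ))

theorem quadApprox_omegaStar (hlam : 0 < lam) (hA : M.SufficientExploration lam)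
    (hp : M.LipschitzPolicy L S) (hL : 0 ≤ L) (hS : 0 ≤ S) (hC : 0 ≤ C)
    (hr : M.LipschitzReward L S C D) (hφ : φ ∈ M.rewardSet) :
    QuadApprox (M.omegaStar φ) (M.starDeriv φ) (starQuad M.γ lam L S C) := by
  have h1 := smoothFamily_expReward_smul_feat hp hL hS hC hr hφ
  have h2 := smoothFamily_featOp hp hL hS
  have hb := h1.quadApprox_visit hp hL hS
  simp_rw [← b_eq] at hb
  exact QuadApprox.linear_solve (h2.quadApprox_visit hp hL hS) hb (h2.norm_visitDeriv_le hp)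
    (h1.norm_visitDeriv_le hp) hlam (fun θ => le_norm_A hA θ) (A_inverse_apply hlam hA)
    (A_omegaStar hlam hA φ) (norm_omegaStar_le hlam hA hr hφ)

theorem norm_starDeriv_le (hlam : 0 < lam) (hA : M.SufficientExploration lam)
    (hp : M.LipschitzPolicy L S) (hL : 0 ≤ L) (hS : 0 ≤ S) (hC : 0 ≤ C)
    (hr : M.LipschitzReward L S C D) (hφ : φ ∈ M.rewardSet) (θ : Euc m) :
    ‖M.starDeriv φ θ‖ ≤ starLip M.γ lam L C := by
  have h1 := smoothFamily_expReward_smul_feat hp hL hS hC hr hφ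
  have h2 := smoothFamily_featOp hp hL hS
  exact norm_linear_solve_deriv_le (A := M.A) (h2.norm_visitDeriv_le hp)
    (h1.norm_visitDeriv_le hp) hlam (fun θ => le_norm_A hA θ) (A_inverse_apply hlam hA)
    (norm_omegaStar_le hlam hA hr hφ) θ

/-- The derivative of `J_φ`. -/
def JDeriv (M : ParamMDP St Ac m k d) (φ : Euc k) (θ : Euc m) : Euc m →L[ℝ] ℝ :=
  (1 - M.γ)⁻¹ • M.visitDeriv (fun θ => M.expReward φ θ)
    (fun θ s => innerSL ℝ (M.gradReward φ θ s)) θ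

theorem quadApprox_J (hp : M.LipschitzPolicy L S) (hL : 0 ≤ L) (hS : 0 ≤ S) (hC : 0 ≤ C)
    (hr : M.LipschitzReward L S C D) (hφ : φ ∈ M.rewardSet) :
    QuadApprox (M.J φ) (M.JDeriv φ) ((1 - M.γ)⁻¹ * rewardQuad M.γ L S C) := by
  have h1 := (smoothFamily_expReward hp hL hS hC hr hφ).quadApprox_visit hp hL hS
  have h0 := inv_pos.2 M.one_sub_gamma_pos
  refine ⟨mul_nonneg h0.le h1.nonneg, fun x y => ?_⟩
  have e : M.J φ y - M.J φ x - M.JDeriv φ x (y - x) = (1 - M.γ)⁻¹ *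
      (∫ s, M.expReward φ y s ∂M.visit y - ∫ s, M.expReward φ x s ∂M.visit x
        - M.visitDeriv (fun θ => M.expReward φ θ)
          (fun θ s => innerSL ℝ (M.gradReward φ θ s)) x (y - x)) := by
    rw [J_eq hr hφ, J_eq hr hφ, mul_sub, mul_sub]
    rfl
  rw [e, norm_mul, Real.norm_of_nonneg h0.le, mul_assoc]
  exact mul_le_mul_of_nonneg_left (h1.remainder x y) h0.le

theorem differentiable_J (hp : M.LipschitzPolicy L S) (hL : 0 ≤ L) (hS : 0 ≤ S) (hC : 0 ≤ C)
    (hr : M.LipschitzReward L S C D) (hφ : φ ∈ M.rewardSet) : Differentiable ℝ (M.J φ) :=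
  fun θ => ((quadApprox_J hp hL hS hC hr hφ).hasFDerivAt θ).differentiableAt

theorem norm_JDeriv_le (hp : M.LipschitzPolicy L S) (hL : 0 ≤ L) (hS : 0 ≤ S) (hC : 0 ≤ C)
    (hr : M.LipschitzReward L S C D) (hφ : φ ∈ M.rewardSet) (θ : Euc m) :
    ‖M.JDeriv φ θ‖ ≤ (1 - M.γ)⁻¹ * rewardLip M.γ L C := by
  have h0 := inv_pos.2 M.one_sub_gamma_pos
  unfold JDeriv
  rw [norm_smul, Real.norm_of_nonneg h0.le]
  exact mul_le_mul_of_nonneg_left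
    ((smoothFamily_expReward hp hL hS hC hr hφ).norm_visitDeriv_le hp θ) h0.le

theorem JDeriv_eq_gradient (hp : M.LipschitzPolicy L S) (hL : 0 ≤ L) (hS : 0 ≤ S) (hC : 0 ≤ C)
    (hr : M.LipschitzReward L S C D) (hφ : φ ∈ M.rewardSet) (θ : Euc m) :
    innerSL ℝ (gradient (M.J φ) θ) = M.JDeriv φ θ :=
  ((differentiable_J hp hL hS hC hr hφ θ).hasGradientAt.hasFDerivAt).unique
    ((quadApprox_J hp hL hS hC hr hφ).hasFDerivAt θ)

theorem abs_J_le (hr : M.LipschitzReward L S C D) (hφ : φ ∈ M.rewardSet) (θ : Euc m) :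
    |M.J φ θ| ≤ (1 - M.γ)⁻¹ * C := by
  have h0 := inv_pos.2 M.one_sub_gamma_pos
  rw [J_eq hr hφ, abs_mul, abs_of_pos h0]
  exact mul_le_mul_of_nonneg_left ((bddMeas_expReward hr hφ θ).norm_integral_le _) h0.le

theorem abs_J_sub_le (hr : M.LipschitzReward L S C D) (hφ : φ ∈ M.rewardSet)
    (hφ' : φ' ∈ M.rewardSet) (θ : Euc m) :
    |M.J φ' θ - M.J φ θ| ≤ (1 - M.γ)⁻¹ * (D * ‖φ' - φ‖) := by
  have h0 := inv_pos.2 M.one_sub_gamma_pos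
  have h1 := bddMeas_expReward hr hφ θ
  have h2 := bddMeas_expReward hr hφ' θ
  rw [J_eq hr hφ, J_eq hr hφ', ← mul_sub, abs_mul, abs_of_pos h0,
    ← integral_sub (h2.integrable _) (h1.integrable _)]
  exact mul_le_mul_of_nonneg_left (BddMeas.norm_integral_le
    ⟨(h2.sub h1).meas, fun s => abs_expReward_sub_le hr hφ hφ' θ s⟩ _) h0.le

end ParamMDP

end

/-! ### Functions of the parameters with a common modulus of continuity. -/

noncomputable section

namespace ParamMDP

variable {St Ac : Type*} [MeasurableSpace St] [MeasurableSpace Ac] {m k d : ℕ}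

/-- The parameters `(φ, θ, ω)` visited by the algorithm. -/
abbrev Par (M : ParamMDP St Ac m k d) (R : ℝ) : Type :=
  {p : Euc k × Euc m × Euc d // p.1 ∈ M.rewardSet ∧ ‖p.2.2‖ ≤ R}

variable {M : ParamMDP St Ac m k d} {R : ℝ}

namespace Par

/-- reward parameter -/
abbrev φ (x : M.Par R) : Euc k := x.1.1

/-- policy parameter -/
abbrev θ (x : M.Par R) : Euc m := x.1.2.1

/-- critic parameter -/
abbrev ω (x : M.Par R) : Euc d := x.1.2.2

/-- The modulus of continuity in the parameters, of Hölder type in the reward parameter. -/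
def gap (x y : M.Par R) : ℝ := ‖y.θ - x.θ‖ + ‖y.ω - x.ω‖ + ‖y.φ - x.φ‖ + √‖y.φ - x.φ‖

theorem gap_nonneg (x y : M.Par R) : 0 ≤ gap x y := by unfold gap; positivity

theorem combine_le_mul_gap {x y : M.Par R} {a b c e K : ℝ} (hK : a + b + c + e ≤ K) (ha : 0 ≤ a)
    (hb : 0 ≤ b) (hc : 0 ≤ c) (he : 0 ≤ e) :
    a * ‖y.θ - x.θ‖ + b * ‖y.ω - x.ω‖ + c * ‖y.φ - x.φ‖ + e * √‖y.φ - x.φ‖ ≤ K * gap x y := by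
  refine le_trans ?_ (mul_le_mul_of_nonneg_right hK (gap_nonneg x y))
  unfold gap
  have h1 := norm_nonneg (y.θ - x.θ)
  have h2 := norm_nonneg (y.ω - x.ω)
  have h3 := norm_nonneg (y.φ - x.φ)
  have h4 := Real.sqrt_nonneg ‖y.φ - x.φ‖
  set p := ‖y.θ - x.θ‖
  set q := ‖y.ω - x.ω‖
  set r := ‖y.φ - x.φ‖
  set s := √r
  have := mul_nonneg (add_nonneg (add_nonneg hb hc) he) h1
  have := mul_nonneg (add_nonneg (add_nonneg ha hc) he) h2
  have := mul_nonneg (add_nonneg (add_nonneg ha hb) he) h3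
  have := mul_nonneg (add_nonneg (add_nonneg ha hb) hc) h4
  linarith

end Par

/-- `Q` is bounded by `B` and has modulus of continuity `Λ * gap`. -/
structure ParLip {E : Type*} [NormedAddCommGroup E] (Q : M.Par R → E) (B Λ : ℝ) : Prop where
  bound : ∀ x, ‖Q x‖ ≤ B
  lip : ∀ x y, ‖Q y - Q x‖ ≤ Λ * Par.gap x y

namespace ParLip

variable {E F : Type*} [NormedAddCommGroup E] [NormedSpace ℝ E] [NormedAddCommGroup F]
  [NormedSpace ℝ F] {Q Q' : M.Par R → E} {B B' Λ Λ' : ℝ}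

theorem continuous (h : ParLip Q B Λ) : Continuous Q := by
  refine continuous_iff_continuousAt.2 fun x => ?_
  have hc : Continuous fun y : M.Par R => Λ * Par.gap x y := by
    unfold Par.gap; fun_prop
  refine tendsto_iff_norm_sub_tendsto_zero.2 (squeeze_zero (fun _ => norm_nonneg _) (h.lip x) ?_)
  convert hc.tendsto x
  simp [Par.gap]

theorem add (h : ParLip Q B Λ) (h' : ParLip Q' B' Λ') :
    ParLip (fun x => Q x + Q' x) (B + B') (Λ + Λ') where
  bound x := (norm_add_le _ _).trans (add_le_add (h.bound x) (h'.bound x))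
  lip x y := by
    rw [add_sub_add_comm, add_mul]
    exact (norm_add_le _ _).trans (add_le_add (h.lip x y) (h'.lip x y))

theorem sub (h : ParLip Q B Λ) (h' : ParLip Q' B' Λ') :
    ParLip (fun x => Q x - Q' x) (B + B') (Λ + Λ') where
  bound x := (norm_sub_le _ _).trans (add_le_add (h.bound x) (h'.bound x))
  lip x y := by
    rw [sub_sub_sub_comm, add_mul]
    exact (norm_sub_le _ _).trans (add_le_add (h.lip x y) (h'.lip x y))

theorem clm_apply {T : M.Par R → E →L[ℝ] F} (hT : ParLip T B Λ) (h : ParLip Q B' Λ') :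
    ParLip (fun x => T x (Q x)) (B * B') (B * Λ' + Λ * B') where
  bound x := ((T x).le_opNorm _).trans (mul_le_mul (hT.bound x) (h.bound x) (norm_nonneg _)
    ((norm_nonneg _).trans (hT.bound x)))
  lip x y := by
    have e : T y (Q y) - T x (Q x) = T y (Q y - Q x) + (T y - T x) (Q x) := by
      simp only [map_sub, _root_.sub_apply]; abel
    rw [e, add_mul]
    refine (norm_add_le _ _).trans (add_le_add ?_ ?_)
    · refine ((T y).le_opNorm _).trans ?_
      rw [mul_assoc]
      exact mul_le_mul (hT.bound y) (h.lip x y) (norm_nonneg _)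
        ((norm_nonneg _).trans (hT.bound y))
    · refine ((T y - T x).le_opNorm _).trans ?_
      rw [mul_right_comm]
      exact mul_le_mul (hT.lip x y) (h.bound x) (norm_nonneg _)
        ((norm_nonneg _).trans (hT.lip x y))

theorem innerSL {V : Type*} [NormedAddCommGroup V] [InnerProductSpace ℝ V] {Q : M.Par R → V}
    (h : ParLip Q B Λ) : ParLip (fun x => innerSL ℝ (Q x)) B Λ where
  bound x := by rw [innerSL_apply_norm]; exact h.bound x
  lip x y := by rw [← map_sub, innerSL_apply_norm]; exact h.lip x y

theorem smul_const {q : M.Par R → ℝ} (h : ParLip q B Λ) (v : E) (hv : ‖v‖ ≤ 1) :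
    ParLip (fun x => q x • v) B Λ where
  bound x := by
    rw [norm_smul]
    exact (mul_le_of_le_one_right (norm_nonneg _) hv).trans (h.bound x)
  lip x y := by
    rw [← sub_smul, norm_smul]
    exact (mul_le_of_le_one_right (norm_nonneg _) hv).trans (h.lip x y)

end ParLip

end ParamMDP

end

/-! ### Moduli of continuity of the gradients and of the conditional mean increments. -/

noncomputable section

namespace ParamMDP

variable {St Ac : Type*} [MeasurableSpace St] [MeasurableSpace Ac] {m k d : ℕ}
  {M : ParamMDP St Ac m k d} {R L S C D lam : ℝ}

/-- The standing regularity hypotheses on the decision process. -/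
structure Regular (M : ParamMDP St Ac m k d) (lam L S C D : ℝ) : Prop where
  lam_pos : 0 < lam
  L_nonneg : 0 ≤ L
  S_nonneg : 0 ≤ S
  C_nonneg : 0 ≤ C
  D_nonneg : 0 ≤ D
  explore : M.SufficientExploration lam
  policy : M.LipschitzPolicy L S
  reward : M.LipschitzReward L S C D

variable (hM : M.Regular lam L S C D)

include hM

theorem Regular.starLip_nonneg (hne : M.rewardSet.Nonempty) : 0 ≤ starLip M.γ lam L C := by
  obtain ⟨φ, hφ⟩ := hne
  exact (norm_nonneg _).trans (norm_starDeriv_le hM.lam_pos hM.explore hM.policy hM.L_nonneg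
    hM.S_nonneg hM.C_nonneg hM.reward hφ 0)

theorem parLip_expReward (s : St) :
    ParLip (fun x : M.Par R => M.expReward x.φ x.θ s) C (C * L + D) where
  bound x := hM.reward.bounded _ x.2.1 _ s
  lip x y := by
    have h1 := (quadApprox_expReward hM.reward hM.C_nonneg hM.S_nonneg y.2.1 s).norm_sub_le
      (fun θ => (innerSL_apply_norm ℝ _).trans_le (hM.reward.grad_le _ y.2.1 θ s)) x.θ y.θ
    have h2 := abs_expReward_sub_le hM.reward x.2.1 y.2.1 x.θ s
    have h3 := Par.combine_le_mul_gap (x := x) (y := y) (a := C * L) (b := 0) (c := D) (e := 0)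
      (K := C * L + D) (by linarith) (mul_nonneg hM.C_nonneg hM.L_nonneg) le_rfl hM.D_nonneg le_rfl
    have h4 := norm_sub_le_norm_sub_add_norm_sub (M.expReward y.φ y.θ s) (M.expReward y.φ x.θ s)
      (M.expReward x.φ x.θ s)
    rw [Real.norm_eq_abs (M.expReward y.φ x.θ s - _)] at h4
    linarith

theorem parLip_omegaStar : ParLip (fun x : M.Par R => M.omegaStar x.φ x.θ) (C / lam)
    (starLip M.γ lam L C + D / lam) where
  bound x := norm_omegaStar_le hM.lam_pos hM.explore hM.reward x.2.1 x.θ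
  lip x y := by
    have h1 := (quadApprox_omegaStar hM.lam_pos hM.explore hM.policy hM.L_nonneg hM.S_nonneg
      hM.C_nonneg hM.reward y.2.1).norm_sub_le (norm_starDeriv_le hM.lam_pos hM.explore hM.policy
        hM.L_nonneg hM.S_nonneg hM.C_nonneg hM.reward y.2.1) x.θ y.θ
    have h2 := norm_omegaStar_sub_le hM.lam_pos hM.explore hM.reward x.2.1 y.2.1 x.θ
    have h3 := Par.combine_le_mul_gap (x := x) (y := y) (a := starLip M.γ lam L C) (b := 0)
      (c := D / lam) (e := 0) (K := starLip M.γ lam L C + D / lam) (by linarith)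
      (hM.starLip_nonneg ⟨_, x.2.1⟩) le_rfl (div_nonneg hM.D_nonneg hM.lam_pos.le) le_rfl
    have h4 := norm_sub_le_norm_sub_add_norm_sub (M.omegaStar y.φ y.θ) (M.omegaStar y.φ x.θ)
      (M.omegaStar x.φ x.θ)
    linarith

omit hM in
theorem parLip_omega : ParLip (fun x : M.Par R => x.ω) R 1 where
  bound x := x.2.2
  lip x y := by
    have h3 := Par.combine_le_mul_gap (x := x) (y := y) (a := 0) (b := 1) (c := 0) (e := 0)
      (K := 1) (by linarith) le_rfl zero_le_one le_rfl le_rfl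
    linarith

/-- The critic error `ω - ω*(φ,θ)`. -/
def critErr (M : ParamMDP St Ac m k d) {R : ℝ} (x : M.Par R) : Euc d := x.ω - M.omegaStar x.φ x.θ

/-- Bound for the critic error. -/
def errBound (lam C R : ℝ) : ℝ := R + C / lam

/-- Modulus constant of the critic error. -/
def errMod (γ lam L C D : ℝ) : ℝ := 1 + (starLip γ lam L C + D / lam)

theorem parLip_critErr : ParLip (fun x : M.Par R => M.critErr x) (errBound lam C R)
    (errMod M.γ lam L C D) :=
  parLip_omega.sub (parLip_omegaStar hM)

theorem parLip_avgAct_featOp (s : St) :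
    ParLip (fun x : M.Par R => M.avgAct x.θ s (M.featOp s)) 2 (polLip L * 2) where
  bound x := norm_avgAct_le (M.bddMeas_featOp_left s) _ _
  lip x y := by
    have h1 := norm_avgAct_sub_le hM.policy hM.L_nonneg hM.S_nonneg (M.bddMeas_featOp_left s)
      x.θ y.θ s
    have h2 := polLip_nonneg hM.L_nonneg
    have h3 := Par.combine_le_mul_gap (x := x) (y := y) (a := polLip L * 2) (b := 0) (c := 0)
      (e := 0) (K := polLip L * 2) (by linarith) (by positivity) le_rfl le_rfl le_rfl
    linarith

/-- The conditional expectation given `s` of the inner product of the critic error with the critic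
increment. -/
def critNoise (M : ParamMDP St Ac m k d) {R : ℝ} (x : M.Par R) (s : St) : ℝ :=
  innerSL ℝ (M.critErr x)
    (M.expReward x.φ x.θ s • M.feat s - M.avgAct x.θ s (M.featOp s) x.ω)

/-- Bound for `critNoise`. -/
def critNoiseBound (lam C R : ℝ) : ℝ := errBound lam C R * (C + 2 * R)

/-- Modulus constant of `critNoise`. -/
def critNoiseMod (γ lam L C D R : ℝ) : ℝ :=
  errBound lam C R * (C * L + D + (2 * 1 + polLip L * 2 * R))
    + errMod γ lam L C D * (C + 2 * R)

theorem parLip_critNoise (s : St) : ParLip (fun x : M.Par R => M.critNoise x s)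
    (critNoiseBound lam C R) (critNoiseMod M.γ lam L C D R) :=
  (parLip_critErr hM).innerSL.clm_apply
    (((parLip_expReward hM s).smul_const _ (M.norm_feat_le s)).sub
      ((parLip_avgAct_featOp hM s).clm_apply parLip_omega))

/-- Hölder constant in the reward parameter of the derivative of a function with remainder constant
`K` which is Lipschitz in the reward parameter with constant `D`. -/
def holder (K D : ℝ) : ℝ := 6 * K + (2 + 2 * K) * √D

-- In `θ` the derivative is Lipschitz by `QuadApprox.deriv_sub_le`. In `φ` only `f` itself is known
-- to be Lipschitz, and the interpolation `deriv_sub_le_sqrt` leaves exponent `1/2` for the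
-- derivative. This is the origin of the square root in `Par.gap`.
omit hM in
theorem QuadApprox.parLip_deriv {F : Type*} [NormedAddCommGroup F] [NormedSpace ℝ F]
    {f : Euc k → Euc m → F} {f' : Euc k → Euc m → Euc m →L[ℝ] F} {K B δ : ℝ}
    (hf : ∀ φ ∈ M.rewardSet, QuadApprox (f φ) (f' φ) K) (hB : ∀ φ ∈ M.rewardSet, ∀ θ, ‖f' φ θ‖ ≤ B)
    (hδ : 0 ≤ δ) (hφ : ∀ φ ∈ M.rewardSet, ∀ φ' ∈ M.rewardSet, ∀ θ,
      ‖f φ' θ - f φ θ‖ ≤ δ * ‖φ' - φ‖) :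
    ParLip (fun x : M.Par R => f' x.φ x.θ) B (holder K δ) where
  bound x := hB _ x.2.1 _
  lip x y := by
    have hK := (hf _ x.2.1).nonneg
    have h1 := (hf _ y.2.1).deriv_sub_le x.θ y.θ
    have h2 := (hf _ y.2.1).deriv_sub_le_sqrt (hf _ x.2.1) (hφ _ x.2.1 _ y.2.1) x.θ
    have h3 := Par.combine_le_mul_gap (x := x) (y := y) (a := 6 * K) (b := 0)
      (c := 0) (e := (2 + 2 * K) * √δ) (K := holder K δ) (by unfold holder; linarith)
      (by positivity) le_rfl le_rfl (by positivity)
    have h4 := norm_sub_le_norm_sub_add_norm_sub (f' y.φ y.θ) (f' y.φ x.θ) (f' x.φ x.θ)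
    rw [Real.sqrt_mul hδ] at h2
    linarith

theorem parLip_JDeriv : ParLip (fun x : M.Par R => M.JDeriv x.φ x.θ)
    ((1 - M.γ)⁻¹ * rewardLip M.γ L C)
    (holder ((1 - M.γ)⁻¹ * rewardQuad M.γ L S C) ((1 - M.γ)⁻¹ * D)) := by
  refine QuadApprox.parLip_deriv (f := M.J) (fun _ hφ => quadApprox_J hM.policy hM.L_nonneg
    hM.S_nonneg hM.C_nonneg hM.reward hφ) (fun _ hφ => norm_JDeriv_le hM.policy hM.L_nonneg
    hM.S_nonneg hM.C_nonneg hM.reward hφ)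
    (mul_nonneg (inv_pos.2 M.one_sub_gamma_pos).le hM.D_nonneg) (fun _ hφ _ hφ' θ => ?_)
  rw [mul_assoc]
  exact abs_J_sub_le hM.reward hφ hφ' θ

theorem parLip_starDeriv : ParLip (fun x : M.Par R => M.starDeriv x.φ x.θ)
    (starLip M.γ lam L C) (holder (starQuad M.γ lam L S C) (D / lam)) :=
  QuadApprox.parLip_deriv (f := M.omegaStar) (fun _ hφ => quadApprox_omegaStar hM.lam_pos hM.explore
    hM.policy hM.L_nonneg hM.S_nonneg hM.C_nonneg hM.reward hφ) (fun _ hφ => norm_starDeriv_le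
    hM.lam_pos hM.explore hM.policy hM.L_nonneg hM.S_nonneg hM.C_nonneg hM.reward hφ)
    (div_nonneg hM.D_nonneg hM.lam_pos.le)
    (fun _ hφ _ hφ' θ => norm_omegaStar_sub_le hM.lam_pos hM.explore hM.reward hφ hφ' θ)

theorem parLip_gradReward (s : St) :
    ParLip (fun x : M.Par R => innerSL ℝ (M.gradReward x.φ x.θ s)) (C * L)
      (holder (C * (L ^ 2 + S)) D) :=
  QuadApprox.parLip_deriv (f := fun φ θ => M.expReward φ θ s)
    (f' := fun φ θ => innerSL ℝ (M.gradReward φ θ s))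
    (fun _ hφ => quadApprox_expReward hM.reward hM.C_nonneg hM.S_nonneg hφ s)
    (fun _ hφ θ => (innerSL_apply_norm ℝ _).trans_le (hM.reward.grad_le _ hφ θ s)) hM.D_nonneg
    (fun _ hφ _ hφ' θ => abs_expReward_sub_le hM.reward hφ hφ' θ s)

omit hM in
theorem bddMeas_inner_feat (M : ParamMDP St Ac m k d) (w : Euc d) :
    BddMeas (fun s => ⟪M.feat s, w⟫) ‖w‖ :=
  ⟨(M.feat_meas.inner_const).stronglyMeasurable, fun s => (norm_inner_le_norm _ _).trans
    (mul_le_of_le_one_left (norm_nonneg _) (M.norm_feat_le s))⟩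

/-- The derivative in the policy parameter of the expected next value of the critic. -/
def nextDir (M : ParamMDP St Ac m k d) {R : ℝ} (x : M.Par R) (s : St) : Euc m →L[ℝ] ℝ :=
  M.dAct x.θ s (M.avgNext (fun s' => ⟪M.feat s', x.ω⟫) s)

omit hM in
theorem avgNext_inner_sub (w w' : Euc d) (s : St) (a : Ac) :
    M.avgNext (fun s' => ⟪M.feat s', w' - w⟫) s a
      = M.avgNext (fun s' => ⟪M.feat s', w'⟫) s a - M.avgNext (fun s' => ⟪M.feat s', w⟫) s a := by
  unfold avgNext
  rw [← integral_sub ((M.bddMeas_inner_feat w').integrable _)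
    ((M.bddMeas_inner_feat w).integrable _)]
  simp_rw [inner_sub_right]

theorem dAct_sub {f g : Ac → ℝ} {B B' : ℝ} (hf : BddMeas f B) (hg : BddMeas g B') (θ : Euc m)
    (s : St) : M.dAct θ s (fun a => f a - g a) = M.dAct θ s f - M.dAct θ s g := by
  unfold dAct
  rw [← integral_sub ((bddMeas_score_smulRight_left hM.policy θ s hf).integrable _)
    ((bddMeas_score_smulRight_left hM.policy θ s hg).integrable _)]
  congr 1
  funext a
  ext v
  simp [mul_sub]

/-- The direction is linear in `ω`, and in `θ` it is the derivative of a function with uniform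
quadratic remainder. No reward parameter is involved, so no square root arises. -/
theorem parLip_nextDir (hR : 0 ≤ R) (s : St) : ParLip (fun x : M.Par R => M.nextDir x s) (L * R)
    (6 * (polQuad L S * R) + L) where
  bound x := norm_dAct_le hM.policy _ _
    (bddMeas_avgNext_left ((M.bddMeas_inner_feat x.ω).mono x.2.2) s)
  lip x y := by
    have hy := bddMeas_avgNext_left (M := M) ((M.bddMeas_inner_feat y.ω).mono y.2.2) s
    have hx := bddMeas_avgNext_left (M := M) ((M.bddMeas_inner_feat x.ω).mono x.2.2) s
    have hd := bddMeas_avgNext_left (M := M) (M.bddMeas_inner_feat (y.ω - x.ω)) s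
    have h1 := (quadApprox_avgAct hM.policy hM.L_nonneg hM.S_nonneg hy s).deriv_sub_le x.θ y.θ
    have h2 := norm_dAct_le hM.policy x.θ s hd
    have e : M.avgNext (fun s' => ⟪M.feat s', y.ω - x.ω⟫) s = fun a =>
        M.avgNext (fun s' => ⟪M.feat s', y.ω⟫) s a - M.avgNext (fun s' => ⟪M.feat s', x.ω⟫) s a :=
      funext fun a => avgNext_inner_sub _ _ s a
    rw [e, dAct_sub hM hy hx] at h2
    have hq := polQuad_nonneg hM.L_nonneg hM.S_nonneg
    have h3 := Par.combine_le_mul_gap (x := x) (y := y) (a := 6 * (polQuad L S * R)) (b := L)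
      (c := 0) (e := 0) (K := 6 * (polQuad L S * R) + L) (by linarith) (by positivity)
      hM.L_nonneg le_rfl le_rfl
    have h4 := norm_sub_le_norm_sub_add_norm_sub
      (M.dAct y.θ s (M.avgNext (fun s' => ⟪M.feat s', y.ω⟫) s))
      (M.dAct x.θ s (M.avgNext (fun s' => ⟪M.feat s', y.ω⟫) s))
      (M.dAct x.θ s (M.avgNext (fun s' => ⟪M.feat s', x.ω⟫) s))
    unfold nextDir
    linarith

/-- The conditional expectation given `s` of the actor increment (as a functional). -/
def actorDir (M : ParamMDP St Ac m k d) {R : ℝ} (x : M.Par R) (s : St) : Euc m →L[ℝ] ℝ :=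
  innerSL ℝ (M.gradReward x.φ x.θ s) + M.γ • M.nextDir x s

/-- Bound for `actorDir`. -/
def dirBound (L C R : ℝ) : ℝ := C * L + L * R

/-- Modulus constant of `actorDir`. -/
def dirMod (L S C D R : ℝ) : ℝ := holder (C * (L ^ 2 + S)) D + (6 * (polQuad L S * R) + L)

theorem parLip_actorDir (hR : 0 ≤ R) (s : St) : ParLip (fun x : M.Par R => M.actorDir x s)
    (dirBound L C R) (dirMod L S C D R) := by
  have h1 := parLip_nextDir (R := R) hM hR s
  have h2 : ParLip (fun x : M.Par R => M.γ • M.nextDir x s) (L * R)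
      (6 * (polQuad L S * R) + L) := by
    refine ⟨fun x => ?_, fun x y => ?_⟩
    · rw [norm_smul, Real.norm_of_nonneg M.γ_pos.le]
      exact (mul_le_of_le_one_left (norm_nonneg _) M.γ_lt_one.le).trans (h1.bound x)
    · have e : M.γ • M.nextDir y s - M.γ • M.nextDir x s
          = M.γ • (M.nextDir y s - M.nextDir x s) := (smul_sub _ _ _).symm
      rw [e, norm_smul, Real.norm_of_nonneg M.γ_pos.le]
      exact (mul_le_of_le_one_left (norm_nonneg _) M.γ_lt_one.le).trans (h1.lip x y)
  exact (parLip_gradReward hM s).add h2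

/-- The gradient of `J_φ`. -/
def gradJ (M : ParamMDP St Ac m k d) {R : ℝ} (x : M.Par R) : Euc m := gradient (M.J x.φ) x.θ

/-- The gradient in `θ` of the inner product of the critic error with `ω*(φ,θ)`. -/
def starDir (M : ParamMDP St Ac m k d) {R : ℝ} (x : M.Par R) : Euc m :=
  ContinuousLinearMap.adjoint (M.starDeriv x.φ x.θ) (M.critErr x)

/-- Bound for `gradJ`. -/
def gradBound (γ L C : ℝ) : ℝ := (1 - γ)⁻¹ * rewardLip γ L C

/-- Modulus constant of `gradJ`. -/
def gradMod (γ L S C D : ℝ) : ℝ :=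
  holder ((1 - γ)⁻¹ * rewardQuad γ L S C) ((1 - γ)⁻¹ * D)

theorem parLip_gradJ : ParLip (fun x : M.Par R => M.gradJ x) (gradBound M.γ L C)
    (gradMod M.γ L S C D) := by
  have h := parLip_JDeriv (R := R) hM
  have e : ∀ x : M.Par R, M.JDeriv x.φ x.θ = innerSL ℝ (M.gradJ x) := fun x =>
    (JDeriv_eq_gradient hM.policy hM.L_nonneg hM.S_nonneg hM.C_nonneg hM.reward x.2.1 x.θ).symm
  refine ⟨fun x => ?_, fun x y => ?_⟩
  · rw [← innerSL_apply_norm ℝ, ← e]; exact h.bound x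
  · rw [← innerSL_apply_norm ℝ, map_sub, ← e, ← e]; exact h.lip x y

theorem parLip_starDir : ParLip (fun x : M.Par R => M.starDir x)
    (starLip M.γ lam L C * errBound lam C R)
    (starLip M.γ lam L C * errMod M.γ lam L C D
      + holder (starQuad M.γ lam L S C) (D / lam) * errBound lam C R) := by
  have h := parLip_starDeriv (R := R) hM
  have h1 : ParLip (fun x : M.Par R => ContinuousLinearMap.adjoint (M.starDeriv x.φ x.θ))
      (starLip M.γ lam L C) (holder (starQuad M.γ lam L S C) (D / lam)) := by
    refine ⟨fun x => ?_, fun x y => ?_⟩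
    · rw [LinearIsometryEquiv.norm_map]; exact h.bound x
    · rw [← map_sub, LinearIsometryEquiv.norm_map]; exact h.lip x y
  exact h1.clm_apply (parLip_critErr hM)

/-- The conditional expectation given `s` of the inner product of `∇J_φ` with the actor
increment. -/
def actorNoise (M : ParamMDP St Ac m k d) {R : ℝ} (x : M.Par R) (s : St) : ℝ :=
  M.actorDir x s (M.gradJ x)

/-- The conditional expectation given `s` of the inner product of the critic error with the linear
part of the drift of `ω*`. -/
def starNoise (M : ParamMDP St Ac m k d) {R : ℝ} (x : M.Par R) (s : St) : ℝ :=
  M.actorDir x s (M.starDir x)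

theorem parLip_actorNoise (hR : 0 ≤ R) (s : St) : ParLip (fun x : M.Par R => M.actorNoise x s)
    (dirBound L C R * gradBound M.γ L C)
    (dirBound L C R * gradMod M.γ L S C D + dirMod L S C D R * gradBound M.γ L C) :=
  (parLip_actorDir hM hR s).clm_apply (parLip_gradJ hM)

theorem parLip_starNoise (hR : 0 ≤ R) (s : St) : ParLip (fun x : M.Par R => M.starNoise x s)
    (dirBound L C R * (starLip M.γ lam L C * errBound lam C R))
    (dirBound L C R * (starLip M.γ lam L C * errMod M.γ lam L C D
      + holder (starQuad M.γ lam L S C) (D / lam) * errBound lam C R)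
      + dirMod L S C D R * (starLip M.γ lam L C * errBound lam C R)) :=
  (parLip_actorDir hM hR s).clm_apply (parLip_starDir hM)

omit hM in
theorem stronglyMeasurable_clm_apply {α E F : Type*} [MeasurableSpace α] [NormedAddCommGroup E]
    [NormedSpace ℝ E] [NormedAddCommGroup F] [NormedSpace ℝ F] {T : α → E →L[ℝ] F}
    (hT : StronglyMeasurable T) (v : E) : StronglyMeasurable fun a => T a v :=
  (ContinuousLinearMap.apply ℝ F v).continuous.comp_stronglyMeasurable hT

theorem bddMeas_actorDir (hR : 0 ≤ R) (x : M.Par R) :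
    BddMeas (M.actorDir x) (dirBound L C R) := by
  refine ⟨?_, fun s => (parLip_actorDir hM hR s).bound x⟩
  have h1 := bddMeas_gradReward hM.policy hM.L_nonneg hM.S_nonneg hM.reward x.2.1 x.θ
  have h2 := bddMeas_dAct hM.policy x.θ (bddMeas_avgNext (M := M) (M.bddMeas_inner_feat x.ω))
  exact ((innerSL ℝ).continuous.comp_stronglyMeasurable h1.meas).add (h2.meas.const_smul M.γ)

theorem bddMeas_actorNoise (hR : 0 ≤ R) (x : M.Par R) :
    BddMeas (M.actorNoise x) (dirBound L C R * gradBound M.γ L C) :=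
  ⟨stronglyMeasurable_clm_apply (bddMeas_actorDir hM hR x).meas _,
    fun s => (parLip_actorNoise hM hR s).bound x⟩

theorem bddMeas_starNoise (hR : 0 ≤ R) (x : M.Par R) :
    BddMeas (M.starNoise x) (dirBound L C R * (starLip M.γ lam L C * errBound lam C R)) :=
  ⟨stronglyMeasurable_clm_apply (bddMeas_actorDir hM hR x).meas _,
    fun s => (parLip_starNoise hM hR s).bound x⟩

theorem bddMeas_critNoise (x : M.Par R) :
    BddMeas (M.critNoise x) (critNoiseBound lam C R) := by
  refine ⟨?_, fun s => (parLip_critNoise hM s).bound x⟩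
  refine (innerSL ℝ (M.critErr x)).continuous.comp_stronglyMeasurable (StronglyMeasurable.sub ?_ ?_)
  · exact (bddMeas_expReward hM.reward x.2.1 x.θ).meas.smul M.bddMeas_feat.meas
  · exact stronglyMeasurable_clm_apply (bddMeas_avgAct M.bddMeas_featOp x.θ).meas x.ω

end ParamMDP

end

/-! ### Stationary means of the three noises, and the Poisson equation. -/

noncomputable section

/-- Nonnegativity of the variance of `|f|`. -/
theorem sq_integral_abs_le {α : Type*} [MeasurableSpace α] {f : α → ℝ} {B : ℝ} (hf : BddMeas f B)
    (μ : Measure α) [IsProbabilityMeasure μ] : (∫ x, |f x| ∂μ) ^ 2 ≤ ∫ x, f x ^ 2 ∂μ := by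
  set c := ∫ x, |f x| ∂μ with hc
  have h2 : BddMeas (fun x => f x • f x) (B * B) := hf.smul hf
  have h0 : 0 ≤ ∫ x, (|f x| - c) ^ 2 ∂μ := integral_nonneg fun x => sq_nonneg _
  have e : ∀ x, (|f x| - c) ^ 2 = f x • f x - (2 * c) * |f x| + c ^ 2 := fun x => by
    rw [smul_eq_mul, sub_sq, sq_abs]; ring
  simp_rw [e] at h0
  have hi := hf.norm.integrable μ
  simp only [Real.norm_eq_abs] at hi
  rw [integral_add (f := fun x => f x • f x - (2 * c) * |f x|)
      ((h2.integrable μ).sub (hi.const_mul _)) (integrable_const _),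
    integral_sub (h2.integrable μ) (hi.const_mul _), integral_const_mul, ← hc] at h0
  simp only [smul_eq_mul, ← sq, integral_const, probReal_univ, one_mul] at h0
  linarith

namespace ParamMDP

variable {St Ac : Type*} [MeasurableSpace St] [MeasurableSpace Ac] {m k d : ℕ}
  {M : ParamMDP St Ac m k d} {R L S C D lam : ℝ}

/-- The pointwise error of the best linear critic. -/
def linErr (M : ParamMDP St Ac m k d) (φ : Euc k) (θ : Euc m) (s : St) : ℝ :=
  ⟪M.feat s, M.omegaStar φ θ⟫ - M.value φ θ s

variable (hM : M.Regular lam L S C D)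

include hM

theorem bddMeas_value {φ : Euc k} (hφ : φ ∈ M.rewardSet) (θ : Euc m) :
    BddMeas (M.value φ θ) (C / (1 - M.γ)) :=
  bddMeas_resolv (bddMeas_expReward hM.reward hφ θ) θ

theorem bddMeas_linErr {φ : Euc k} (hφ : φ ∈ M.rewardSet) (θ : Euc m) :
    BddMeas (M.linErr φ θ) (C / lam + C / (1 - M.γ)) :=
  ((M.bddMeas_inner_feat _).mono (norm_omegaStar_le hM.lam_pos hM.explore hM.reward hφ θ)).sub
    (bddMeas_value hM hφ θ)

theorem sqrt_linErr_le {φ : Euc k} (hφ : φ ∈ M.rewardSet) (θ : Euc m) :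
    √(∫ s, M.linErr φ θ s ^ 2 ∂M.visit θ) ≤ C / lam + C / (1 - M.γ) := by
  have h := bddMeas_linErr hM hφ θ
  have := M.nonempty_state
  have h2 := (h.smul h).norm_integral_le (M.visit θ)
  simp only [smul_eq_mul, ← sq] at h2
  exact Real.sqrt_le_iff.2 ⟨h.nonneg, (le_abs_self _).trans h2⟩

theorem approxError_le : M.approxError ≤ C / lam + C / (1 - M.γ) :=
  Real.iSup_le (fun x => sqrt_linErr_le hM x.1.2 x.2)
    (add_nonneg (div_nonneg hM.C_nonneg hM.lam_pos.le)
      (div_nonneg hM.C_nonneg M.one_sub_gamma_pos.le))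

omit hM in
theorem approxError_nonneg (M : ParamMDP St Ac m k d) : 0 ≤ M.approxError :=
  Real.iSup_nonneg fun _ => Real.sqrt_nonneg _

theorem integral_sq_linErr_le {φ : Euc k} (hφ : φ ∈ M.rewardSet) (θ : Euc m) :
    ∫ s, M.linErr φ θ s ^ 2 ∂M.visit θ ≤ M.approxError ^ 2 := by
  have h0 : 0 ≤ ∫ s, M.linErr φ θ s ^ 2 ∂M.visit θ := integral_nonneg fun s => sq_nonneg _
  rw [← Real.sq_sqrt h0]
  -- A supremum of reals dominates its terms only when the range is bounded above, hence the a
  -- priori bound on the approximation error.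
  have hb : BddAbove (Set.range fun x : M.rewardSet × Euc m =>
      √(∫ s, M.linErr x.1 x.2 s ^ 2 ∂M.visit x.2)) :=
    ⟨_, by rintro _ ⟨x, rfl⟩; exact sqrt_linErr_le hM x.1.2 x.2⟩
  exact pow_le_pow_left₀ (Real.sqrt_nonneg _) (le_ciSup hb (⟨φ, hφ⟩, θ)) 2

/-- The critic is evaluated at the next state, while `ε` is measured under `ν_θ`. The law `μ` of the
next state satisfies `γ μ ≤ ν_θ`, so the square of the left side is at most `γ² μ(e²) ≤ γ μ(e²) ≤
ε²`, with `e` the linear error. -/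
theorem gamma_mul_integral_trans_linErr_le {φ : Euc k} (hφ : φ ∈ M.rewardSet) (θ : Euc m) :
    M.γ * ∫ s, M.trans θ (fun s => |M.linErr φ θ s|) s ∂M.visit θ ≤ M.approxError := by
  have h := bddMeas_linErr hM hφ θ
  have ha : BddMeas (fun s => |M.linErr φ θ s|) (C / lam + C / (1 - M.γ)) := h.norm
  set μ := (M.visit θ).bind (M.stateKernel θ) with hμ
  have e1 : ∫ s, M.trans θ (fun s => |M.linErr φ θ s|) s ∂M.visit θ
      = ∫ s, |M.linErr φ θ s| ∂μ := by
    rw [hμ, integral_bind_kernel (ha.integrable _)]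
    simp_rw [integral_stateKernel ha]
  have e2 : M.γ * ∫ s, M.linErr φ θ s ^ 2 ∂μ ≤ M.approxError ^ 2 := by
    have h2 : BddMeas (fun s => M.linErr φ θ s ^ 2)
        ((C / lam + C / (1 - M.γ)) * (C / lam + C / (1 - M.γ))) := by
      simpa only [smul_eq_mul, ← sq] using h.smul h
    rw [hμ, integral_bind_kernel (h2.integrable _)]
    simp_rw [integral_stateKernel h2]
    exact (integral_visit_trans_le h2 (fun s => sq_nonneg _) θ).trans
      (integral_sq_linErr_le hM hφ θ)
  have e3 := sq_integral_abs_le h μ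
  rw [e1]
  refine abs_le_of_sq_le_sq' ?_ M.approxError_nonneg |>.2
  have h1 := M.γ_pos
  have h2 := M.γ_lt_one
  have h3 : 0 ≤ ∫ s, M.linErr φ θ s ^ 2 ∂μ := integral_nonneg fun s => sq_nonneg _
  rw [mul_pow]
  have h4 : M.γ ^ 2 ≤ M.γ := by nlinarith
  calc _ ≤ M.γ * ∫ s, M.linErr φ θ s ^ 2 ∂μ :=
        mul_le_mul h4 e3 (sq_nonneg _) h1.le
    _ ≤ _ := e2

/-- At frozen parameters the mean critic increment is `b - A ω = -A z`, because `A ω* = b`;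
coercivity of `A` does the rest. -/
theorem integral_critNoise_le (x : M.Par R) :
    ∫ s, M.critNoise x s ∂M.visit x.θ ≤ -lam * ‖M.critErr x‖ ^ 2 := by
  have h1 : BddMeas (fun s => M.expReward x.φ x.θ s • M.feat s) (C * 1) :=
    (bddMeas_expReward hM.reward x.2.1 x.θ).smul M.bddMeas_feat
  have h2 := bddMeas_avgAct (M := M) M.bddMeas_featOp x.θ
  have h3 := h2.clm_apply x.ω
  have e : ∫ s, M.critNoise x s ∂M.visit x.θ = -⟪M.critErr x, M.A x.θ (M.critErr x)⟫ := by
    unfold critNoise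
    rw [ContinuousLinearMap.integral_comp_comm _ ((h1.sub h3).integrable _),
      integral_sub (h1.integrable _) (h3.integrable _), ← b_eq,
      ← ContinuousLinearMap.integral_apply (h2.integrable _), ← A_eq,
      ← A_omegaStar hM.lam_pos hM.explore, ← map_sub, innerSL_apply_apply, ← inner_neg_right,
      ← map_neg]
    congr 2
    unfold critErr
    abel
  rw [e]
  have := hM.explore x.θ (M.critErr x)
  linarith

/-- With the true value function in place of the critic, the stationary mean of the actor direction
is exactly `(1 - γ)∇J`. The discrepancy is the score tested against the error `q` of the critic at
the next state. This error splits into `⟨feat, z⟩`, of size at most `‖z‖`, and the error of the best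
linear critic, which costs `ε` after averaging. -/
theorem abs_integral_actorDir_sub_le (x : M.Par R) (hR : 0 ≤ R) (c : Euc m) :
    |∫ s, M.actorDir x s c ∂M.visit x.θ - (1 - M.γ) * M.JDeriv x.φ x.θ c|
      ≤ L * ‖c‖ * (‖M.critErr x‖ + M.approxError) := by
  have hL := hM.L_nonneg
  have hV := bddMeas_value hM x.2.1 x.θ
  have hω := M.bddMeas_inner_feat x.ω
  have hsf := smoothFamily_expReward hM.policy hM.L_nonneg hM.S_nonneg hM.C_nonneg hM.reward x.2.1
  have hdV : BddMeas (fun s => M.dAct x.θ s (M.avgNext (M.value x.φ x.θ) s)) _ :=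
    bddMeas_dAct hM.policy x.θ (bddMeas_avgNext (M := M) hV)
  have hdVc := ((hdV.clm_apply c).const_smul M.γ)
  have hgc := (hsf.bdd_deriv x.θ).clm_apply c
  have h1 : (1 - M.γ) * M.JDeriv x.φ x.θ c
      = ∫ s, (innerSL ℝ (M.gradReward x.φ x.θ s) c
        + M.γ • M.dAct x.θ s (M.avgNext (M.value x.φ x.θ) s) c) ∂M.visit x.θ := by
    unfold JDeriv
    rw [_root_.smul_apply, smul_eq_mul, ← mul_assoc, mul_inv_cancel₀ M.one_sub_gamma_pos.ne',
      one_mul, hsf.visitDeriv_apply hM.policy]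
    rfl
  have hA := (bddMeas_actorDir hM hR x).clm_apply c
  rw [h1, ← integral_sub (hA.integrable _) ((hgc.add hdVc).integrable _)]
  set q : St → ℝ := fun s => ⟪M.feat s, x.ω⟫ - M.value x.φ x.θ s with hq
  have hqb : BddMeas q _ := hω.sub hV
  have e : ∀ s, M.actorDir x s c - (innerSL ℝ (M.gradReward x.φ x.θ s) c
        + M.γ • M.dAct x.θ s (M.avgNext (M.value x.φ x.θ) s) c)
      = M.γ * M.dAct x.θ s (M.avgNext q s) c := by
    intro s
    have e1 : M.avgNext q s = fun a => M.avgNext (fun s' => ⟪M.feat s', x.ω⟫) s a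
        - M.avgNext (M.value x.φ x.θ) s a := by
      funext a
      exact integral_sub (hω.integrable _) (hV.integrable _)
    rw [e1, dAct_sub hM (bddMeas_avgNext_left hω s) (bddMeas_avgNext_left hV s)]
    unfold actorDir nextDir
    simp only [_root_.add_apply, _root_.smul_apply, _root_.sub_apply, smul_eq_mul]
    ring
  simp_rw [e]
  have hqa : BddMeas (fun s => |q s|) _ := hqb.norm
  have hb : ∀ s, |M.γ * M.dAct x.θ s (M.avgNext q s) c|
      ≤ M.γ * (L * ‖c‖ * M.trans x.θ (fun s => |q s|) s) := by
    intro s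
    rw [abs_mul, abs_of_pos M.γ_pos]
    refine mul_le_mul_of_nonneg_left ?_ M.γ_pos.le
    have hn := bddMeas_avgNext_left (M := M) hqb s
    have hna := bddMeas_avgNext_left (M := M) hqa s
    rw [dAct_apply hM.policy _ _ hn]
    unfold trans avgAct
    rw [← integral_const_mul]
    refine norm_integral_le_of_norm_le (μ := M.policy (x.θ, s))
      (f := fun a => ⟪M.score x.θ s a, c⟫ • M.avgNext q s a)
      (g := fun a => L * ‖c‖ * M.avgNext (fun s => |q s|) s a) ((hna.integrable _).const_mul _) (ae_of_all _ fun a => ?_)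
    rw [norm_smul]
    refine mul_le_mul ((norm_inner_le_norm (𝕜 := ℝ) _ _).trans (by gcongr; exact hM.policy.score_le _ _ _))
      (norm_integral_le_integral_norm (μ := M.P (s, a)) q) (norm_nonneg _) (by positivity)
  have hta := bddMeas_trans (M := M) hqa x.θ
  refine (norm_integral_le_of_norm_le (((hta.integrable _).const_mul (L * ‖c‖)).const_mul M.γ)
    (ae_of_all _ fun s => (Real.norm_eq_abs _).trans_le (hb s))).trans ?_
  rw [integral_const_mul, integral_const_mul]
  have hla : BddMeas (fun s => |M.linErr x.φ x.θ s|) (C / lam + C / (1 - M.γ)) :=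
    (bddMeas_linErr hM x.2.1 x.θ).norm
  have hc : BddMeas (fun _ : St => ‖M.critErr x‖) ‖M.critErr x‖ :=
    ⟨stronglyMeasurable_const, fun _ => by simp⟩
  have ht : ∀ s, M.trans x.θ (fun s => |q s|) s
      ≤ M.trans x.θ (fun _ => ‖M.critErr x‖) s
        + M.trans x.θ (fun s => |M.linErr x.φ x.θ s|) s := by
    intro s
    rw [← trans_add hc hla, ← integral_stateKernel hqa, ← integral_stateKernel (hc.add hla)]
    refine integral_mono (hqa.integrable _) ((hc.add hla).integrable _) fun y => ?_
    have : q y = ⟪M.feat y, M.critErr x⟫ + M.linErr x.φ x.θ y := by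
      simp only [hq, linErr, critErr, inner_sub_right]; ring
    simp only
    rw [this]
    refine (abs_add_le _ _).trans (add_le_add_left ?_ _)
    exact (M.bddMeas_inner_feat (M.critErr x)).bound y
  have htc : ∀ s, M.trans x.θ (fun _ => ‖M.critErr x‖) s = ‖M.critErr x‖ := fun s => by
    simp [trans, avgAct, avgNext]
  have htl := bddMeas_trans (M := M) hla x.θ
  have hfin : ∫ s, M.trans x.θ (fun s => |q s|) s ∂M.visit x.θ
      ≤ ‖M.critErr x‖ + ∫ s, M.trans x.θ (fun s => |M.linErr x.φ x.θ s|) s ∂M.visit x.θ := by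
    have := integral_mono (hta.integrable (M.visit x.θ))
      ((integrable_const ‖M.critErr x‖).add (htl.integrable _)) (fun s => (ht s).trans_eq (by
        rw [htc]; rfl))
    refine this.trans_eq ?_
    rw [integral_add' (integrable_const _) (htl.integrable _)]
    simp
  have hg := gamma_mul_integral_trans_linErr_le hM x.2.1 x.θ
  have hγ := M.γ_pos
  have hγ1 := M.γ_lt_one
  have hz := norm_nonneg (M.critErr x)
  have h5 : M.γ * ∫ s, M.trans x.θ (fun s => |q s|) s ∂M.visit x.θ
      ≤ ‖M.critErr x‖ + M.approxError := by nlinarith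
  calc _ = L * ‖c‖ * (M.γ * ∫ s, M.trans x.θ (fun s => |q s|) s ∂M.visit x.θ) := by ring
    _ ≤ _ := mul_le_mul_of_nonneg_left h5 (by positivity)

theorem JDeriv_gradJ (x : M.Par R) (c : Euc m) : M.JDeriv x.φ x.θ c = ⟪M.gradJ x, c⟫ := by
  rw [← JDeriv_eq_gradient hM.policy hM.L_nonneg hM.S_nonneg hM.C_nonneg hM.reward x.2.1 x.θ]
  rfl

/-- Constant of the critic error in the actor inequality. -/
def actorCoupling (γ L : ℝ) : ℝ := L ^ 2 / (1 - γ)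

/-- Young's inequality: half of `(1 - γ)‖∇J‖²` absorbs the cross term `L‖∇J‖(‖z‖ + ε)`, at the price
of `L² / (1 - γ)` times `‖z‖² + ε²`. -/
theorem le_integral_actorNoise (x : M.Par R) (hR : 0 ≤ R) :
    (1 - M.γ) / 2 * ‖M.gradJ x‖ ^ 2
        - actorCoupling M.γ L * (‖M.critErr x‖ ^ 2 + M.approxError ^ 2)
      ≤ ∫ s, M.actorNoise x s ∂M.visit x.θ := by
  have h := abs_integral_actorDir_sub_le hM x hR (M.gradJ x)
  rw [JDeriv_gradJ hM, real_inner_self_eq_norm_sq] at h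
  have h1 := (abs_le.1 h).1
  have h0 := M.one_sub_gamma_pos
  unfold actorNoise actorCoupling
  set g := ‖M.gradJ x‖
  set z := ‖M.critErr x‖
  set e := M.approxError
  set κ := 1 - M.γ
  have key : L * g * (z + e) ≤ κ / 2 * g ^ 2 + L ^ 2 / κ * (z ^ 2 + e ^ 2) := by
    have e1 : κ / 2 * g ^ 2 + L ^ 2 / κ * (z ^ 2 + e ^ 2) - L * g * (z + e)
        = (κ * g - L * (z + e)) ^ 2 / (2 * κ) + L ^ 2 / (2 * κ) * (z - e) ^ 2 := by
      field_simp
      ring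
    have e2 : 0 ≤ (κ * g - L * (z + e)) ^ 2 / (2 * κ) + L ^ 2 / (2 * κ) * (z - e) ^ 2 := by
      positivity
    linarith
  linarith

/-- Constant of the coupling terms in the critic inequality. -/
def critCoupling (γ lam L C : ℝ) : ℝ := starLip γ lam L C * (1 + 2 * L)

/-- `starDir` carries a factor `‖z‖`, and the mean actor direction is of size `‖∇J‖ + ‖z‖ + ε`, so
the mean is quadratic in the errors. Estimating the actor increment by its norm would leave a term
linear in `‖z‖` that does not decay. -/
theorem abs_integral_starNoise_le (x : M.Par R) (hR : 0 ≤ R) :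
    |∫ s, M.starNoise x s ∂M.visit x.θ|
      ≤ critCoupling M.γ lam L C
        * (‖M.critErr x‖ ^ 2 + ‖M.gradJ x‖ ^ 2 + M.approxError ^ 2) := by
  have h := abs_integral_actorDir_sub_le hM x hR (M.starDir x)
  rw [JDeriv_gradJ hM] at h
  have h0 := M.one_sub_gamma_pos
  have h0' := M.γ_pos
  have hi := abs_real_inner_le_norm (M.gradJ x) (M.starDir x)
  have hs0 := hM.starLip_nonneg ⟨_, x.2.1⟩
  have hc : ‖M.starDir x‖ ≤ starLip M.γ lam L C * ‖M.critErr x‖ := by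
    refine (ContinuousLinearMap.le_opNorm _ _).trans ?_
    rw [LinearIsometryEquiv.norm_map]
    exact mul_le_mul_of_nonneg_right ((parLip_starDeriv hM).bound x) (norm_nonneg _)
  have hL := hM.L_nonneg
  have he := M.approxError_nonneg
  have hz := norm_nonneg (M.critErr x)
  have hg := norm_nonneg (M.gradJ x)
  have hs := norm_nonneg (M.starDir x)
  unfold starNoise critCoupling
  set g := ‖M.gradJ x‖
  set z := ‖M.critErr x‖
  set e := M.approxError
  set ℓ := starLip M.γ lam L C
  set I := ∫ s, M.actorDir x s (M.starDir x) ∂M.visit x.θ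
  set j := ⟪M.gradJ x, M.starDir x⟫
  have h1 : |I| ≤ L * ‖M.starDir x‖ * (z + e) + (1 - M.γ) * |j| := by
    have := abs_sub_abs_le_abs_sub I ((1 - M.γ) * j)
    rw [abs_mul, abs_of_pos h0] at this
    linarith
  have h2 : (1 - M.γ) * |j| ≤ g * ‖M.starDir x‖ := by
    nlinarith [abs_nonneg j]
  have h3 : |I| ≤ ‖M.starDir x‖ * (L * (z + e) + g) := by nlinarith
  have h4 : |I| ≤ ℓ * z * (L * (z + e) + g) :=
    h3.trans (mul_le_mul_of_nonneg_right hc (by positivity))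
  refine h4.trans ?_
  rw [mul_assoc, mul_assoc]
  refine mul_le_mul_of_nonneg_left ?_ hs0
  nlinarith [sq_nonneg (z - g), sq_nonneg (z - e), sq_nonneg z, sq_nonneg g, sq_nonneg e,
    mul_nonneg hL (sq_nonneg (z - e)), mul_nonneg hL (sq_nonneg z), mul_nonneg hL (sq_nonneg g),
    mul_nonneg hL (sq_nonneg e)]

/-- The solution of the Poisson equation of the sampling chain with right hand side `f x`. -/
def poisson (M : ParamMDP St Ac m k d) {R : ℝ} (f : M.Par R → St → ℝ) (x : M.Par R) (s : St) : ℝ :=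
  M.resolv x.θ (f x) s

theorem parLip_poisson {f : M.Par R → St → ℝ} {B Λ : ℝ} (hm : ∀ x, BddMeas (f x) B)
    (hf : ∀ s, ParLip (fun x => f x s) B Λ) (s : St) : ParLip (fun x => M.poisson f x s)
      (B / (1 - M.γ)) ((Λ + polLip L * (B / (1 - M.γ))) / (1 - M.γ)) where
  bound x := (bddMeas_resolv (hm x) x.θ).bound s
  lip x y := by
    have h0 := M.one_sub_gamma_pos
    have hB := (norm_nonneg _).trans ((hm x).bound s)
    have h1 := norm_resolv_sub_le hM.policy hM.L_nonneg hM.S_nonneg (hm x) (hm y)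
      (fun s => (hf s).lip x y) x.θ y.θ s
    have h2 := polLip_nonneg hM.L_nonneg
    have h3 := Par.combine_le_mul_gap (x := x) (y := y) (a := polLip L * (B / (1 - M.γ))) (b := 0)
      (c := 0) (e := 0) (K := polLip L * (B / (1 - M.γ))) (by linarith) (by positivity) le_rfl
      le_rfl le_rfl
    refine h1.trans ?_
    rw [div_mul_eq_mul_div]
    gcongr
    linarith

-- The left side is the sampling kernel applied to `u` (see `integral_sampleStep_snd`), so this is
-- the Poisson equation: `resolv_eq` accounts for `f`, and the constant `(1 - γ) ρ(u)` is the
-- visitation mean of `f`.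
omit hM in
theorem poisson_eq {f : M.Par R → St → ℝ} {B : ℝ} (hm : ∀ x, BddMeas (f x) B) (x : M.Par R)
    (s : St) : M.γ * M.trans x.θ (M.poisson f x) s + (1 - M.γ) * ∫ s', M.poisson f x s' ∂M.ρ
      = M.poisson f x s - f x s + ∫ s', f x s' ∂M.visit x.θ := by
  have h1 := resolv_eq (M := M) (hm x) x.θ s
  have h2 := integral_visit_eq_resolv (M := M) (hm x) x.θ
  rw [smul_eq_mul] at h1 h2
  rw [h2]
  change _ = M.resolv x.θ (f x) s - _ + _
  rw [h1]
  change M.γ * M.trans x.θ (M.resolv x.θ (f x)) s + _ = _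
  unfold poisson
  ring

end ParamMDP

end

/-! ### Conditional moments of the TD error over one transition. -/

noncomputable section

namespace ParamMDP

variable {St Ac : Type*} [MeasurableSpace St] [MeasurableSpace Ac] {m k d : ℕ}
  {M : ParamMDP St Ac m k d} {R L S C D lam : ℝ}

instance instMarkovSampleStep (M : ParamMDP St Ac m k d) : IsMarkovKernel M.sampleStep := by
  unfold sampleStep; infer_instance

theorem integral_sampleStep {θ : Euc m} {s : St} {F : Ac × St × St → ℝ}
    (hF : Integrable F (M.sampleStep (θ, s))) :
    ∫ u, F u ∂M.sampleStep (θ, s)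
      = ∫ a, ∫ v, F (a, v) ∂(M.P (s, a)).prod (M.Phat (s, a)) ∂M.policy (θ, s) := by
  unfold sampleStep at hF ⊢
  rw [ProbabilityTheory.integral_compProd hF]
  simp [Kernel.comap_apply, Kernel.prod_apply]

theorem integral_Phat {f : St → ℝ} {B : ℝ} (hf : BddMeas f B) (s : St) (a : Ac) :
    ∫ y, f y ∂M.Phat (s, a) = M.γ * M.avgNext f s a + (1 - M.γ) * ∫ y, f y ∂M.ρ := by
  change ∫ y, f y ∂(ENNReal.ofReal M.γ • M.P (s, a) + ENNReal.ofReal (1 - M.γ) • M.ρ) = _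
  rw [integral_add_measure ((hf.integrable _).smul_measure ENNReal.ofReal_ne_top)
    ((hf.integrable _).smul_measure ENNReal.ofReal_ne_top), integral_smul_measure,
    integral_smul_measure, ENNReal.toReal_ofReal M.one_sub_gamma_pos.le,
    ENNReal.toReal_ofReal M.γ_pos.le]
  rfl

theorem integral_sampleStep_snd {f : St → ℝ} {B : ℝ} (hf : BddMeas f B) (θ : Euc m) (s : St) :
    ∫ u, f u.2.2 ∂M.sampleStep (θ, s) = M.γ * M.trans θ f s + (1 - M.γ) * ∫ y, f y ∂M.ρ := by
  have hi : Integrable (fun u : Ac × St × St => f u.2.2) (M.sampleStep (θ, s)) :=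
    (hf.comp (measurable_snd.comp measurable_snd)).integrable _
  rw [integral_sampleStep hi]
  simp_rw [integral_fun_snd, probReal_univ, one_smul, integral_Phat hf]
  rw [integral_add (((bddMeas_avgNext_left hf s).integrable _).const_mul _) (integrable_const _),
    integral_const_mul]
  simp [trans, avgAct]

/-- The TD error as a function of the parameters and one transition. -/
def tdFun (M : ParamMDP St Ac m k d) {R : ℝ} (y : M.Par R × St) (u : Ac × St × St) : ℝ :=
  M.regReward y.1.φ y.1.θ y.2 u.1 + ⟪M.γ • M.feat u.2.1 - M.feat y.2, y.1.ω⟫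

theorem measurable_tdFun (M : ParamMDP St Ac m k d) (R : ℝ) :
    Measurable (Function.uncurry (M.tdFun (R := R))) := by
  have h0 : Measurable fun x : (M.Par R × St) × Ac × St × St => x.1.1.1 :=
    measurable_subtype_coe.comp (measurable_fst.comp measurable_fst)
  have h1 : Measurable fun x : (M.Par R × St) × Ac × St × St =>
      M.regReward x.1.1.φ x.1.1.θ x.1.2 x.2.1 :=
    M.measurable_regReward.comp (f := fun x : (M.Par R × St) × Ac × St × St =>
      (x.1.1.φ, (x.1.1.θ, x.1.2), x.2.1)) (h0.fst.prodMk
        ((h0.snd.fst.prodMk (measurable_snd.comp measurable_fst)).prodMk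
          (measurable_fst.comp measurable_snd)))
  refine h1.add (Measurable.inner (((M.feat_meas.comp ?_).const_smul M.γ).sub
    (M.feat_meas.comp ?_)) h0.snd.snd)
  · fun_prop
  · fun_prop

theorem measurable_tdFun_right (M : ParamMDP St Ac m k d) (y : M.Par R × St) :
    Measurable (M.tdFun y) :=
  (M.measurable_tdFun R).comp (measurable_prodMk_left (x := y))

theorem abs_inner_feat_sub_le (M : ParamMDP St Ac m k d) (y : M.Par R × St) (s' : St) :
    |⟪M.γ • M.feat s' - M.feat y.2, y.1.ω⟫| ≤ 2 * R := by
  refine (abs_real_inner_le_norm _ _).trans ?_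
  rw [norm_sub_rev]
  exact mul_le_mul (M.norm_feat_sub_le _ _) y.1.2.2 (norm_nonneg _) zero_le_two

/-- Bound for the conditional second moment of the TD error. -/
def tdBound (C R : ℝ) : ℝ := 2 * C ^ 2 + 8 * R ^ 2

theorem tdFun_sq_le (y : M.Par R × St) (u : Ac × St × St) :
    M.tdFun y u ^ 2 ≤ 2 * M.regReward y.1.φ y.1.θ y.2 u.1 ^ 2 + 8 * R ^ 2 := by
  have h := abs_inner_feat_sub_le M y u.2.1
  unfold tdFun
  set p := M.regReward y.1.φ y.1.θ y.2 u.1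
  set q := ⟪M.γ • M.feat u.2.1 - M.feat y.2, y.1.ω⟫
  have h2 : q ^ 2 ≤ (2 * R) ^ 2 := sq_le_sq' (abs_le.1 h).1 (abs_le.1 h).2
  nlinarith [sq_nonneg (p - q)]

theorem map_fst_sampleStep (M : ParamMDP St Ac m k d) (x : Euc m × St) :
    (M.sampleStep x).map Prod.fst = M.policy x := by
  have h : M.sampleStep.fst = M.policy := by
    unfold sampleStep
    exact Kernel.fst_compProd _ _
  rw [← Kernel.fst_apply, h]

theorem featOp_apply (s : St) (a : Ac) (w : Euc d) : M.featOp s a w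
    = (⟪M.feat s, w⟫ - M.γ * M.avgNext (fun s' => ⟪M.feat s', w⟫) s a) • M.feat s := by
  have hb : Integrable (fun s' => InnerProductSpace.rankOne ℝ (M.feat s)
      (M.feat s - M.γ • M.feat s')) (M.P (s, a)) := by
    have h := M.bddMeas_rankOne.comp (measurable_prodMk_left (x := (s, a)))
    exact h.integrable _
  unfold featOp
  rw [ContinuousLinearMap.integral_apply hb]
  have e : ∀ s', InnerProductSpace.rankOne ℝ (M.feat s) (M.feat s - M.γ • M.feat s') w
      = (⟪M.feat s, w⟫ - M.γ * ⟪M.feat s', w⟫) • M.feat s := fun s' => by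
    rw [InnerProductSpace.rankOne_apply, inner_sub_left, real_inner_smul_left]
  simp_rw [e]
  rw [integral_smul_const, integral_sub (integrable_const _)
    (((M.bddMeas_inner_feat w).integrable _).const_mul _), integral_const_mul, integral_const,
    probReal_univ, one_smul]
  rfl

variable (hM : M.Regular lam L S C D)

include hM

/-- Written with the lower integral, so that it yields square integrability of the TD error as well
as the bound. -/
theorem lintegral_tdFun_sq_le (y : M.Par R × St) :
    ∫⁻ u, ENNReal.ofReal (M.tdFun y u ^ 2) ∂M.sampleStep (y.1.θ, y.2)
      ≤ ENNReal.ofReal (tdBound C R) := by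
  have hm : Measurable fun a => 2 * M.regReward y.1.φ y.1.θ y.2 a ^ 2 + 8 * R ^ 2 := by
    have : Measurable fun a => M.regReward y.1.φ y.1.θ y.2 a :=
      (M.measurable_regReward_right y.1.φ y.1.θ).comp (measurable_prodMk_left (x := y.2))
    fun_prop
  calc _ ≤ ∫⁻ u, ENNReal.ofReal (2 * M.regReward y.1.φ y.1.θ y.2 u.1 ^ 2 + 8 * R ^ 2)
        ∂M.sampleStep (y.1.θ, y.2) :=
        lintegral_mono fun u => ENNReal.ofReal_le_ofReal (tdFun_sq_le y u)
    _ = ∫⁻ a, ENNReal.ofReal (2 * M.regReward y.1.φ y.1.θ y.2 a ^ 2 + 8 * R ^ 2)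
        ∂M.policy (y.1.θ, y.2) := by
        rw [← map_fst_sampleStep, lintegral_map hm.ennreal_ofReal measurable_fst]
    _ = ENNReal.ofReal (∫ a, (2 * M.regReward y.1.φ y.1.θ y.2 a ^ 2 + 8 * R ^ 2)
        ∂M.policy (y.1.θ, y.2)) := by
        rw [ofReal_integral_eq_lintegral_ofReal]
        · exact ((hM.reward.memLp _ y.1.2.1 y.1.θ y.2).integrable_sq.const_mul 2).add
            (integrable_const _)
        · exact ae_of_all _ fun a => by positivity
    _ ≤ _ := by
        refine ENNReal.ofReal_le_ofReal ?_
        rw [integral_add ((hM.reward.memLp _ y.1.2.1 y.1.θ y.2).integrable_sq.const_mul 2)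
          (integrable_const _), integral_const_mul]
        have := hM.reward.secondMoment _ y.1.2.1 y.1.θ y.2
        simp only [integral_const, probReal_univ, one_smul, tdBound]
        linarith

theorem integrable_tdFun (y : M.Par R × St) :
    Integrable (M.tdFun y) (M.sampleStep (y.1.θ, y.2)) := by
  refine MemLp.integrable (q := 2) (by norm_num) ?_
  rw [memLp_two_iff_integrable_sq (M.measurable_tdFun_right y).aestronglyMeasurable]
  refine ⟨((M.measurable_tdFun_right y).pow_const 2).aestronglyMeasurable, ?_⟩
  rw [hasFiniteIntegral_iff_ofReal (ae_of_all _ fun _ => sq_nonneg _)]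
  exact (lintegral_tdFun_sq_le hM y).trans_lt ENNReal.ofReal_lt_top

/-- Conditional expectation of the TD error times a function of the action. -/
theorem integral_tdFun_mul (y : M.Par R × St) {q : Ac → ℝ} {B : ℝ} (hq : BddMeas q B) :
    ∫ u, M.tdFun y u * q u.1 ∂M.sampleStep (y.1.θ, y.2)
      = ∫ a, M.regReward y.1.φ y.1.θ y.2 a * q a ∂M.policy (y.1.θ, y.2)
        + (M.γ * ∫ a, q a * M.avgNext (fun s' => ⟪M.feat s', y.1.ω⟫) y.2 a
            ∂M.policy (y.1.θ, y.2)
          - ⟪M.feat y.2, y.1.ω⟫ * ∫ a, q a ∂M.policy (y.1.θ, y.2)) := by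
  have hi : Integrable (fun u => M.tdFun y u * q u.1) (M.sampleStep (y.1.θ, y.2)) :=
    (integrable_tdFun hM y).mul_bdd (c := B) (hq.comp measurable_fst).meas.aestronglyMeasurable
      (ae_of_all _ fun u => hq.bound u.1)
  have hω := M.bddMeas_inner_feat y.1.ω
  have hn := bddMeas_avgNext_left (M := M) hω y.2
  rw [integral_sampleStep hi]
  have e : ∀ a, ∫ v, M.tdFun y (a, v) * q a ∂(M.P (y.2, a)).prod (M.Phat (y.2, a))
      = M.regReward y.1.φ y.1.θ y.2 a * q a
        + (M.γ * (q a * M.avgNext (fun s' => ⟪M.feat s', y.1.ω⟫) y.2 a)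
          - ⟪M.feat y.2, y.1.ω⟫ * q a) := by
    intro a
    have e1 : ∀ v : St × St, M.tdFun y (a, v) * q a
        = (fun s' => (M.regReward y.1.φ y.1.θ y.2 a - ⟪M.feat y.2, y.1.ω⟫) * q a
          + M.γ * q a * ⟪M.feat s', y.1.ω⟫) v.1 := by
      intro v
      simp only [tdFun, inner_sub_left, real_inner_smul_left]
      ring
    simp_rw [e1]
    rw [integral_fun_fst (μ := M.P (y.2, a)) (ν := M.Phat (y.2, a)) (fun s' =>
      (M.regReward y.1.φ y.1.θ y.2 a - ⟪M.feat y.2, y.1.ω⟫) * q a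
          + M.γ * q a * ⟪M.feat s', y.1.ω⟫), integral_add (integrable_const _)
      ((hω.integrable _).const_mul _)]
    simp only [integral_const_mul, integral_const, probReal_univ, one_smul, avgNext]
    ring
  simp_rw [e]
  have i1 : Integrable (fun a => M.regReward y.1.φ y.1.θ y.2 a * q a) (M.policy (y.1.θ, y.2)) :=
    (integrable_regReward hM.reward y.1.2.1 _ _).mul_bdd (c := B) hq.meas.aestronglyMeasurable
      (ae_of_all _ hq.bound)
  have i2 : Integrable (fun a => q a * M.avgNext (fun s' => ⟪M.feat s', y.1.ω⟫) y.2 a)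
      (M.policy (y.1.θ, y.2)) := (hq.smul hn).integrable _
  have i3 := hq.integrable (M.policy (y.1.θ, y.2))
  rw [integral_add (g := fun a => M.γ * (q a * M.avgNext (fun s' => ⟪M.feat s', y.1.ω⟫) y.2 a)
      - ⟪M.feat y.2, y.1.ω⟫ * q a) i1 ((i2.const_mul _).sub (i3.const_mul _)),
    integral_sub (i2.const_mul _) (i3.const_mul _), integral_const_mul, integral_const_mul]

/-- The score has mean zero given the state, which removes the baseline `⟨feat s, ω⟩`. The reward
contributes its gradient by the score formula, and the next-state feature contributes `γ • nextDir`.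
-/
theorem integral_tdFun_mul_score (y : M.Par R × St) (c : Euc m) :
    ∫ u, M.tdFun y u * ⟪c, M.score y.1.θ y.2 u.1⟫ ∂M.sampleStep (y.1.θ, y.2)
      = M.actorDir y.1 y.2 c := by
  have hq : BddMeas (fun a => ⟪M.score y.1.θ y.2 a, c⟫) (L * ‖c‖) :=
    ⟨((measurable_score_right hM.policy y.1.θ y.2).inner_const).stronglyMeasurable, fun a =>
      (norm_inner_le_norm _ _).trans (by gcongr; exact hM.policy.score_le _ _ _)⟩
  have hn := bddMeas_avgNext_left (M := M) (M.bddMeas_inner_feat y.1.ω) y.2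
  simp_rw [real_inner_comm _ c]
  rw [integral_tdFun_mul hM y hq, integral_inner_score hM.policy hM.L_nonneg hM.S_nonneg,
    mul_zero, sub_zero]
  unfold actorDir nextDir
  rw [_root_.add_apply, _root_.smul_apply, dAct_apply hM.policy _ _ hn, innerSL_apply_apply,
    gradReward_eq hM.policy hM.L_nonneg hM.S_nonneg hM.reward y.1.2.1, real_inner_comm,
    ← integral_inner (integrable_regReward_smul_score hM.policy hM.reward y.1.2.1 _ _)]
  simp_rw [real_inner_smul_right, real_inner_comm c]
  rfl

theorem integral_tdFun_mul_feat (y : M.Par R × St) :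
    ∫ u, M.tdFun y u * ⟪M.critErr y.1, M.feat y.2⟫ ∂M.sampleStep (y.1.θ, y.2)
      = M.critNoise y.1 y.2 := by
  have hq : BddMeas (fun _ : Ac => ⟪M.critErr y.1, M.feat y.2⟫) |⟪M.critErr y.1, M.feat y.2⟫| :=
    ⟨stronglyMeasurable_const, fun a => le_rfl⟩
  have hω := M.bddMeas_inner_feat y.1.ω
  have hn := bddMeas_avgNext_left (M := M) hω y.2
  rw [integral_tdFun_mul hM y hq, integral_mul_const, integral_const_mul]
  have e : M.avgAct y.1.θ y.2 (M.featOp y.2) y.1.ω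
      = (⟪M.feat y.2, y.1.ω⟫ - M.γ * ∫ a, M.avgNext (fun s' => ⟪M.feat s', y.1.ω⟫) y.2 a
        ∂M.policy (y.1.θ, y.2)) • M.feat y.2 := by
    unfold avgAct
    rw [ContinuousLinearMap.integral_apply ((M.bddMeas_featOp_left y.2).integrable _)]
    simp_rw [featOp_apply]
    rw [integral_smul_const, integral_sub (integrable_const _) ((hn.integrable _).const_mul _),
        integral_const_mul]
    simp
  unfold critNoise
  rw [e, ← sub_smul, innerSL_apply_apply, real_inner_smul_right]
  simp only [integral_const, probReal_univ, one_smul]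
  unfold expReward
  ring

end ParamMDP

end

/-! ### Conditioning along a run, and the bias of the Markovian noise. -/

noncomputable section

theorem norm_ballProj_le {d : ℕ} {R : ℝ} (hR : 0 ≤ R) (x : Euc d) : ‖ballProj R x‖ ≤ R := by
  unfold ballProj
  split_ifs with h
  · exact h
  · have h0 : 0 < ‖x‖ := hR.trans_lt (not_le.1 h)
    rw [norm_smul, Real.norm_of_nonneg (by positivity), div_mul_cancel₀ _ h0.ne']

theorem ballProj_of_norm_le {d : ℕ} {R : ℝ} {x : Euc d} (h : ‖x‖ ≤ R) : ballProj R x = x :=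
  if_pos h

theorem measurable_ballProj {d : ℕ} (R : ℝ) : Measurable (ballProj R : Euc d → Euc d) := by
  unfold ballProj
  exact Measurable.ite (measurableSet_le measurable_norm measurable_const) measurable_id
    ((measurable_const.div measurable_norm).smul measurable_id)

theorem norm_ballProj_sub_le {d : ℕ} {R : ℝ} {x y : Euc d} (hy : ‖y‖ ≤ R) :
    ‖ballProj R x - y‖ ≤ ‖x - y‖ := by
  unfold ballProj
  split_ifs with h
  · exact le_rfl
  have hR : 0 ≤ R := (norm_nonneg y).trans hy
  have h0 : 0 < ‖x‖ := hR.trans_lt (not_le.1 h)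
  have h1 : ⟪x, y⟫ ≤ ‖x‖ * R := (real_inner_le_norm x y).trans (by gcongr)
  rw [← abs_of_nonneg (norm_nonneg (x - y)), ← abs_of_nonneg (norm_nonneg (_ - y)), ← sq_le_sq,
    norm_sub_sq_real, norm_sub_sq_real, norm_smul, real_inner_smul_left,
    Real.norm_of_nonneg (by positivity), div_mul_cancel₀ _ h0.ne']
  have h2 : (1 - R / ‖x‖) * ⟪x, y⟫ ≤ (1 - R / ‖x‖) * (‖x‖ * R) := by
    refine mul_le_mul_of_nonneg_left h1 (sub_nonneg.2 ?_)
    exact (div_le_one h0).2 (not_le.1 h).le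
  have h3 : (1 - R / ‖x‖) * (‖x‖ * R) = ‖x‖ * R - R * R := by field_simp
  nlinarith [sq_nonneg (‖x‖ - R)]

/-- The law of a transition determines the joint law. -/
theorem map_prodMk_eq_compProd {Ω α β : Type*} {mF m0 : MeasurableSpace Ω} [MeasurableSpace α]
    [MeasurableSpace β] {Pr : Measure Ω} [IsProbabilityMeasure Pr]
    (hF : mF ≤ m0) {y : Ω → α} {Y : Ω → β} (hy : Measurable[mF] y) (hY : Measurable Y)
    (κ : Kernel α β) [IsMarkovKernel κ]
    (h : ∀ B : Set Ω, MeasurableSet[mF] B → ∀ U : Set β, MeasurableSet U →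
      Pr (B ∩ Y ⁻¹' U) = ∫⁻ w in B, κ (y w) U ∂Pr) :
    Pr.map (fun w => (y w, Y w)) = (Pr.map y) ⊗ₘ κ := by
  have hy' : Measurable y := hy.mono hF le_rfl
  have := Measure.isProbabilityMeasure_map (μ := Pr) hy'.aemeasurable
  have := Measure.isProbabilityMeasure_map (μ := Pr) (hy'.prodMk hY).aemeasurable
  refine Measure.ext_prod fun {s t} hs ht => ?_
  rw [Measure.map_apply (hy'.prodMk hY) (hs.prod ht), Measure.compProd_apply_prod hs ht,
    setLIntegral_map hs (Kernel.measurable_coe κ ht) hy', ← h _ (hy hs) _ ht]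
  rfl

namespace ParamMDP

variable {St Ac : Type*} [MeasurableSpace St] [MeasurableSpace Ac] {m k d : ℕ}
  {M : ParamMDP St Ac m k d} {R L S C D lam : ℝ}

/-- A function of parameters and state that is bounded, measurable in the state and regular in the
parameters. -/
structure Regularity (M : ParamMDP St Ac m k d) {R : ℝ} (f : M.Par R → St → ℝ) (B Λ : ℝ) :
    Prop where
  meas : ∀ x, BddMeas (f x) B
  lip : ∀ s, ParLip (fun x => f x s) B Λ

/-- A Carathéodory function: continuous in the parameters and measurable in the state. -/
theorem Regularity.measurable {f : M.Par R → St → ℝ} {B Λ : ℝ} (hf : M.Regularity f B Λ) :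
    Measurable fun y : M.Par R × St => f y.1 y.2 :=
  measurable_uncurry_of_continuous_of_measurable (fun s => (hf.lip s).continuous)
    fun x => (hf.meas x).meas.measurable

/-- The stationary mean of `f x`. -/
def mean (M : ParamMDP St Ac m k d) {R : ℝ} (f : M.Par R → St → ℝ) (x : M.Par R) : ℝ :=
  ∫ s, f x s ∂M.visit x.θ

theorem parLip_J (hM : M.Regular lam L S C D) : ParLip (fun x : M.Par R => M.J x.φ x.θ)
    ((1 - M.γ)⁻¹ * C) (gradBound M.γ L C + (1 - M.γ)⁻¹ * D) where
  bound x := abs_J_le hM.reward x.2.1 x.θ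
  lip x y := by
    have h0 := inv_pos.2 M.one_sub_gamma_pos
    have h1 := abs_J_sub_le hM.reward x.2.1 y.2.1 y.θ
    have h2 := (quadApprox_J hM.policy hM.L_nonneg hM.S_nonneg hM.C_nonneg hM.reward
      x.2.1).norm_sub_le (fun z => (parLip_JDeriv (R := R) hM).bound ⟨(x.φ, z, x.ω), x.2⟩) x.θ y.θ
    refine le_trans ?_ (Par.combine_le_mul_gap (x := x) (y := y) (a := gradBound M.γ L C) (b := 0)
      (c := (1 - M.γ)⁻¹ * D) (e := 0) (by linarith) ?_ le_rfl ?_ le_rfl)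
    · rw [Real.norm_eq_abs] at h2 ⊢
      rw [← mul_assoc] at h1
      change _ ≤ gradBound M.γ L C * ‖y.θ - x.θ‖ at h2
      change _ ≤ _ * ‖y.φ - x.φ‖ at h1
      have := abs_sub_le (M.J y.φ y.θ) (M.J x.φ y.θ) (M.J x.φ x.θ)
      linarith
    · exact (norm_nonneg _).trans ((parLip_gradJ hM).bound x)
    · exact mul_nonneg h0.le hM.D_nonneg

section

variable (hM : M.Regular lam L S C D)

include hM

theorem Regularity.poisson {f : M.Par R → St → ℝ} {B Λ : ℝ} (hf : M.Regularity f B Λ) :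
    M.Regularity (M.poisson f) (B / (1 - M.γ)) ((Λ + polLip L * (B / (1 - M.γ))) / (1 - M.γ)) where
  meas x := bddMeas_resolv (hf.meas x) x.θ
  lip := parLip_poisson hM hf.meas hf.lip

/-- The measure `ν_θ` varies with the parameter. Rewriting the mean as `(1 - γ) ρ(u)` moves the
dependence into the integrand, over a fixed measure. -/
theorem Regularity.measurable_mean {f : M.Par R → St → ℝ} {B Λ : ℝ} (hf : M.Regularity f B Λ) :
    Measurable (M.mean f) := by
  have e : M.mean f = fun x => (1 - M.γ) * ∫ s, M.poisson f x s ∂M.ρ :=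
    funext fun x => integral_visit_eq_resolv (hf.meas x) x.θ
  rw [e]
  exact ((hf.poisson hM).measurable.stronglyMeasurable.integral_prod_right
    (ν := M.ρ)).measurable.const_mul _

theorem abs_mean_le {f : M.Par R → St → ℝ} {B Λ : ℝ} (hf : M.Regularity f B Λ) (x : M.Par R) :
    |M.mean f x| ≤ B := by
  have := instProbVisit M x.θ
  exact (hf.meas x).norm_integral_le _

theorem regularity_critNoise : M.Regularity (M.critNoise (R := R)) (critNoiseBound lam C R)
    (critNoiseMod M.γ lam L C D R) := ⟨bddMeas_critNoise hM, parLip_critNoise hM⟩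

theorem regularity_actorNoise (hR : 0 ≤ R) : M.Regularity (M.actorNoise (R := R))
    (dirBound L C R * gradBound M.γ L C)
    (dirBound L C R * gradMod M.γ L S C D + dirMod L S C D R * gradBound M.γ L C) :=
  ⟨bddMeas_actorNoise hM hR, parLip_actorNoise hM hR⟩

theorem regularity_starNoise (hR : 0 ≤ R) : M.Regularity (M.starNoise (R := R))
    (dirBound L C R * (starLip M.γ lam L C * errBound lam C R))
    (dirBound L C R * (starLip M.γ lam L C * errMod M.γ lam L C D
      + holder (starQuad M.γ lam L S C) (D / lam) * errBound lam C R)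
      + dirMod L S C D R * (starLip M.γ lam L C * errBound lam C R)) :=
  ⟨bddMeas_starNoise hM hR, parLip_starNoise hM hR⟩

end

end ParamMDP

namespace Trajectory.IsRun

open ParamMDP

variable {St Ac : Type*} [MeasurableSpace St] [MeasurableSpace Ac] {m k d : ℕ}
  {M : ParamMDP St Ac m k d} {R L S C D lam : ℝ} {Ω : Type*} [MeasurableSpace Ω]
  {X : Trajectory Ω St Ac m k d} {Pr : Measure Ω} [IsProbabilityMeasure Pr]
  {𝓕 : Filtration ℕ (inferInstance : MeasurableSpace Ω)} {ηθ ηω : ℕ → ℝ}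

/-- The parameters at time `t`. -/
def par (hX : X.IsRun M Pr 𝓕 ηθ ηω R) (hR : 0 ≤ R) (t : ℕ) (w : Ω) : M.Par R :=
  ⟨(X.φ t w, X.θ t w, ballProj R (X.ω t w)), hX.φ_mem t w, norm_ballProj_le hR _⟩

/-- The parameters and the state at time `t`. -/
def cur (hX : X.IsRun M Pr 𝓕 ηθ ηω R) (hR : 0 ≤ R) (t : ℕ) (w : Ω) : M.Par R × St :=
  (hX.par hR t w, X.s t w)

/-- The sample drawn at time `t`. -/
def draw (X : Trajectory Ω St Ac m k d) (t : ℕ) (w : Ω) : Ac × St × St :=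
  (X.a t w, X.s' t w, X.s (t + 1) w)

variable (hX : X.IsRun M Pr 𝓕 ηθ ηω R) (hR : 0 ≤ R)

-- Only the arbitrary starting value `ω_0` can lie outside the ball. The projection built into `par`
-- therefore acts at most at time `0`, and the identities for the TD error below are stated for `1 ≤
-- t`.
include hX hR in
theorem ballProj_omega {t : ℕ} (ht : 1 ≤ t) (w : Ω) : ballProj R (X.ω t w) = X.ω t w := by
  obtain ⟨n, rfl⟩ := Nat.exists_eq_add_of_le' ht
  rw [hX.critic, ballProj_of_norm_le (norm_ballProj_le hR _)]

theorem tdFun_eq {t : ℕ} (ht : 1 ≤ t) (w : Ω) :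
    M.tdFun (hX.cur hR t w) (draw X t w) = X.tdError M t w := by
  simp only [tdFun, cur, par, draw, Par.ω, tdError, hX.ballProj_omega hR ht]

theorem measurable_cur_filtration (t : ℕ) : Measurable[𝓕 t] (hX.cur hR t) :=
  Measurable.prodMk (((hX.meas_φ t).prodMk ((hX.meas_θ t).prodMk
    ((measurable_ballProj R).comp (hX.meas_ω t)))).subtype_mk) (hX.meas_s t)

theorem measurable_cur (t : ℕ) : Measurable (hX.cur hR t) :=
  (hX.measurable_cur_filtration hR t).mono (𝓕.le t) le_rfl

theorem measurable_par (t : ℕ) : Measurable (hX.par hR t) := (hX.measurable_cur hR t).fst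

include hX in
theorem measurable_draw (t : ℕ) : Measurable (draw X t) :=
  ((hX.meas_a t).mono (𝓕.le _) le_rfl).prodMk
    (((hX.meas_s' t).mono (𝓕.le _) le_rfl).prodMk ((hX.meas_s (t + 1)).mono (𝓕.le _) le_rfl))

/-- The sampling kernel as a function of parameters and state. -/
def stepKernel (M : ParamMDP St Ac m k d) (R : ℝ) : Kernel (M.Par R × St) (Ac × St × St) :=
  M.sampleStep.comap (fun y => (y.1.θ, y.2)) (by fun_prop)

theorem map_cur_draw (t : ℕ) : Pr.map (fun w => (hX.cur hR t w, draw X t w))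
    = (Pr.map (hX.cur hR t)) ⊗ₘ stepKernel M R := by
  have : IsMarkovKernel (stepKernel M R) := by unfold stepKernel; infer_instance
  exact map_prodMk_eq_compProd (Pr := Pr) (𝓕.le t) (hX.measurable_cur_filtration hR t)
    (hX.measurable_draw t) _ (hX.sampling t)

theorem lintegral_draw (t : ℕ) {H : (M.Par R × St) × Ac × St × St → ℝ≥0∞} (hH : Measurable H) :
    ∫⁻ w, H (hX.cur hR t w, draw X t w) ∂Pr
      = ∫⁻ w, ∫⁻ u, H (hX.cur hR t w, u) ∂M.sampleStep (X.θ t w, X.s t w) ∂Pr := by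
  have : IsMarkovKernel (stepKernel M R) := by unfold stepKernel; infer_instance
  have := Measure.isProbabilityMeasure_map (μ := Pr) (hX.measurable_cur hR t).aemeasurable
  rw [← lintegral_map hH ((hX.measurable_cur hR t).prodMk (hX.measurable_draw t)),
    hX.map_cur_draw hR, Measure.lintegral_compProd hH, lintegral_map _ (hX.measurable_cur hR t)]
  · rfl
  · exact hH.lintegral_kernel_prod_right'

theorem integral_draw (t : ℕ) {H : (M.Par R × St) × Ac × St × St → ℝ} (hH : Measurable H)
    (hi : Integrable (fun w => H (hX.cur hR t w, draw X t w)) Pr) :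
    ∫ w, H (hX.cur hR t w, draw X t w) ∂Pr
      = ∫ w, ∫ u, H (hX.cur hR t w, u) ∂M.sampleStep (X.θ t w, X.s t w) ∂Pr := by
  have : IsMarkovKernel (stepKernel M R) := by unfold stepKernel; infer_instance
  have := Measure.isProbabilityMeasure_map (μ := Pr) (hX.measurable_cur hR t).aemeasurable
  have hm := (hX.measurable_cur hR t).prodMk (hX.measurable_draw t)
  have hi' : Integrable H ((Pr.map (hX.cur hR t)) ⊗ₘ stepKernel M R) := by
    rw [← hX.map_cur_draw hR]
    exact (integrable_map_measure hH.aestronglyMeasurable hm.aemeasurable).2 hi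
  rw [← integral_map hm.aemeasurable hH.aestronglyMeasurable, hX.map_cur_draw hR,
    Measure.integral_compProd hi', integral_map (hX.measurable_cur hR t).aemeasurable]
  · rfl
  · exact (StronglyMeasurable.integral_kernel_prod_right
      (f := fun y u => H (y, u)) hH.stronglyMeasurable).aestronglyMeasurable

section

variable (hM : M.Regular lam L S C D)

theorem measurable_tdError_aux (t : ℕ) :
    Measurable fun w => M.tdFun (hX.cur hR t w) (draw X t w) :=
  (M.measurable_tdFun R).comp ((hX.measurable_cur hR t).prodMk (hX.measurable_draw t))

theorem integrable_comp_par {E : Type*} [NormedAddCommGroup E] [SecondCountableTopology E]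
    {Q : M.Par R → E} {B : ℝ}
    (hc : Continuous Q) (hb : ∀ x, ‖Q x‖ ≤ B) (t : ℕ) :
    Integrable (fun w => Q (hX.par hR t w)) Pr :=
  Integrable.of_bound (hc.stronglyMeasurable.comp_measurable
    (hX.measurable_par hR t)).aestronglyMeasurable B (ae_of_all _ fun _ => hb _)

include hX hR hM

theorem lintegral_tdError_sq_le {t : ℕ} (ht : 1 ≤ t) :
    ∫⁻ w, ENNReal.ofReal (X.tdError M t w ^ 2) ∂Pr ≤ ENNReal.ofReal (tdBound C R) := by
  have h := hX.lintegral_draw hR t (H := fun z => ENNReal.ofReal (M.tdFun z.1 z.2 ^ 2))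
    (((M.measurable_tdFun R).pow_const 2).ennreal_ofReal)
  simp only [hX.tdFun_eq hR ht] at h
  rw [h]
  refine (lintegral_mono fun w => lintegral_tdFun_sq_le hM (hX.cur hR t w)).trans ?_
  simp

theorem memLp_tdError {t : ℕ} (ht : 1 ≤ t) : MemLp (X.tdError M t) 2 Pr := by
  have e : X.tdError M t = fun w => M.tdFun (hX.cur hR t w) (draw X t w) :=
    funext fun w => (hX.tdFun_eq hR ht w).symm
  have hm : Measurable (X.tdError M t) := e ▸ hX.measurable_tdError_aux hR t
  rw [memLp_two_iff_integrable_sq hm.aestronglyMeasurable]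
  refine ⟨(hm.pow_const 2).aestronglyMeasurable, ?_⟩
  rw [hasFiniteIntegral_iff_ofReal (ae_of_all _ fun _ => sq_nonneg _)]
  exact (hX.lintegral_tdError_sq_le hR hM ht).trans_lt ENNReal.ofReal_lt_top

theorem integral_tdError_sq_le {t : ℕ} (ht : 1 ≤ t) :
    ∫ w, X.tdError M t w ^ 2 ∂Pr ≤ tdBound C R := by
  have h0 : 0 ≤ tdBound C R := by unfold tdBound; positivity
  have h := hX.lintegral_tdError_sq_le hR hM ht
  rw [← ofReal_integral_eq_lintegral_ofReal (hX.memLp_tdError hR hM ht).integrable_sq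
    (ae_of_all _ fun _ => sq_nonneg _)] at h
  exact (ENNReal.ofReal_le_ofReal_iff h0).1 h

theorem integrable_tdError_mul_score {t : ℕ} (ht : 1 ≤ t) {c : M.Par R → Euc m} {B : ℝ}
    (hc : Continuous c) (hb : ∀ x, ‖c x‖ ≤ B) : Integrable (fun w => X.tdError M t w
      * ⟪c (hX.par hR t w), M.score (X.θ t w) (X.s t w) (X.a t w)⟫) Pr := by
  have hs : Measurable fun w => M.score (X.θ t w) (X.s t w) (X.a t w) :=
    (measurable_score hM.policy).comp (((hX.measurable_par hR t).subtype_val.snd.fst.prodMk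
      (hX.measurable_cur hR t).snd).prodMk (hX.measurable_draw t).fst)
  refine ((hX.memLp_tdError hR hM ht).integrable (by norm_num)).mul_bdd (c := B * L) ?_ ?_
  · exact ((hc.measurable.comp (hX.measurable_par hR t)).inner hs).aestronglyMeasurable
  · refine ae_of_all _ fun w => (norm_inner_le_norm _ _).trans ?_
    exact mul_le_mul (hb _) (hM.policy.score_le _ _ _) (norm_nonneg _)
      ((norm_nonneg _).trans (hb (hX.par hR t w)))

theorem integral_tdError_mul_score {t : ℕ} (ht : 1 ≤ t) {c : M.Par R → Euc m} {B : ℝ}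
    (hc : Continuous c) (hb : ∀ x, ‖c x‖ ≤ B) : ∫ w, X.tdError M t w
      * ⟪c (hX.par hR t w), M.score (X.θ t w) (X.s t w) (X.a t w)⟫ ∂Pr
      = ∫ w, M.actorDir (hX.par hR t w) (X.s t w) (c (hX.par hR t w)) ∂Pr := by
  have hi := hX.integrable_tdError_mul_score hR hM ht hc hb
  have hs : Measurable fun z : (M.Par R × St) × Ac × St × St =>
      M.score z.1.1.θ z.1.2 z.2.1 := (measurable_score hM.policy).comp
    (f := fun z : (M.Par R × St) × Ac × St × St => ((z.1.1.θ, z.1.2), z.2.1)) (by fun_prop)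
  have h := hX.integral_draw hR t (H := fun z => M.tdFun z.1 z.2
      * ⟪c z.1.1, M.score z.1.1.θ z.1.2 z.2.1⟫) ((M.measurable_tdFun R).mul
      ((hc.measurable.comp measurable_fst.fst).inner hs)) (by
        simp only [hX.tdFun_eq hR ht]; exact hi)
  simp only [hX.tdFun_eq hR ht] at h
  refine h.trans (integral_congr_ae (ae_of_all _ fun w => ?_))
  exact integral_tdFun_mul_score hM (hX.cur hR t w) (c (hX.par hR t w))

theorem integrable_tdError_mul_feat {t : ℕ} (ht : 1 ≤ t) : Integrable (fun w => X.tdError M t w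
      * ⟪M.critErr (hX.par hR t w), M.feat (X.s t w)⟫) Pr := by
  refine ((hX.memLp_tdError hR hM ht).integrable (by norm_num)).mul_bdd
    (c := errBound lam C R * 1) ?_ ?_
  · exact (((parLip_critErr hM).continuous.measurable.comp (hX.measurable_par hR t)).inner
      (M.feat_meas.comp (hX.measurable_cur hR t).snd)).aestronglyMeasurable
  · refine ae_of_all _ fun w => (norm_inner_le_norm _ _).trans ?_
    exact mul_le_mul ((parLip_critErr hM).bound _) (M.norm_feat_le _) (norm_nonneg _)
      ((norm_nonneg _).trans ((parLip_critErr hM).bound (hX.par hR t w)))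

theorem integral_tdError_mul_feat {t : ℕ} (ht : 1 ≤ t) : ∫ w, X.tdError M t w
      * ⟪M.critErr (hX.par hR t w), M.feat (X.s t w)⟫ ∂Pr
      = ∫ w, M.critNoise (hX.par hR t w) (X.s t w) ∂Pr := by
  have hi := hX.integrable_tdError_mul_feat hR hM ht
  have h := hX.integral_draw hR t (H := fun z => M.tdFun z.1 z.2
      * ⟪M.critErr z.1.1, M.feat z.1.2⟫) ((M.measurable_tdFun R).mul
      (((parLip_critErr hM).continuous.measurable.comp measurable_fst.fst).inner
        (M.feat_meas.comp measurable_fst.snd))) (by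
        simp only [hX.tdFun_eq hR ht]; exact hi)
  simp only [hX.tdFun_eq hR ht] at h
  refine h.trans (integral_congr_ae (ae_of_all _ fun w => ?_))
  exact integral_tdFun_mul_feat hM (hX.cur hR t w)

omit hM in
theorem integrable_regularity {f : M.Par R → St → ℝ} {B Λ : ℝ} (hf : M.Regularity f B Λ)
    (t t' : ℕ) : Integrable (fun w => f (hX.par hR t w) (X.s t' w)) Pr :=
  Integrable.of_bound (hf.measurable.comp ((hX.measurable_par hR t).prodMk
    (hX.measurable_cur hR t').snd)).aestronglyMeasurable B (ae_of_all _ fun _ => (hf.meas _).bound _)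

theorem integrable_mean {f : M.Par R → St → ℝ} {B Λ : ℝ} (hf : M.Regularity f B Λ)
    (t : ℕ) : Integrable (fun w => M.mean f (hX.par hR t w)) Pr :=
  Integrable.of_bound ((hf.measurable_mean hM).comp
    (hX.measurable_par hR t)).aestronglyMeasurable B (ae_of_all _ fun _ => abs_mean_le hM hf _)

/-- The bias of the Markovian noise, via the Poisson equation. -/
theorem integral_sub_mean {f : M.Par R → St → ℝ} {B Λ : ℝ} (hf : M.Regularity f B Λ)
    (t : ℕ) : ∫ w, f (hX.par hR t w) (X.s t w) ∂Pr - ∫ w, M.mean f (hX.par hR t w) ∂Pr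
      = ∫ w, M.poisson f (hX.par hR t w) (X.s t w) ∂Pr
        - ∫ w, M.poisson f (hX.par hR t w) (X.s (t + 1) w) ∂Pr := by
  have hu := hf.poisson hM
  have h := hX.integral_draw hR t (H := fun z => M.poisson f z.1.1 z.2.2.2)
    (hu.measurable.comp (f := fun z : (M.Par R × St) × Ac × St × St => (z.1.1, z.2.2.2))
      (by fun_prop)) (hX.integrable_regularity hR hu t (t + 1))
  -- Given the past, the next state is drawn from the sampling kernel at the current parameters, so
  -- the Poisson equation evaluates the conditional mean of the solution there.
  have e : ∀ w, ∫ u, M.poisson f (hX.par hR t w) u.2.2 ∂M.sampleStep (X.θ t w, X.s t w)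
      = M.poisson f (hX.par hR t w) (X.s t w) - f (hX.par hR t w) (X.s t w)
        + M.mean f (hX.par hR t w) := fun w =>
    (integral_sampleStep_snd (hu.meas _) _ _).trans (poisson_eq hf.meas (hX.par hR t w) (X.s t w))
  have h' := h.trans (integral_congr_ae (ae_of_all _ e))
  have e3 : ∫ w, M.poisson f (hX.par hR t w) (X.s (t + 1) w) ∂Pr = _ := h'
  rw [e3, integral_add (f := fun w => M.poisson f (hX.par hR t w) (X.s t w)
    - f (hX.par hR t w) (X.s t w)) ((hX.integrable_regularity hR hu t t).sub
    (hX.integrable_regularity hR hf t t)) (hX.integrable_mean hR hM hf t),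
    integral_sub (hX.integrable_regularity hR hu t t) (hX.integrable_regularity hR hf t t)]
  ring

end

end Trajectory.IsRun

end

/-! ### Sizes of the parameter steps and the accumulated Markovian noise. -/

noncomputable section

/-- One step of a perturbed stochastic approximation, seen from a drifting target. -/
theorem norm_sq_step_le {E : Type*} [NormedAddCommGroup E] [InnerProductSpace ℝ E]
    {z p l r₁ r₂ z' : E} {a b c e f B : ℝ} (hz' : ‖z'‖ ≤ ‖z + p - (l + r₁ + r₂)‖)
    (hz : ‖z‖ ≤ B) (hp : ‖p‖ ≤ a) (hlr : ‖l + r₁‖ ≤ b) (hr₂ : ‖r₂‖ ≤ c) (hr₁ : ‖r₁‖ ≤ e)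
    (hf : 3 * (a ^ 2 + b ^ 2 + c ^ 2) + 2 * B * (e + c) ≤ f) :
    ‖z'‖ ^ 2 ≤ ‖z‖ ^ 2 + 2 * ⟪z, p⟫ - 2 * ⟪z, l⟫ + f := by
  have h0 : ‖z'‖ ^ 2 ≤ ‖z + (p - (l + r₁) - r₂)‖ ^ 2 := by
    have e : z + p - (l + r₁ + r₂) = z + (p - (l + r₁) - r₂) := by abel
    rw [← e]; gcongr
  rw [norm_add_sq_real, inner_sub_right, inner_sub_right, inner_add_right] at h0
  -- The inner products with `p` and `l` are kept exactly. Those with the remainders `r₁` and `r₂`,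
  -- which are of second order in the application, are estimated by norms.
  have h1 : -⟪z, r₁⟫ ≤ B * e := (neg_le_abs _).trans ((abs_real_inner_le_norm _ _).trans
    (mul_le_mul hz hr₁ (norm_nonneg _) ((norm_nonneg _).trans hz)))
  have h2 : -⟪z, r₂⟫ ≤ B * c := (neg_le_abs _).trans ((abs_real_inner_le_norm _ _).trans
    (mul_le_mul hz hr₂ (norm_nonneg _) ((norm_nonneg _).trans hz)))
  have h3 : ‖p - (l + r₁) - r₂‖ ≤ a + b + c :=
    (norm_sub_le _ _).trans (add_le_add ((norm_sub_le _ _).trans (add_le_add hp hlr)) hr₂)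
  have h4 : ‖p - (l + r₁) - r₂‖ ^ 2 ≤ (a + b + c) ^ 2 := by gcongr
  have h5 : (a + b + c) ^ 2 ≤ 3 * (a ^ 2 + b ^ 2 + c ^ 2) := by
    nlinarith [sq_nonneg (a - b), sq_nonneg (b - c), sq_nonneg (a - c)]
  linarith

namespace Trajectory.IsRun

open ParamMDP

variable {St Ac : Type*} [MeasurableSpace St] [MeasurableSpace Ac] {m k d : ℕ}
  {M : ParamMDP St Ac m k d} {R L S C D lam : ℝ} {Ω : Type*} [MeasurableSpace Ω]
  {X : Trajectory Ω St Ac m k d} {Pr : Measure Ω} [IsProbabilityMeasure Pr]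
  {𝓕 : Filtration ℕ (inferInstance : MeasurableSpace Ω)} {ηθ ηω ηφ : ℕ → ℝ}
  {h : ℕ → Ω → Euc k} {cθ cω cφ Cφ : ℝ}

/-- The step sizes and the update rule of the reward parameter. -/
structure Steps (X : Trajectory Ω St Ac m k d) (Pr : Measure Ω) (ηθ ηω ηφ : ℕ → ℝ)
    (h : ℕ → Ω → Euc k) (cθ cω cφ Cφ : ℝ) : Prop where
  cθ_pos : 0 < cθ
  cω_pos : 0 < cω
  cφ_nonneg : 0 ≤ cφ
  actor : ∀ t : ℕ, 1 ≤ t → ηθ t = cθ / √(t : ℝ)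
  critic : ∀ t : ℕ, 1 ≤ t → ηω t = cω / √(t : ℝ)
  rate : ∀ t : ℕ, 1 ≤ t → ηφ t = cφ / (t : ℝ)
  reward : ∀ t w, X.φ (t + 1) w = X.φ t w + ηφ t • h t w
  memLp : ∀ t, MemLp (h t) 2 Pr
  bound : ∀ t, ∫ w, ‖h t w‖ ^ 2 ∂Pr ≤ Cφ ^ 2

variable (hX : X.IsRun M Pr 𝓕 ηθ ηω R) (hR : 0 ≤ R)
  (hS : Steps X Pr ηθ ηω ηφ h cθ cω cφ Cφ) (hM : M.Regular lam L S C D)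

include hS

theorem norm_phi_sub_eq {t : ℕ} (ht : 1 ≤ t) (w : Ω) :
    ‖X.φ (t + 1) w - X.φ t w‖ = cφ / t * ‖h t w‖ := by
  have h0 := hS.cφ_nonneg
  rw [hS.reward, add_sub_cancel_left, hS.rate t ht, norm_smul, Real.norm_of_nonneg (by positivity)]

theorem norm_phi_sub_le {t : ℕ} (ht : 1 ≤ t) (w : Ω) :
    ‖X.φ (t + 1) w - X.φ t w‖ ≤ (√(t : ℝ))⁻¹ ^ 2 * (cφ * (1 + ‖h t w‖ ^ 2)) := by
  have h0 := hS.cφ_nonneg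
  have ht' : (0 : ℝ) ≤ t := by positivity
  rw [norm_phi_sub_eq hS ht, inv_pow, Real.sq_sqrt ht', div_mul_eq_mul_div, div_eq_inv_mul]
  gcongr
  nlinarith [sq_nonneg (‖h t w‖ - 1)]

include hX hM

theorem theta_sub_eq {t : ℕ} (ht : 1 ≤ t) (w : Ω) : X.θ (t + 1) w - X.θ t w
    = ((√(t : ℝ))⁻¹ * cθ * X.tdError M t w) • M.score (X.θ t w) (X.s t w) (X.a t w) := by
  rw [hX.actor, add_sub_cancel_left, hS.actor t ht, div_eq_inv_mul]

theorem norm_theta_sub_le {t : ℕ} (ht : 1 ≤ t) (w : Ω) :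
    ‖X.θ (t + 1) w - X.θ t w‖ ≤ (√(t : ℝ))⁻¹ * (cθ * L * |X.tdError M t w|) := by
  have h0 := hS.cθ_pos.le
  rw [hX.theta_sub_eq hS hM ht, norm_smul, norm_mul, Real.norm_of_nonneg (by positivity),
    Real.norm_eq_abs]
  calc _ ≤ (√(t : ℝ))⁻¹ * cθ * |X.tdError M t w| * L := by
        gcongr; exact hM.policy.score_le _ _ _
    _ = _ := by ring

theorem norm_theta_sub_sq_le {t : ℕ} (ht : 1 ≤ t) (w : Ω) :
    ‖X.θ (t + 1) w - X.θ t w‖ ^ 2 ≤ (√(t : ℝ))⁻¹ ^ 2 * ((cθ * L) ^ 2 * X.tdError M t w ^ 2) := by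
  have h1 := pow_le_pow_left₀ (norm_nonneg _) (hX.norm_theta_sub_le hS hM ht w) 2
  rwa [mul_pow, mul_pow, sq_abs] at h1

include hR

theorem norm_omega_sub_le {t : ℕ} (ht : 1 ≤ t) (w : Ω) :
    ‖ballProj R (X.ω (t + 1) w) - ballProj R (X.ω t w)‖
      ≤ (√(t : ℝ))⁻¹ * (cω * |X.tdError M t w|) := by
  have h0 := hS.cω_pos.le
  have h1 := hX.ballProj_omega hR ht w
  rw [hX.ballProj_omega hR (by lia), hX.critic, h1]
  refine (norm_ballProj_sub_le (h1 ▸ norm_ballProj_le hR _)).trans ?_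
  rw [add_sub_cancel_left, norm_smul, norm_mul, hS.critic t ht, Real.norm_of_nonneg (by positivity),
    div_eq_inv_mul, Real.norm_eq_abs]
  calc _ ≤ (√(t : ℝ))⁻¹ * cω * |X.tdError M t w| * 1 := by gcongr; exact M.norm_feat_le _
    _ = _ := by ring

/-- The reward step has size `1/t`, so its square root has size `1/√t`, like the actor and critic
steps. The bounds `|δ| ≤ 1 + δ²` and `√q ≤ q` for `q ≥ 1` leave only second moments to integrate. -/
theorem gap_le {t : ℕ} (ht : 1 ≤ t) (w : Ω) : Par.gap (hX.par hR t w) (hX.par hR (t + 1) w)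
    ≤ (√(t : ℝ))⁻¹ * ((cθ * L + cω) * (1 + X.tdError M t w ^ 2)
      + (cφ + √cφ) * (1 + ‖h t w‖ ^ 2)) := by
  have hL := hM.L_nonneg
  have hcθ := hS.cθ_pos.le
  have hcω := hS.cω_pos.le
  have hcφ := hS.cφ_nonneg
  have h1 := hX.norm_theta_sub_le hS hM ht w
  have h2 := hX.norm_omega_sub_le hR hS hM ht w
  have h3 := norm_phi_sub_le hS ht w
  have ht' : (1 : ℝ) ≤ t := by exact_mod_cast ht
  have hs : (√(t : ℝ))⁻¹ ≤ 1 := inv_le_one_of_one_le₀ (Real.one_le_sqrt.2 ht')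
  set η := (√(t : ℝ))⁻¹ with hη
  have hη0 : 0 ≤ η := by positivity
  have hδ : |X.tdError M t w| ≤ 1 + X.tdError M t w ^ 2 := by
    rw [← sq_abs]; nlinarith [sq_nonneg (|X.tdError M t w| - 1)]
  set q := 1 + ‖h t w‖ ^ 2 with hq
  have hq1 : 1 ≤ q := by rw [hq]; nlinarith [sq_nonneg ‖h t w‖]
  have h4 : √‖X.φ (t + 1) w - X.φ t w‖ ≤ η * (√cφ * q) := by
    refine (Real.sqrt_le_sqrt h3).trans ?_
    rw [Real.sqrt_mul (by positivity), Real.sqrt_sq hη0, Real.sqrt_mul hcφ]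
    gcongr
    rw [Real.sqrt_le_left (by linarith)]
    nlinarith
  have h5 : ‖X.φ (t + 1) w - X.φ t w‖ ≤ η * (cφ * q) := by
    refine h3.trans ?_
    gcongr
    nlinarith
  have h6 : η * (cθ * L * |X.tdError M t w|) ≤ η * (cθ * L * (1 + X.tdError M t w ^ 2)) := by gcongr
  have h7 : η * (cω * |X.tdError M t w|) ≤ η * (cω * (1 + X.tdError M t w ^ 2)) := by gcongr
  change ‖X.θ (t + 1) w - X.θ t w‖ + ‖ballProj R (X.ω (t + 1) w) - ballProj R (X.ω t w)‖
    + ‖X.φ (t + 1) w - X.φ t w‖ + √‖X.φ (t + 1) w - X.φ t w‖ ≤ _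
  linarith

/-- Expected size of a step of the parameters, up to the factor `1 / √t`. -/
def stepBound (L C R cθ cω cφ Cφ : ℝ) : ℝ :=
  (cθ * L + cω) * (1 + tdBound C R) + (cφ + √cφ) * (1 + Cφ ^ 2)

omit hX hR hM in
theorem integrable_norm_sq (t : ℕ) : Integrable (fun w => ‖h t w‖ ^ 2) Pr :=
  (hS.memLp t).integrable_norm_pow (by norm_num)

/-- Let `u` be the Poisson solution and `x_t` the parameters. The difference of `u(x_t, s_t)` and
`u(x_t, s_{t+1})` splits into a telescoping difference, which leaves two boundary terms, and the
change of `u(·, s_{t+1})` from `x_t` to `x_{t+1}`. The modulus of continuity of `u` makes the latter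
`O(1/√t)` in mean. -/
theorem abs_sum_noise_le {f : M.Par R → St → ℝ} {B Λ : ℝ} (hf : M.Regularity f B Λ) {a b : ℕ}
    (ha : 1 ≤ a) (hab : a ≤ b) :
    |∑ t ∈ Finset.Ico a b, (∫ w, f (hX.par hR t w) (X.s t w) ∂Pr
      - ∫ w, M.mean f (hX.par hR t w) ∂Pr)| ≤ 2 * (B / (1 - M.γ))
      + |(Λ + polLip L * (B / (1 - M.γ))) / (1 - M.γ)| * stepBound L C R cθ cω cφ Cφ
        * ∑ t ∈ Finset.Ico a b, (√(t : ℝ))⁻¹ := by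
  have hL := hM.L_nonneg
  have hcθ := hS.cθ_pos.le
  have hcω := hS.cω_pos.le
  have hcφ := hS.cφ_nonneg
  have hu := hf.poisson hM
  set Bu := B / (1 - M.γ)
  set Λu := (Λ + polLip L * Bu) / (1 - M.γ)
  have e1 : ∀ t ∈ Finset.Ico a b, ∫ w, f (hX.par hR t w) (X.s t w) ∂Pr
      - ∫ w, M.mean f (hX.par hR t w) ∂Pr
      = (∫ w, M.poisson f (hX.par hR t w) (X.s t w) ∂Pr
        - ∫ w, M.poisson f (hX.par hR (t + 1) w) (X.s (t + 1) w) ∂Pr)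
        + ∫ w, (M.poisson f (hX.par hR (t + 1) w) (X.s (t + 1) w)
          - M.poisson f (hX.par hR t w) (X.s (t + 1) w)) ∂Pr := by
    intro t _
    rw [hX.integral_sub_mean hR hM hf, integral_sub (hX.integrable_regularity hR hu _ _)
      (hX.integrable_regularity hR hu _ _)]
    ring
  have e2 : ∀ n, |∫ w, M.poisson f (hX.par hR n w) (X.s n w) ∂Pr| ≤ Bu := fun n => by
    have := norm_integral_le_of_norm_le_const (μ := Pr) (C := Bu)
      (ae_of_all _ fun w => (hu.meas (hX.par hR n w)).bound (X.s n w))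
    simpa using this
  have e3 : ∀ t ∈ Finset.Ico a b, |∫ w, (M.poisson f (hX.par hR (t + 1) w) (X.s (t + 1) w)
          - M.poisson f (hX.par hR t w) (X.s (t + 1) w)) ∂Pr|
      ≤ |Λu| * stepBound L C R cθ cω cφ Cφ * (√(t : ℝ))⁻¹ := by
    intro t ht
    have ht1 : 1 ≤ t := ha.trans (Finset.mem_Ico.1 ht).1
    have i1 : Integrable (fun w => (cθ * L + cω) * (1 + X.tdError M t w ^ 2)) Pr :=
      ((integrable_const 1).add (hX.memLp_tdError hR hM ht1).integrable_sq).const_mul _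
    have i2 : Integrable (fun w => (cφ + √cφ) * (1 + ‖h t w‖ ^ 2)) Pr :=
      ((integrable_const 1).add (integrable_norm_sq hS t)).const_mul _
    have hi : Integrable (fun w => |Λu| * ((√(t : ℝ))⁻¹ * ((cθ * L + cω) * (1 + X.tdError M t w ^ 2)
        + (cφ + √cφ) * (1 + ‖h t w‖ ^ 2)))) Pr := ((i1.add i2).const_mul (√(t : ℝ))⁻¹).const_mul |Λu|
    rw [← Real.norm_eq_abs]
    refine (norm_integral_le_of_norm_le hi (ae_of_all _ fun w => ?_)).trans ?_
    · refine ((hu.lip (X.s (t + 1) w)).lip _ _).trans ?_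
      refine (mul_le_mul_of_nonneg_right (le_abs_self _) (Par.gap_nonneg _ _)).trans ?_
      exact mul_le_mul_of_nonneg_left (hX.gap_le hR hS hM ht1 w) (abs_nonneg _)
    · rw [integral_const_mul, integral_const_mul, integral_add i1 i2, integral_const_mul,
        integral_const_mul, integral_add (integrable_const _)
        (hX.memLp_tdError hR hM ht1).integrable_sq, integral_add (integrable_const _)
        (integrable_norm_sq hS t)]
      have h1 := hX.integral_tdError_sq_le hR hM ht1
      have h2 := hS.bound t
      simp only [integral_const, probReal_univ, one_smul]
      rw [mul_comm (√(t : ℝ))⁻¹, ← mul_assoc]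
      unfold stepBound
      gcongr
  rw [Finset.sum_congr rfl e1, Finset.sum_add_distrib]
  have e4 := Finset.sum_range_sub' (fun t => ∫ w, M.poisson f (hX.par hR t w) (X.s t w) ∂Pr)
  have e5 : ∑ t ∈ Finset.Ico a b, (∫ w, M.poisson f (hX.par hR t w) (X.s t w) ∂Pr
        - ∫ w, M.poisson f (hX.par hR (t + 1) w) (X.s (t + 1) w) ∂Pr)
      = ∫ w, M.poisson f (hX.par hR a w) (X.s a w) ∂Pr
        - ∫ w, M.poisson f (hX.par hR b w) (X.s b w) ∂Pr := by
    rw [Finset.sum_Ico_eq_sub _ hab, e4, e4]; ring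
  rw [e5]
  have e6 := (Finset.abs_sum_le_sum_abs _ (Finset.Ico a b)).trans (Finset.sum_le_sum e3)
  rw [← Finset.mul_sum] at e6
  have e7 := abs_le.1 (e2 a)
  have e8 := abs_le.1 (e2 b)
  refine (abs_add_le _ _).trans (add_le_add (abs_le.2 ⟨?_, ?_⟩) e6) <;> linarith

end Trajectory.IsRun

end

/-! ### One-step inequalities for the objective and for the critic error. -/

noncomputable section

namespace Trajectory.IsRun

open ParamMDP

variable {St Ac : Type*} [MeasurableSpace St] [MeasurableSpace Ac] {m k d : ℕ}
  {M : ParamMDP St Ac m k d} {R L S C D lam : ℝ} {Ω : Type*} [MeasurableSpace Ω]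
  {X : Trajectory Ω St Ac m k d} {Pr : Measure Ω} [IsProbabilityMeasure Pr]
  {𝓕 : Filtration ℕ (inferInstance : MeasurableSpace Ω)} {ηθ ηω ηφ : ℕ → ℝ}
  {h : ℕ → Ω → Euc k} {cθ cω cφ Cφ : ℝ}
  (hX : X.IsRun M Pr 𝓕 ηθ ηω R) (hR : 0 ≤ R)
  (hS : Steps X Pr ηθ ηω ηφ h cθ cω cφ Cφ) (hM : M.Regular lam L S C D)

/-- Coefficient of the squared TD error in the second order terms of the actor recursion. -/
def actorTdCoeff (γ L S C cθ : ℝ) : ℝ := (1 - γ)⁻¹ * rewardQuad γ L S C * (cθ * L) ^ 2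

/-- Coefficient of the reward drift in the second order terms of the actor recursion. -/
def actorDriftCoeff (γ D cφ : ℝ) : ℝ := (1 - γ)⁻¹ * (D * cφ)

/-- Coefficient of the squared TD error in the second order terms of the critic recursion. -/
def criticTdCoeff (γ lam L S C R cθ cω : ℝ) : ℝ :=
  3 * cω ^ 2 + 3 * (starLip γ lam L C * (cθ * L)) ^ 2
    + 2 * errBound lam C R * (starQuad γ lam L S C * (cθ * L) ^ 2)

/-- Coefficient of the reward drift in the second order terms of the critic recursion. -/
def criticDriftCoeff (lam C D R cφ : ℝ) : ℝ :=
  3 * (D / lam * cφ) ^ 2 + 2 * errBound lam C R * (D / lam * cφ)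

theorem _root_.ParamMDP.Regular.actorTdCoeff_nonneg (hM : M.Regular lam L S C D)
    (hne : M.rewardSet.Nonempty) (cθ : ℝ) : 0 ≤ actorTdCoeff M.γ L S C cθ := by
  obtain ⟨φ, hφ⟩ := hne
  exact mul_nonneg (quadApprox_J hM.policy hM.L_nonneg hM.S_nonneg hM.C_nonneg hM.reward
    hφ).nonneg (sq_nonneg _)

theorem _root_.ParamMDP.Regular.actorDriftCoeff_nonneg (hM : M.Regular lam L S C D)
    (hcφ : 0 ≤ cφ) : 0 ≤ actorDriftCoeff M.γ D cφ := by
  have h0 := inv_pos.2 M.one_sub_gamma_pos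
  have hD := hM.D_nonneg
  unfold actorDriftCoeff
  positivity

theorem _root_.ParamMDP.Regular.errBound_nonneg (hM : M.Regular lam L S C D) (hR : 0 ≤ R) :
    0 ≤ errBound lam C R := by
  have hlam := hM.lam_pos
  have hC := hM.C_nonneg
  unfold errBound
  positivity

theorem _root_.ParamMDP.Regular.criticTdCoeff_nonneg (hM : M.Regular lam L S C D)
    (hne : M.rewardSet.Nonempty) (hR : 0 ≤ R) (cθ cω : ℝ) :
    0 ≤ criticTdCoeff M.γ lam L S C R cθ cω := by
  obtain ⟨φ, hφ⟩ := hne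
  have hEB := hM.errBound_nonneg hR
  have hsq := (quadApprox_omegaStar hM.lam_pos hM.explore hM.policy hM.L_nonneg hM.S_nonneg
    hM.C_nonneg hM.reward hφ).nonneg
  unfold criticTdCoeff
  positivity

theorem _root_.ParamMDP.Regular.criticDriftCoeff_nonneg (hM : M.Regular lam L S C D) (hR : 0 ≤ R)
    (hcφ : 0 ≤ cφ) : 0 ≤ criticDriftCoeff lam C D R cφ := by
  have hlam := hM.lam_pos
  have hD := hM.D_nonneg
  have hEB := hM.errBound_nonneg hR
  unfold criticDriftCoeff
  positivity

section pointwise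

include hS hM

/-- Taylor expansion in `θ` at the old reward parameter, followed by the change of reward parameter
at the new `θ`; the latter is Lipschitz and of order `1/t`. -/
theorem le_J_step {t : ℕ} (ht : 1 ≤ t) (w : Ω) :
    (√(t : ℝ))⁻¹ * (cθ * (X.tdError M t w
        * ⟪M.gradJ (hX.par hR t w), M.score (X.θ t w) (X.s t w) (X.a t w)⟫))
      - (√(t : ℝ))⁻¹ ^ 2 * (actorTdCoeff M.γ L S C cθ * X.tdError M t w ^ 2
        + actorDriftCoeff M.γ D cφ * (1 + ‖h t w‖ ^ 2))
      ≤ M.J (X.φ (t + 1) w) (X.θ (t + 1) w) - M.J (X.φ t w) (X.θ t w) := by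
  have h0 := inv_pos.2 M.one_sub_gamma_pos
  have hq := quadApprox_J hM.policy hM.L_nonneg hM.S_nonneg hM.C_nonneg hM.reward (hX.φ_mem t w)
  have h1 := hq.remainder (X.θ t w) (X.θ (t + 1) w)
  have h2 := abs_J_sub_le hM.reward (hX.φ_mem t w) (hX.φ_mem (t + 1) w) (X.θ (t + 1) w)
  have h3 := mul_le_mul_of_nonneg_left (hX.norm_theta_sub_sq_le hS hM ht w) hq.nonneg
  have h4 := mul_le_mul_of_nonneg_left (mul_le_mul_of_nonneg_left (norm_phi_sub_le hS ht w)
    hM.D_nonneg) h0.le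
  have e : M.JDeriv (X.φ t w) (X.θ t w) (X.θ (t + 1) w - X.θ t w)
      = (√(t : ℝ))⁻¹ * cθ * X.tdError M t w
        * ⟪M.gradJ (hX.par hR t w), M.score (X.θ t w) (X.s t w) (X.a t w)⟫ := by
    rw [hX.theta_sub_eq hS hM ht, map_smul, smul_eq_mul]
    congr 1
    exact JDeriv_gradJ hM (hX.par hR t w) _
  rw [e] at h1
  have h5 := (abs_le.1 h1).1
  have h6 := (abs_le.1 h2).1
  unfold actorTdCoeff actorDriftCoeff
  linarith

/-- The new target lies in the ball, so the projection does not increase the distance to it. The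
displacement of the target is split into its linear part `l` along the actor step, the Taylor
remainder `r₁`, and the effect `r₂` of the reward step. Only `l` is of first order in `1/√t`. -/
theorem criticSq_step_le (hstar : ∀ φ ∈ M.rewardSet, ∀ θ, ‖M.omegaStar φ θ‖ ≤ R) {t : ℕ}
    (ht : 1 ≤ t) (w : Ω) :
    ‖M.critErr (hX.par hR (t + 1) w)‖ ^ 2 - ‖M.critErr (hX.par hR t w)‖ ^ 2
      ≤ (√(t : ℝ))⁻¹ * (2 * cω * (X.tdError M t w
          * ⟪M.critErr (hX.par hR t w), M.feat (X.s t w)⟫)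
        - 2 * cθ * (X.tdError M t w
          * ⟪M.starDir (hX.par hR t w), M.score (X.θ t w) (X.s t w) (X.a t w)⟫))
      + (√(t : ℝ))⁻¹ ^ 2 * (criticTdCoeff M.γ lam L S C R cθ cω * X.tdError M t w ^ 2
        + criticDriftCoeff lam C D R cφ * (1 + ‖h t w‖ ^ 2)) := by
  have hcω := hS.cω_pos.le
  have hcφ := hS.cφ_nonneg
  have hlam := hM.lam_pos
  have hD := hM.D_nonneg
  have hne : M.rewardSet.Nonempty := ⟨_, hX.φ_mem t w⟩
  have hsl := hM.starLip_nonneg hne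
  have hq := quadApprox_omegaStar hM.lam_pos hM.explore hM.policy hM.L_nonneg hM.S_nonneg
    hM.C_nonneg hM.reward (hX.φ_mem t w)
  have hsq := hq.nonneg
  have hEB : 0 ≤ errBound lam C R :=
    (norm_nonneg _).trans ((parLip_critErr hM).bound (hX.par hR t w))
  have hω := hX.ballProj_omega hR ht w
  have hω1 := hX.ballProj_omega hR (t := t + 1) (by lia) w
  set η := (√(t : ℝ))⁻¹ with hη
  have hη0 : 0 ≤ η := by positivity
  set δ := X.tdError M t w with hδ
  set ψ := M.score (X.θ t w) (X.s t w) (X.a t w)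
  set z := M.critErr (hX.par hR t w) with hz
  have ez : z = X.ω t w - M.omegaStar (X.φ t w) (X.θ t w) := by
    rw [hz]; unfold critErr; change ballProj R (X.ω t w) - _ = _; rw [hω]; rfl
  have ez' : M.critErr (hX.par hR (t + 1) w)
      = X.ω (t + 1) w - M.omegaStar (X.φ (t + 1) w) (X.θ (t + 1) w) := by
    unfold critErr; change ballProj R (X.ω (t + 1) w) - _ = _; rw [hω1]; rfl
  have hηω : ηω t = η * cω := by rw [hS.critic t ht, div_eq_inv_mul]
  set dθ := X.θ (t + 1) w - X.θ t w with hdθ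
  set dφ := X.φ (t + 1) w - X.φ t w with hdφ
  set p : Euc d := (η * cω * δ) • M.feat (X.s t w) with hp
  set l : Euc d := M.starDeriv (X.φ t w) (X.θ t w) dθ with hl
  set r₁ : Euc d := M.omegaStar (X.φ t w) (X.θ (t + 1) w) - M.omegaStar (X.φ t w) (X.θ t w) - l
    with hr₁
  set r₂ : Euc d := M.omegaStar (X.φ (t + 1) w) (X.θ (t + 1) w)
    - M.omegaStar (X.φ t w) (X.θ (t + 1) w) with hr₂
  have hz' : ‖M.critErr (hX.par hR (t + 1) w)‖ ≤ ‖z + p - (l + r₁ + r₂)‖ := by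
    have e1 : z + p - (l + r₁ + r₂) = (X.ω t w + p)
        - M.omegaStar (X.φ (t + 1) w) (X.θ (t + 1) w) := by
      rw [ez, hr₁, hr₂]; abel
    rw [e1, ez', hX.critic, hηω]
    exact norm_ballProj_sub_le (hstar _ (hX.φ_mem _ w) _)
  have hpa : ‖p‖ ≤ η * cω * |δ| := by
    rw [hp, norm_smul, norm_mul, Real.norm_of_nonneg (by positivity), Real.norm_eq_abs]
    exact mul_le_of_le_one_right (by positivity) (M.norm_feat_le _)
  have hlr : ‖l + r₁‖ ≤ starLip M.γ lam L C * ‖dθ‖ := by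
    rw [hr₁, add_sub_cancel]
    exact hq.norm_sub_le (norm_starDeriv_le hM.lam_pos hM.explore hM.policy hM.L_nonneg
      hM.S_nonneg hM.C_nonneg hM.reward (hX.φ_mem t w)) _ _
  have hr₂' : ‖r₂‖ ≤ D / lam * ‖dφ‖ := norm_omegaStar_sub_le hM.lam_pos hM.explore hM.reward
    (hX.φ_mem t w) (hX.φ_mem _ w) _
  have hr₁' : ‖r₁‖ ≤ starQuad M.γ lam L S C * ‖dθ‖ ^ 2 := hq.remainder _ _
  have hmain := norm_sq_step_le hz' ((parLip_critErr hM).bound _) hpa hlr hr₂' hr₁' le_rfl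
  have e2 : ⟪z, p⟫ = η * cω * δ * ⟪z, M.feat (X.s t w)⟫ := by rw [hp, real_inner_smul_right]
  -- The adjoint moves the derivative of `ω*` onto the critic error, so that the drift of the target
  -- becomes a pairing with the score, like the actor term.
  have e3 : ⟪z, l⟫ = η * cθ * δ * ⟪M.starDir (hX.par hR t w), ψ⟫ := by
    rw [hl, hdθ, hX.theta_sub_eq hS hM ht, map_smul, real_inner_smul_right]
    congr 1
    unfold starDir
    rw [ContinuousLinearMap.adjoint_inner_left]
    rfl
  rw [e2, e3] at hmain
  have g1 : ‖dθ‖ ^ 2 ≤ η ^ 2 * ((cθ * L) ^ 2 * δ ^ 2) := hX.norm_theta_sub_sq_le hS hM ht w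
  have g2 : ‖dφ‖ ≤ η ^ 2 * (cφ * (1 + ‖h t w‖ ^ 2)) := norm_phi_sub_le hS ht w
  have g3 : ‖dφ‖ ^ 2 ≤ η ^ 2 * (cφ ^ 2 * (1 + ‖h t w‖ ^ 2)) := by
    have ht' : (1 : ℝ) ≤ t := by exact_mod_cast ht
    have e4 : η ^ 2 = (t : ℝ)⁻¹ := by rw [hη, inv_pow, Real.sq_sqrt (by positivity)]
    rw [hdφ, norm_phi_sub_eq hS ht, e4, mul_pow, div_pow, div_eq_inv_mul, mul_assoc]
    have : ((t : ℝ) ^ 2)⁻¹ ≤ (t : ℝ)⁻¹ := inv_anti₀ (by positivity) (by nlinarith)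
    gcongr
    linarith
  have k1 : (starLip M.γ lam L C * ‖dθ‖) ^ 2
      ≤ starLip M.γ lam L C ^ 2 * (η ^ 2 * ((cθ * L) ^ 2 * δ ^ 2)) := by
    rw [mul_pow]; gcongr
  have k2 : (D / lam * ‖dφ‖) ^ 2 ≤ (D / lam) ^ 2 * (η ^ 2 * (cφ ^ 2 * (1 + ‖h t w‖ ^ 2))) := by
    rw [mul_pow]; gcongr
  have k3 : 2 * errBound lam C R * (starQuad M.γ lam L S C * ‖dθ‖ ^ 2 + D / lam * ‖dφ‖)
      ≤ 2 * errBound lam C R * (starQuad M.γ lam L S C * (η ^ 2 * ((cθ * L) ^ 2 * δ ^ 2))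
        + D / lam * (η ^ 2 * (cφ * (1 + ‖h t w‖ ^ 2)))) := by gcongr
  have k4 : (η * cω * |δ|) ^ 2 = η ^ 2 * cω ^ 2 * δ ^ 2 := by rw [mul_pow, mul_pow, sq_abs]
  unfold criticTdCoeff criticDriftCoeff
  rw [k4] at hmain
  linarith

end pointwise

/-- Constant of the second order terms after taking expectations. -/
def secondOrder (C R Cφ K₁ K₂ : ℝ) : ℝ := K₁ * tdBound C R + K₂ * (1 + Cφ ^ 2)

theorem secondOrder_nonneg {K₁ K₂ : ℝ} (h₁ : 0 ≤ K₁) (h₂ : 0 ≤ K₂) :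
    0 ≤ secondOrder C R Cφ K₁ K₂ := by
  unfold secondOrder tdBound
  positivity

include hX in
theorem nonempty_rewardSet : M.rewardSet.Nonempty := by
  obtain ⟨w⟩ : Nonempty Ω := nonempty_of_isProbabilityMeasure Pr
  exact ⟨_, hX.φ_mem 0 w⟩

include hX hR hS hM

theorem integrable_secondOrder {t : ℕ} (ht : 1 ≤ t) (K₁ K₂ : ℝ) : Integrable
    (fun w => (√(t : ℝ))⁻¹ ^ 2 * (K₁ * X.tdError M t w ^ 2 + K₂ * (1 + ‖h t w‖ ^ 2))) Pr :=
  (((hX.memLp_tdError hR hM ht).integrable_sq.const_mul K₁).add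
    (((integrable_const 1).add (integrable_norm_sq hS t)).const_mul K₂)).const_mul _

theorem integral_secondOrder_le {t : ℕ} (ht : 1 ≤ t) {K₁ K₂ : ℝ} (h₁ : 0 ≤ K₁) (h₂ : 0 ≤ K₂) :
    ∫ w, (√(t : ℝ))⁻¹ ^ 2 * (K₁ * X.tdError M t w ^ 2 + K₂ * (1 + ‖h t w‖ ^ 2)) ∂Pr
      ≤ (√(t : ℝ))⁻¹ ^ 2 * secondOrder C R Cφ K₁ K₂ := by
  have i2 : Integrable (fun w => K₂ * (1 + ‖h t w‖ ^ 2)) Pr :=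
    ((integrable_const 1).add (integrable_norm_sq hS t)).const_mul _
  rw [integral_const_mul, integral_add ((hX.memLp_tdError hR hM ht).integrable_sq.const_mul K₁) i2,
    integral_const_mul, integral_const_mul, integral_add (integrable_const _)
      (integrable_norm_sq hS t)]
  have k1 := hX.integral_tdError_sq_le hR hM ht
  have k2 := hS.bound t
  simp only [integral_const, probReal_univ, one_smul]
  unfold secondOrder
  gcongr

omit hS in
theorem integrable_J (t : ℕ) : Integrable (fun w => M.J (X.φ t w) (X.θ t w)) Pr :=
  hX.integrable_comp_par hR (parLip_J hM).continuous (parLip_J hM).bound t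

omit hS in
theorem integrable_gradJ_sq (t : ℕ) : Integrable (fun w => ‖M.gradJ (hX.par hR t w)‖ ^ 2) Pr :=
  hX.integrable_comp_par hR (Q := fun x => ‖M.gradJ x‖ ^ 2) (B := gradBound M.γ L C ^ 2)
    ((parLip_gradJ hM).continuous.norm.pow 2) (fun x => by
      rw [norm_pow, norm_norm]; gcongr; exact (parLip_gradJ hM).bound x) t

omit hS in
theorem integrable_critErr_sq (t : ℕ) :
    Integrable (fun w => ‖M.critErr (hX.par hR t w)‖ ^ 2) Pr :=
  hX.integrable_comp_par hR (Q := fun x => ‖M.critErr x‖ ^ 2) (B := errBound lam C R ^ 2)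
    ((parLip_critErr hM).continuous.norm.pow 2) (fun x => by
      rw [norm_pow, norm_norm]; gcongr; exact (parLip_critErr hM).bound x) t

/-- The actor recursion in expectation. -/
theorem actor_recursion {t : ℕ} (ht : 1 ≤ t) :
    cθ * ((1 - M.γ) / 2 * ∫ w, ‖M.gradJ (hX.par hR t w)‖ ^ 2 ∂Pr
        - actorCoupling M.γ L * (∫ w, ‖M.critErr (hX.par hR t w)‖ ^ 2 ∂Pr + M.approxError ^ 2)
        + (∫ w, M.actorNoise (hX.par hR t w) (X.s t w) ∂Pr
          - ∫ w, M.mean M.actorNoise (hX.par hR t w) ∂Pr))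
      - (√(t : ℝ))⁻¹ * secondOrder C R Cφ (actorTdCoeff M.γ L S C cθ) (actorDriftCoeff M.γ D cφ)
      ≤ √(t : ℝ) * (∫ w, M.J (X.φ (t + 1) w) (X.θ (t + 1) w) ∂Pr
        - ∫ w, M.J (X.φ t w) (X.θ t w) ∂Pr) := by
  have h0 := inv_pos.2 M.one_sub_gamma_pos
  have hcθ := hS.cθ_pos.le
  have hmean : (1 - M.γ) / 2 * ∫ w, ‖M.gradJ (hX.par hR t w)‖ ^ 2 ∂Pr
        - actorCoupling M.γ L * (∫ w, ‖M.critErr (hX.par hR t w)‖ ^ 2 ∂Pr + M.approxError ^ 2)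
      ≤ ∫ w, M.mean M.actorNoise (hX.par hR t w) ∂Pr := by
    have i1 := hX.integrable_critErr_sq hR hM t
    have i2 : Integrable (fun w => actorCoupling M.γ L
        * (‖M.critErr (hX.par hR t w)‖ ^ 2 + M.approxError ^ 2)) Pr :=
      (i1.add (integrable_const _)).const_mul _
    have hle := integral_mono (((hX.integrable_gradJ_sq hR hM t).const_mul _).sub i2)
      (hX.integrable_mean hR hM (regularity_actorNoise hM hR) t)
      (fun w => le_integral_actorNoise hM (hX.par hR t w) hR)
    rw [integral_sub' ((hX.integrable_gradJ_sq hR hM t).const_mul _) i2, integral_const_mul,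
      integral_const_mul, integral_add i1 (integrable_const _)] at hle
    simpa using hle
  have hc := parLip_gradJ (R := R) hM
  have i1 := ((hX.integrable_tdError_mul_score hR hM ht hc.continuous hc.bound).const_mul
    cθ).const_mul (√(t : ℝ))⁻¹
  have i2 := hX.integrable_secondOrder hR hS hM ht (actorTdCoeff M.γ L S C cθ)
    (actorDriftCoeff M.γ D cφ)
  have hK₁ := hM.actorTdCoeff_nonneg (hX.nonempty_rewardSet) cθ
  have hK₂ := hM.actorDriftCoeff_nonneg hS.cφ_nonneg
  have hle := integral_mono (i1.sub i2) ((hX.integrable_J hR hM (t + 1)).sub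
    (hX.integrable_J hR hM t)) (fun w => hX.le_J_step hR hS hM ht w)
  rw [integral_sub' i1 i2, integral_sub' (hX.integrable_J hR hM (t + 1)) (hX.integrable_J hR hM t),
    integral_const_mul, integral_const_mul,
    hX.integral_tdError_mul_score hR hM ht hc.continuous hc.bound] at hle
  have h3 := hX.integral_secondOrder_le hR hS hM ht hK₁ hK₂
  have ht' : (0 : ℝ) < √(t : ℝ) := Real.sqrt_pos.2 (by exact_mod_cast ht)
  set N := ∫ w, M.actorNoise (hX.par hR t w) (X.s t w) ∂Pr with hN
  have hN' : ∫ w, M.actorDir (hX.par hR t w) (X.s t w) (M.gradJ (hX.par hR t w)) ∂Pr = N := rfl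
  rw [hN'] at hle
  -- Multiplying by `√t` makes the coefficient of the main term the constant `cθ`; the weights
  -- reappear in the summation by parts.
  have h4 := mul_le_mul_of_nonneg_left (hle.trans' (sub_le_sub_left h3 _)) ht'.le
  refine le_trans ?_ h4
  have e : √(t : ℝ) * ((√(t : ℝ))⁻¹ * (cθ * N) - (√(t : ℝ))⁻¹ ^ 2
      * secondOrder C R Cφ (actorTdCoeff M.γ L S C cθ) (actorDriftCoeff M.γ D cφ))
      = cθ * N - (√(t : ℝ))⁻¹
      * secondOrder C R Cφ (actorTdCoeff M.γ L S C cθ) (actorDriftCoeff M.γ D cφ) := by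
    field_simp
  rw [e]
  have := mul_le_mul_of_nonneg_left hmean hcθ
  linarith

/-- The critic recursion in expectation. -/
theorem critic_recursion (hstar : ∀ φ ∈ M.rewardSet, ∀ θ, ‖M.omegaStar φ θ‖ ≤ R) {t : ℕ}
    (ht : 1 ≤ t) :
    √(t : ℝ) * (∫ w, ‖M.critErr (hX.par hR (t + 1) w)‖ ^ 2 ∂Pr
        - ∫ w, ‖M.critErr (hX.par hR t w)‖ ^ 2 ∂Pr)
      ≤ 2 * cω * (-lam * ∫ w, ‖M.critErr (hX.par hR t w)‖ ^ 2 ∂Pr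
          + (∫ w, M.critNoise (hX.par hR t w) (X.s t w) ∂Pr
            - ∫ w, M.mean M.critNoise (hX.par hR t w) ∂Pr))
        + 2 * cθ * (critCoupling M.γ lam L C * (∫ w, ‖M.critErr (hX.par hR t w)‖ ^ 2 ∂Pr
            + ∫ w, ‖M.gradJ (hX.par hR t w)‖ ^ 2 ∂Pr + M.approxError ^ 2)
          - (∫ w, M.starNoise (hX.par hR t w) (X.s t w) ∂Pr
            - ∫ w, M.mean M.starNoise (hX.par hR t w) ∂Pr))
        + (√(t : ℝ))⁻¹ * secondOrder C R Cφ (criticTdCoeff M.γ lam L S C R cθ cω)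
          (criticDriftCoeff lam C D R cφ) := by
  have hcθ := hS.cθ_pos.le
  have hcω := hS.cω_pos.le
  have ip := hX.integrable_critErr_sq hR hM t
  have iq := hX.integrable_gradJ_sq hR hM t
  have hm1 : ∫ w, M.mean M.critNoise (hX.par hR t w) ∂Pr
      ≤ -lam * ∫ w, ‖M.critErr (hX.par hR t w)‖ ^ 2 ∂Pr := by
    rw [← integral_const_mul]
    exact integral_mono (hX.integrable_mean hR hM (regularity_critNoise hM) t) (ip.const_mul _)
      fun w => integral_critNoise_le hM (hX.par hR t w)
  have hm2 : -∫ w, M.mean M.starNoise (hX.par hR t w) ∂Pr ≤ critCoupling M.γ lam L C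
      * (∫ w, ‖M.critErr (hX.par hR t w)‖ ^ 2 ∂Pr
        + ∫ w, ‖M.gradJ (hX.par hR t w)‖ ^ 2 ∂Pr + M.approxError ^ 2) := by
    have i2 : Integrable (fun w => critCoupling M.γ lam L C * (‖M.critErr (hX.par hR t w)‖ ^ 2
        + ‖M.gradJ (hX.par hR t w)‖ ^ 2 + M.approxError ^ 2)) Pr :=
      ((ip.add iq).add (integrable_const _)).const_mul _
    have hle := integral_mono (hX.integrable_mean hR hM (regularity_starNoise hM hR) t).neg i2
      fun w => (neg_le_abs _).trans (abs_integral_starNoise_le hM (hX.par hR t w) hR)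
    rw [integral_const_mul, integral_add (f := fun w => ‖M.critErr (hX.par hR t w)‖ ^ 2
        + ‖M.gradJ (hX.par hR t w)‖ ^ 2) (ip.add iq) (integrable_const _),
      integral_add ip iq, integral_neg'] at hle
    simpa using hle
  have hc := parLip_starDir (R := R) hM
  have i1 := (hX.integrable_tdError_mul_feat hR hM ht).const_mul (2 * cω)
  have i2 := (hX.integrable_tdError_mul_score hR hM ht hc.continuous hc.bound).const_mul (2 * cθ)
  have i3 := hX.integrable_secondOrder hR hS hM ht (criticTdCoeff M.γ lam L S C R cθ cω)
    (criticDriftCoeff lam C D R cφ)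
  have hK₁ := hM.criticTdCoeff_nonneg hX.nonempty_rewardSet hR cθ cω
  have hK₂ := hM.criticDriftCoeff_nonneg hR hS.cφ_nonneg
  have i12 := (i1.sub i2).const_mul (√(t : ℝ))⁻¹
  have hle := integral_mono ((hX.integrable_critErr_sq hR hM (t + 1)).sub ip) (i12.add i3)
    (fun w => hX.criticSq_step_le hR hS hM hstar ht w)
  rw [integral_sub' (hX.integrable_critErr_sq hR hM (t + 1)) ip, integral_add' i12 i3,
    integral_const_mul, integral_sub' i1 i2, integral_const_mul, integral_const_mul,
    hX.integral_tdError_mul_feat hR hM ht,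
    hX.integral_tdError_mul_score hR hM ht hc.continuous hc.bound] at hle
  have h3 := hX.integral_secondOrder_le hR hS hM ht hK₁ hK₂
  have ht' : (0 : ℝ) < √(t : ℝ) := Real.sqrt_pos.2 (by exact_mod_cast ht)
  have hN' : ∫ w, M.actorDir (hX.par hR t w) (X.s t w) (M.starDir (hX.par hR t w)) ∂Pr
    = ∫ w, M.starNoise (hX.par hR t w) (X.s t w) ∂Pr := rfl
  rw [hN'] at hle
  set N := ∫ w, M.starNoise (hX.par hR t w) (X.s t w) ∂Pr
  set N' := ∫ w, M.critNoise (hX.par hR t w) (X.s t w) ∂Pr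
  have h4 := mul_le_mul_of_nonneg_left (hle.trans (add_le_add_right h3 _)) ht'.le
  refine h4.trans ?_
  have e : √(t : ℝ) * ((√(t : ℝ))⁻¹ * (2 * cω * N' - 2 * cθ * N) + (√(t : ℝ))⁻¹ ^ 2
      * secondOrder C R Cφ (criticTdCoeff M.γ lam L S C R cθ cω) (criticDriftCoeff lam C D R cφ))
      = 2 * cω * N' - 2 * cθ * N + (√(t : ℝ))⁻¹
      * secondOrder C R Cφ (criticTdCoeff M.γ lam L S C R cθ cω) (criticDriftCoeff lam C D R cφ) := by
    field_simp
  rw [e]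
  have := mul_le_mul_of_nonneg_left hm1 hcω
  have := mul_le_mul_of_nonneg_left hm2 hcθ
  linarith

end Trajectory.IsRun

end

/-! ### Summation over the second half of the run and solution of the coupled inequalities. -/

noncomputable section

theorem sum_inv_sqrt_le {a b : ℕ} (hab : a ≤ b) :
    ∑ t ∈ Finset.Ico a b, (√(t : ℝ))⁻¹ ≤ 3 * √(b : ℝ) := by
  have key : ∑ t ∈ Finset.Ico a b, (√(t : ℝ))⁻¹ ≤ 3 * √(b : ℝ) - √(a : ℝ) := by
    induction b, hab using Nat.le_induction with
    | base => have := Real.sqrt_nonneg (a : ℝ); simp; linarith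
    | succ n hn ih =>
      rw [Finset.sum_Ico_succ_top hn]
      -- The increment `2 (√(n+1) - √n)` would be smaller than `1/√n`; the factor `3` suffices from
      -- `n = 1` on. At `n = 0` the left side is zero by the convention for inverses.
      have h1 : (√(n : ℝ))⁻¹ ≤ 3 * √((n + 1 : ℕ) : ℝ) - 3 * √(n : ℝ) := by
        rcases Nat.eq_zero_or_pos n with rfl | hn0
        · simp
        have hx : 1 ≤ √(n : ℝ) := Real.one_le_sqrt.2 (by exact_mod_cast hn0)
        have hx2 : √(n : ℝ) ^ 2 = n := Real.sq_sqrt (by positivity)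
        have hy2 : √((n + 1 : ℕ) : ℝ) ^ 2 = √(n : ℝ) ^ 2 + 1 := by
          rw [hx2, Real.sq_sqrt (by positivity)]; push_cast; ring
        have hy := Real.sqrt_nonneg ((n + 1 : ℕ) : ℝ)
        generalize √((n + 1 : ℕ) : ℝ) = y at *
        generalize √(n : ℝ) = x at *
        have h2 : 1 + 3 * x ^ 2 ≤ 3 * x * y := by
          refine le_of_sq_le_sq ?_ (by positivity)
          rw [mul_pow, mul_pow, hy2]
          nlinarith
        rw [inv_le_iff_one_le_mul₀ (by linarith)]
        linarith
      linarith
  have := Real.sqrt_nonneg (a : ℝ)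
  linarith

/-- Summation by parts with weights `√t`. -/
theorem abs_sum_sqrt_mul_sub_le {j : ℕ → ℝ} {B : ℝ} (hj : ∀ t, |j t| ≤ B) {a b : ℕ} (hab : a ≤ b) :
    |∑ t ∈ Finset.Ico a b, √(t : ℝ) * (j (t + 1) - j t)| ≤ 2 * B * √(b : ℝ) := by
  -- Apart from the boundary terms there remains the sum of `j (t + 1)` against the increments of
  -- `√t`. These are nonnegative, so boundedness of `j` suffices.
  have key : |∑ t ∈ Finset.Ico a b, √(t : ℝ) * (j (t + 1) - j t) - (√(b : ℝ) * j b - √(a : ℝ) * j a)|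
      ≤ B * (√(b : ℝ) - √(a : ℝ)) := by
    induction b, hab using Nat.le_induction with
    | base => simp
    | succ n hn ih =>
      rw [Finset.sum_Ico_succ_top hn]
      have h1 : √(n : ℝ) ≤ √((n + 1 : ℕ) : ℝ) := Real.sqrt_le_sqrt (by push_cast; linarith)
      have h2 := abs_le.1 (hj (n + 1))
      have h3 := mul_le_mul_of_nonneg_left h2.1 (sub_nonneg.2 h1)
      have h4 := mul_le_mul_of_nonneg_left h2.2 (sub_nonneg.2 h1)
      have h5 := abs_le.1 ih
      rw [abs_le]
      constructor <;> linarith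
  have h1 := abs_le.1 key
  have h2 := abs_le.1 (hj a)
  have h3 := abs_le.1 (hj b)
  have ha := Real.sqrt_nonneg (a : ℝ)
  have hb := Real.sqrt_nonneg (b : ℝ)
  rw [abs_le]
  constructor <;> nlinarith

/-- Two coupled error inequalities whose feedback gain is less than one. -/
theorem coupled_bound {κ lam C₁ C₂ x P Q e r u v : ℝ} (hκ : 0 < κ) (hlam : 0 < lam)
    (hC₁ : 0 ≤ C₁) (hC₂ : 0 ≤ C₂) (hx : 0 ≤ x) (hP : 0 ≤ P) (he : 0 ≤ e)
    (hA : κ * Q ≤ C₁ * (P + e) + u * r) (hB : lam * P ≤ x * (C₂ * (P + Q + e)) + v * r)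
    (hgain : x * C₂ * (1 + C₁ / κ) ≤ lam / 2) :
    P ≤ e + 2 * (v + x * C₂ * (u / κ)) / lam * r ∧
      Q ≤ C₁ / κ * (2 * e) + (C₁ / κ * (2 * (v + x * C₂ * (u / κ)) / lam) + u / κ) * r := by
  have hQ : Q ≤ C₁ / κ * (P + e) + u / κ * r := by
    have : Q ≤ (C₁ * (P + e) + u * r) / κ := by rwa [le_div_iff₀ hκ, mul_comm]
    refine this.trans_eq ?_
    ring
  have h1 := mul_le_mul_of_nonneg_left hQ (mul_nonneg hx hC₂)
  have h2 := mul_le_mul_of_nonneg_right hgain (add_nonneg hP he)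
  -- Once the bound for `Q` is inserted, the coefficient of `P + e` on the right is the feedback
  -- gain, at most `lam / 2`. Half of `lam * P` therefore survives on the left.
  have h3 : P ≤ e + 2 * (v + x * C₂ * (u / κ)) / lam * r := by
    have h4 : lam * P ≤ lam * e + 2 * (v + x * C₂ * (u / κ)) * r := by linarith
    have h5 : P ≤ (lam * e + 2 * (v + x * C₂ * (u / κ)) * r) / lam := by
      rwa [le_div_iff₀ hlam, mul_comm]
    refine h5.trans_eq ?_
    field_simp
  refine ⟨h3, hQ.trans ?_⟩
  have h4 := mul_le_mul_of_nonneg_left h3 (div_nonneg hC₁ hκ.le)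
  linarith

namespace Trajectory.IsRun

open ParamMDP

variable {St Ac : Type*} [MeasurableSpace St] [MeasurableSpace Ac] {m k d : ℕ}
  {M : ParamMDP St Ac m k d} {R L S C D lam : ℝ} {Ω : Type*} [MeasurableSpace Ω]
  {X : Trajectory Ω St Ac m k d} {Pr : Measure Ω} [IsProbabilityMeasure Pr]
  {𝓕 : Filtration ℕ (inferInstance : MeasurableSpace Ω)} {ηθ ηω ηφ : ℕ → ℝ}
  {h : ℕ → Ω → Euc k} {cθ cω cφ Cφ : ℝ}
  (hX : X.IsRun M Pr 𝓕 ηθ ηω R) (hR : 0 ≤ R)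
  (hS : Steps X Pr ηθ ηω ηφ h cθ cω cφ Cφ) (hM : M.Regular lam L S C D)

/-- Constant in the bound of the accumulated Markovian noise of a function with bound `B` and
modulus `Λ`, for steps of size `K`. -/
def noiseConst (γ L K B Λ : ℝ) : ℝ :=
  2 * (B / (1 - γ)) + 3 * (|(Λ + polLip L * (B / (1 - γ))) / (1 - γ)| * K)

/-- Constant in the accumulated actor recursion. -/
def actorConst (γ L S C D R cθ cω cφ Cφ : ℝ) : ℝ :=
  noiseConst γ L (stepBound L C R cθ cω cφ Cφ) (dirBound L C R * gradBound γ L C)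
      (dirBound L C R * gradMod γ L S C D + dirMod L S C D R * gradBound γ L C)
    + (3 * secondOrder C R Cφ (actorTdCoeff γ L S C cθ) (actorDriftCoeff γ D cφ)
      + 2 * ((1 - γ)⁻¹ * C)) / cθ

/-- Constant in the accumulated critic recursion. -/
def criticConst (γ lam L S C D R cθ cω cφ Cφ : ℝ) : ℝ :=
  noiseConst γ L (stepBound L C R cθ cω cφ Cφ) (critNoiseBound lam C R)
      (critNoiseMod γ lam L C D R)
    + cθ / cω * noiseConst γ L (stepBound L C R cθ cω cφ Cφ)
      (dirBound L C R * (starLip γ lam L C * errBound lam C R))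
      (dirBound L C R * (starLip γ lam L C * errMod γ lam L C D
        + holder (starQuad γ lam L S C) (D / lam) * errBound lam C R)
        + dirMod L S C D R * (starLip γ lam L C * errBound lam C R))
    + (3 / 2 * secondOrder C R Cφ (criticTdCoeff γ lam L S C R cθ cω)
      (criticDriftCoeff lam C D R cφ) + errBound lam C R ^ 2) / cω

include hX hR hS hM

theorem abs_sum_noise_le_sqrt {f : M.Par R → St → ℝ} {B Λ : ℝ} (hf : M.Regularity f B Λ)
    {a b : ℕ} (ha : 1 ≤ a) (hab : a ≤ b) :
    |∑ t ∈ Finset.Ico a b, (∫ w, f (hX.par hR t w) (X.s t w) ∂Pr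
      - ∫ w, M.mean f (hX.par hR t w) ∂Pr)|
      ≤ noiseConst M.γ L (stepBound L C R cθ cω cφ Cφ) B Λ * √(b : ℝ) := by
  have hL := hM.L_nonneg
  have hcθ := hS.cθ_pos.le
  have hcω := hS.cω_pos.le
  have hcφ := hS.cφ_nonneg
  have hγ := M.one_sub_gamma_pos
  have hs : 0 ≤ stepBound L C R cθ cω cφ Cφ := by unfold stepBound tdBound; positivity
  obtain ⟨w₀⟩ : Nonempty Ω := nonempty_of_isProbabilityMeasure Pr
  have hB : 0 ≤ B := (norm_nonneg _).trans ((hf.meas (hX.par hR 0 w₀)).bound (X.s 0 w₀))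
  have hb : 1 ≤ √(b : ℝ) := Real.one_le_sqrt.2 (by exact_mod_cast ha.trans hab)
  refine (hX.abs_sum_noise_le hR hS hM hf ha hab).trans ?_
  have h1 : 2 * (B / (1 - M.γ)) ≤ 2 * (B / (1 - M.γ)) * √(b : ℝ) :=
    le_mul_of_one_le_right (by positivity) hb
  have h2 := mul_le_mul_of_nonneg_left (sum_inv_sqrt_le hab) (mul_nonneg
    (abs_nonneg ((Λ + polLip L * (B / (1 - M.γ))) / (1 - M.γ))) hs)
  unfold noiseConst
  linarith

/-- The accumulated actor recursion. -/
theorem sum_actor_le {a b : ℕ} (ha : 1 ≤ a) (hab : a ≤ b) :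
    (1 - M.γ) / 2 * ∑ t ∈ Finset.Ico a b, ∫ w, ‖M.gradJ (hX.par hR t w)‖ ^ 2 ∂Pr
      ≤ actorCoupling M.γ L * (∑ t ∈ Finset.Ico a b, ∫ w, ‖M.critErr (hX.par hR t w)‖ ^ 2 ∂Pr
          + (b - a : ℕ) * M.approxError ^ 2)
        + actorConst M.γ L S C D R cθ cω cφ Cφ * √(b : ℝ) := by
  have hcθ := hS.cθ_pos
  have hrec := Finset.sum_le_sum fun t (ht : t ∈ Finset.Ico a b) =>
    hX.actor_recursion hR hS hM (ha.trans (Finset.mem_Ico.1 ht).1)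
  have hj : ∀ t, |∫ w, M.J (X.φ t w) (X.θ t w) ∂Pr| ≤ (1 - M.γ)⁻¹ * C := fun t =>
    (norm_integral_le_of_norm_le_const (μ := Pr)
      (ae_of_all _ fun w => (parLip_J hM).bound (hX.par hR t w))).trans_eq (by simp)
  have habel := (abs_le.1 (abs_sum_sqrt_mul_sub_le hj hab)).2
  have hnoise := (abs_le.1 (hX.abs_sum_noise_le_sqrt hR hS hM (regularity_actorNoise hM hR)
    ha hab)).1
  rw [Finset.sum_sub_distrib, ← Finset.sum_mul, ← Finset.mul_sum, Finset.sum_add_distrib,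
    Finset.sum_sub_distrib, ← Finset.mul_sum, ← Finset.mul_sum, Finset.sum_add_distrib,
    Finset.sum_const, Nat.card_Ico, nsmul_eq_mul] at hrec
  set N := ∑ t ∈ Finset.Ico a b, (∫ w, M.actorNoise (hX.par hR t w) (X.s t w) ∂Pr
          - ∫ w, M.mean M.actorNoise (hX.par hR t w) ∂Pr)
  set A₀ := ∑ t ∈ Finset.Ico a b, ∫ w, ‖M.gradJ (hX.par hR t w)‖ ^ 2 ∂Pr
  set B₀ := ∑ t ∈ Finset.Ico a b, ∫ w, ‖M.critErr (hX.par hR t w)‖ ^ 2 ∂Pr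
  set K₀ := secondOrder C R Cφ (actorTdCoeff M.γ L S C cθ) (actorDriftCoeff M.γ D cφ) with hK₀
  have hK : 0 ≤ K₀ := secondOrder_nonneg (hM.actorTdCoeff_nonneg hX.nonempty_rewardSet cθ)
    (hM.actorDriftCoeff_nonneg hS.cφ_nonneg)
  have h1 := mul_le_mul_of_nonneg_right (sum_inv_sqrt_le hab) hK
  have h2 : cθ * ((1 - M.γ) / 2 * A₀) ≤ cθ * (actorCoupling M.γ L * (B₀
      + (b - a : ℕ) * M.approxError ^ 2) - N) + (3 * K₀ + 2 * ((1 - M.γ)⁻¹ * C)) * √(b : ℝ) := by linarith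
  have h3 : (1 - M.γ) / 2 * A₀ ≤ actorCoupling M.γ L * (B₀
      + (b - a : ℕ) * M.approxError ^ 2) - N + (3 * K₀ + 2 * ((1 - M.γ)⁻¹ * C)) / cθ * √(b : ℝ) := by
    rw [← mul_le_mul_iff_right₀ hcθ]
    refine h2.trans_eq ?_
    field_simp
  unfold actorConst
  linarith

/-- The accumulated critic recursion. -/
theorem sum_critic_le (hstar : ∀ φ ∈ M.rewardSet, ∀ θ, ‖M.omegaStar φ θ‖ ≤ R) {a b : ℕ}
    (ha : 1 ≤ a) (hab : a ≤ b) :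
    lam * ∑ t ∈ Finset.Ico a b, ∫ w, ‖M.critErr (hX.par hR t w)‖ ^ 2 ∂Pr
      ≤ cθ / cω * (critCoupling M.γ lam L C
          * (∑ t ∈ Finset.Ico a b, ∫ w, ‖M.critErr (hX.par hR t w)‖ ^ 2 ∂Pr
          + ∑ t ∈ Finset.Ico a b, ∫ w, ‖M.gradJ (hX.par hR t w)‖ ^ 2 ∂Pr
          + (b - a : ℕ) * M.approxError ^ 2))
        + criticConst M.γ lam L S C D R cθ cω cφ Cφ * √(b : ℝ) := by
  have hcθ := hS.cθ_pos
  have hcω := hS.cω_pos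
  have hrec := Finset.sum_le_sum fun t (ht : t ∈ Finset.Ico a b) =>
    hX.critic_recursion hR hS hM hstar (ha.trans (Finset.mem_Ico.1 ht).1)
  have hj : ∀ t, |∫ w, ‖M.critErr (hX.par hR t w)‖ ^ 2 ∂Pr| ≤ errBound lam C R ^ 2 := fun t => by
    simpa using norm_integral_le_of_norm_le_const (μ := Pr) (C := errBound lam C R ^ 2)
      (f := fun w => ‖M.critErr (hX.par hR t w)‖ ^ 2)
      (ae_of_all _ fun w => by
        rw [norm_pow, norm_norm]; gcongr; exact (parLip_critErr hM).bound (hX.par hR t w))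
  have habel := (abs_le.1 (abs_sum_sqrt_mul_sub_le hj hab)).1
  have hn1 := (abs_le.1 (hX.abs_sum_noise_le_sqrt hR hS hM (regularity_critNoise hM) ha hab)).2
  have hn2 := (abs_le.1 (hX.abs_sum_noise_le_sqrt hR hS hM (regularity_starNoise hM hR) ha hab)).1
  simp only [Finset.sum_add_distrib, Finset.sum_sub_distrib, ← Finset.mul_sum, ← Finset.sum_mul,
    Finset.sum_const, Nat.card_Ico, nsmul_eq_mul] at hrec hn1 hn2
  set N₁ := ∑ t ∈ Finset.Ico a b, ∫ w, M.critNoise (hX.par hR t w) (X.s t w) ∂Pr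
    - ∑ t ∈ Finset.Ico a b, ∫ w, M.mean M.critNoise (hX.par hR t w) ∂Pr
  set N₂ := ∑ t ∈ Finset.Ico a b, ∫ w, M.starNoise (hX.par hR t w) (X.s t w) ∂Pr
    - ∑ t ∈ Finset.Ico a b, ∫ w, M.mean M.starNoise (hX.par hR t w) ∂Pr
  set A₀ := ∑ t ∈ Finset.Ico a b, ∫ w, ‖M.gradJ (hX.par hR t w)‖ ^ 2 ∂Pr
  set B₀ := ∑ t ∈ Finset.Ico a b, ∫ w, ‖M.critErr (hX.par hR t w)‖ ^ 2 ∂Pr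
  set K₀ := secondOrder C R Cφ (criticTdCoeff M.γ lam L S C R cθ cω)
    (criticDriftCoeff lam C D R cφ) with hK₀
  have hK : 0 ≤ K₀ := secondOrder_nonneg (hM.criticTdCoeff_nonneg hX.nonempty_rewardSet hR cθ cω)
    (hM.criticDriftCoeff_nonneg hR hS.cφ_nonneg)
  have h1 := mul_le_mul_of_nonneg_right (sum_inv_sqrt_le hab) hK
  set G := critCoupling M.γ lam L C * (B₀ + A₀ + (b - a : ℕ) * M.approxError ^ 2) with hG
  have h2 : cω * (lam * B₀) ≤ cω * N₁ + cθ * (G - N₂)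
      + (3 / 2 * K₀ + errBound lam C R ^ 2) * √(b : ℝ) := by linarith
  have h3 : lam * B₀ ≤ N₁ + cθ / cω * (G - N₂)
      + (3 / 2 * K₀ + errBound lam C R ^ 2) / cω * √(b : ℝ) := by
    rw [← mul_le_mul_iff_right₀ hcω]
    refine h2.trans_eq ?_
    field_simp
  have h4 := mul_le_mul_of_nonneg_left hn2 (div_pos hcθ hcω).le
  unfold criticConst
  linarith

/-- Growth constant of the accumulated critic error. -/
def criticGrowth (γ lam L S C D R cθ cω cφ Cφ : ℝ) : ℝ :=
  2 * (criticConst γ lam L S C D R cθ cω cφ Cφ + cθ / cω * critCoupling γ lam L C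
    * (actorConst γ L S C D R cθ cω cφ Cφ / ((1 - γ) / 2))) / lam

/-- Growth constant of the accumulated actor error. -/
def actorGrowth (γ lam L S C D R cθ cω cφ Cφ : ℝ) : ℝ :=
  actorCoupling γ L / ((1 - γ) / 2) * criticGrowth γ lam L S C D R cθ cω cφ Cφ
    + actorConst γ L S C D R cθ cω cφ Cφ / ((1 - γ) / 2)

/-- The constant in the error bounds. -/
def errorConst (γ lam L S C D R cθ cω cφ Cφ : ℝ) : ℝ :=
  1 + 2 * |criticGrowth γ lam L S C D R cθ cω cφ Cφ|
    + 2 * |actorGrowth γ lam L S C D R cθ cω cφ Cφ|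
    + (2 + 4 * |actorCoupling γ L / ((1 - γ) / 2)|) * |C / lam + C / (1 - γ)|
    + 18 * (cφ ^ 2 * Cφ ^ 2)

omit hX hR hS hM in
theorem errorConst_pos (γ lam L S C D R cθ cω cφ Cφ : ℝ) :
    0 < errorConst γ lam L S C D R cθ cω cφ Cφ := by
  unfold errorConst; positivity

theorem gradSq_eq (t : ℕ) : X.gradSq M t = fun w => ‖M.gradJ (hX.par hR t w)‖ ^ 2 := rfl

theorem criticSq_eq {t : ℕ} (ht : 1 ≤ t) :
    X.criticSq M t = fun w => ‖M.critErr (hX.par hR t w)‖ ^ 2 := by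
  funext w
  unfold criticSq critErr
  rw [← hX.ballProj_omega hR ht]
  rfl

omit hX hR hM in
theorem rewardSq_eq {t : ℕ} (ht : 1 ≤ t) :
    X.rewardSq t = fun w => (cφ / t) ^ 2 * ‖h t w‖ ^ 2 := by
  funext w
  unfold rewardSq
  rw [norm_phi_sub_eq hS ht, mul_pow]

omit hX hR hM in
-- Steps of size `1/t` in fact give decay of order `T⁻²`; one factor is given away.
theorem rewardVariation_le {T : ℕ} (hT : 2 ≤ T) :
    X.rewardVariation Pr T ≤ 18 * (cφ ^ 2 * Cφ ^ 2) / T := by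
  have hT' : (2 : ℝ) ≤ T := by exact_mod_cast hT
  have h1 : ∀ t ∈ Finset.Ico (T / 2) T, ∫ w, X.rewardSq t w ∂Pr ≤ 9 * (cφ ^ 2 * Cφ ^ 2) / T ^ 2 := by
    intro t ht
    have ht1 : 1 ≤ t := by have := (Finset.mem_Ico.1 ht).1; lia
    -- The rounded-down half of `T` is at least `T / 3` when `T ≥ 2`, with equality at `T = 3`;
    -- hence the factor `9`.
    have ht3 : (T : ℝ) ≤ 3 * t := by
      have : T ≤ 3 * t := by have := (Finset.mem_Ico.1 ht).1; lia
      exact_mod_cast this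
    have ht0 : (0 : ℝ) < t := by exact_mod_cast ht1
    rw [rewardSq_eq hS ht1, integral_const_mul]
    calc _ ≤ (cφ / t) ^ 2 * Cφ ^ 2 := by gcongr; exact hS.bound t
      _ = 9 * (cφ ^ 2 * Cφ ^ 2) / (3 * t) ^ 2 := by field_simp; norm_num
      _ ≤ _ := by gcongr
  have h2 := Finset.sum_le_sum h1
  rw [Finset.sum_const, Nat.card_Ico, nsmul_eq_mul] at h2
  have h3 : ((T - T / 2 : ℕ) : ℝ) ≤ T := by exact_mod_cast Nat.sub_le _ _
  unfold rewardVariation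
  calc _ ≤ 1 / ((T : ℝ) / 2) * (T * (9 * (cφ ^ 2 * Cφ ^ 2) / T ^ 2)) := by
        gcongr
        refine h2.trans ?_
        gcongr
    _ = 18 * (cφ ^ 2 * Cφ ^ 2) / T / T := by field_simp; ring
    _ ≤ _ * 1 := by
        have : (T : ℝ)⁻¹ ≤ 1 := inv_le_one_of_one_le₀ (by linarith)
        rw [div_eq_mul_inv _ (T : ℝ)]
        rw [div_eq_mul_inv _ (T : ℝ)]
        gcongr
    _ = _ := mul_one _

/-- The accumulated recursions are solved by `coupled_bound` with `r = √T` and `e` the number of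
summands times `ε²`; normalising by `T / 2` turns `√T` into `2 / √T`. -/
theorem errors_le (hstar : ∀ φ ∈ M.rewardSet, ∀ θ, ‖M.omegaStar φ θ‖ ≤ R)
    (hgain : cθ / cω * critCoupling M.γ lam L C * (1 + actorCoupling M.γ L / ((1 - M.γ) / 2))
      ≤ lam / 2) {T : ℕ} (hT : 2 ≤ T) :
    X.rewardVariation Pr T ≤ errorConst M.γ lam L S C D R cθ cω cφ Cφ / T ∧
    X.actorError M Pr T ≤ errorConst M.γ lam L S C D R cθ cω cφ Cφ / √(T : ℝ)
      + errorConst M.γ lam L S C D R cθ cω cφ Cφ * M.approxError ∧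
    X.criticError M Pr T ≤ errorConst M.γ lam L S C D R cθ cω cφ Cφ / √(T : ℝ)
      + errorConst M.γ lam L S C D R cθ cω cφ Cφ * M.approxError := by
  have hγ := M.one_sub_gamma_pos
  have hlam := hM.lam_pos
  have hcθ := hS.cθ_pos
  have hcω := hS.cω_pos
  have hL := hM.L_nonneg
  have hT' : (2 : ℝ) ≤ T := by exact_mod_cast hT
  -- All summation times are at least one, where the step sizes are prescribed and the critic lies
  -- in the ball.
  have ha : 1 ≤ T / 2 := by lia
  have hab : T / 2 ≤ T := Nat.div_le_self _ _
  have hA := hX.sum_actor_le hR hS hM ha hab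
  have hB := hX.sum_critic_le hR hS hM hstar ha hab
  have hC₁ : 0 ≤ actorCoupling M.γ L := by unfold actorCoupling; positivity
  have hC₂ : 0 ≤ critCoupling M.γ lam L C := by
    have := hM.starLip_nonneg hX.nonempty_rewardSet
    unfold critCoupling; positivity
  have hε := approxError_nonneg M
  obtain ⟨hP, hQ⟩ := coupled_bound (by positivity) hlam hC₁ hC₂ (div_pos hcθ hcω).le
    (Finset.sum_nonneg fun t _ => integral_nonneg fun w => sq_nonneg _) (by positivity) hA hB hgain
  have eP : ∑ t ∈ Finset.Ico (T / 2) T, ∫ w, X.criticSq M t w ∂Pr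
      = ∑ t ∈ Finset.Ico (T / 2) T, ∫ w, ‖M.critErr (hX.par hR t w)‖ ^ 2 ∂Pr :=
    Finset.sum_congr rfl fun t ht => by
      rw [hX.criticSq_eq hR hS hM (ha.trans (Finset.mem_Ico.1 ht).1)]
  rw [← eP] at hP
  have hn : ((T - T / 2 : ℕ) : ℝ) ≤ T := by exact_mod_cast Nat.sub_le _ _
  -- The recursions produce `ε²`; one factor `ε` is replaced by its a priori bound.
  have hε2 : M.approxError ^ 2 ≤ |C / lam + C / (1 - M.γ)| * M.approxError := by
    rw [sq]; gcongr; exact (approxError_le hM).trans (le_abs_self _)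
  have hs : 0 < √(T : ℝ) := Real.sqrt_pos.2 (by linarith)
  have hss : √(T : ℝ) * √(T : ℝ) = T := Real.mul_self_sqrt (by linarith)
  have hnε : ((T - T / 2 : ℕ) : ℝ) * M.approxError ^ 2
      ≤ T * (|C / lam + C / (1 - M.γ)| * M.approxError) :=
    mul_le_mul hn hε2 (sq_nonneg _) (by positivity)
  have scale : ∀ {Z g c : ℝ}, 0 ≤ c → Z ≤ c * (T * (|C / lam + C / (1 - M.γ)| * M.approxError))
      + g * √(T : ℝ) → 1 / ((T : ℝ) / 2) * Z ≤ 2 * |g| / √(T : ℝ)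
        + 2 * c * |C / lam + C / (1 - M.γ)| * M.approxError := by
    intro Z g c hc hZ
    calc _ ≤ 1 / ((T : ℝ) / 2) * (c * (T * (|C / lam + C / (1 - M.γ)| * M.approxError))
          + |g| * √(T : ℝ)) := by
          gcongr
          refine hZ.trans ?_
          gcongr
          exact le_abs_self g
      _ = _ := by
          generalize √(T : ℝ) = q at hs hss ⊢
          rw [← hss]
          field_simp
          ring
  set c₀ := |C / lam + C / (1 - M.γ)| with hc₀
  set κ₁ := actorCoupling M.γ L / ((1 - M.γ) / 2) with hκ₁
  have hκ₁0 : 0 ≤ κ₁ := by positivity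
  have hW := scale (c := 1) zero_le_one (hP.trans (add_le_add_left (hnε.trans_eq (one_mul _).symm) _))
  have hG := scale (c := 2 * κ₁) (Z := ∑ t ∈ Finset.Ico (T / 2) T, ∫ w, X.gradSq M t w ∂Pr)
    (by positivity) (hQ.trans (add_le_add_left
    ((mul_le_mul_of_nonneg_left (mul_le_mul_of_nonneg_left hnε zero_le_two) hκ₁0).trans_eq
      (by ring)) _))
  change _ ≤ 2 * |criticGrowth M.γ lam L S C D R cθ cω cφ Cφ| / √(T : ℝ) + _ at hW
  change _ ≤ 2 * |actorGrowth M.γ lam L S C D R cθ cω cφ Cφ| / √(T : ℝ) + _ at hG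
  have hK : errorConst M.γ lam L S C D R cθ cω cφ Cφ
      = 1 + 2 * |criticGrowth M.γ lam L S C D R cθ cω cφ Cφ|
      + 2 * |actorGrowth M.γ lam L S C D R cθ cω cφ Cφ| + (2 + 4 * κ₁) * c₀
      + 18 * (cφ ^ 2 * Cφ ^ 2) := by
    rw [errorConst, ← hκ₁, abs_of_nonneg hκ₁0]
  set g₁ := |criticGrowth M.γ lam L S C D R cθ cω cφ Cφ|
  set g₂ := |actorGrowth M.γ lam L S C D R cθ cω cφ Cφ|
  have hg₁ : 0 ≤ g₁ := abs_nonneg _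
  have hg₂ : 0 ≤ g₂ := abs_nonneg _
  have hc₀' : 0 ≤ c₀ := abs_nonneg _
  have hx : 0 ≤ 18 * (cφ ^ 2 * Cφ ^ 2) := by positivity
  have hy : 0 ≤ κ₁ * c₀ := by positivity
  rw [hK]
  refine ⟨(rewardVariation_le hS hT).trans ?_, hG.trans ?_, hW.trans ?_⟩ <;> gcongr <;> linarith

end Trajectory.IsRun

end

/-! ### Choice of the regularity constants and conclusion. -/

theorem corollary1 (γ lam L S C D : ℝ) (hγ0 : 0 < γ) (hγ1 : γ < 1) (hlam : 0 < lam)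
    (hL : 0 < L) (hS : 0 < S) (hC : 0 < C) (hD : 0 < D) :
    -- the regularity constants of `ω*`
    ∃ Lω > 0, ∃ Sω > 0,
      (∀ (St : Type u) (Ac : Type v) [MeasurableSpace St] [MeasurableSpace Ac] (m k d : ℕ)
        (M : ParamMDP St Ac m k d), M.γ = γ → M.SufficientExploration lam →
        M.LipschitzPolicy L S → M.LipschitzReward L S C D → ∀ φ ∈ M.rewardSet,
          (∀ θ, ‖M.omegaStar φ θ‖ ≤ C / lam) ∧
          (∀ θ θ', ‖M.omegaStar φ θ - M.omegaStar φ θ'‖ ≤ Lω * ‖θ - θ'‖) ∧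
          Differentiable ℝ (M.omegaStar φ) ∧
          (∀ θ θ', ‖fderiv ℝ (M.omegaStar φ) θ - fderiv ℝ (M.omegaStar φ) θ'‖
            ≤ Sω * ‖θ - θ'‖)) ∧
      -- the step size constants, the bound on `h`, the projection radius
      ∀ cθ cω cφ Cφ Cω : ℝ, 0 < cθ → 0 < cω → 0 ≤ cφ → 0 ≤ Cφ → 0 ≤ Cω →
        cθ / cω ≤ min (lam / (L * Sω)) (1 / (16 * L * Lω)) →
        ∃ K > 0, ∀ (St : Type u) (Ac : Type v) [MeasurableSpace St] [MeasurableSpace Ac]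
          (m k d : ℕ) (M : ParamMDP St Ac m k d), M.γ = γ → M.SufficientExploration lam →
          M.LipschitzPolicy L S → M.LipschitzReward L S C D →
          (∀ φ ∈ M.rewardSet, ∀ θ, ‖M.omegaStar φ θ‖ ≤ Cω) →
          ∀ (Ω : Type z) [MeasurableSpace Ω] (Pr : MeasureTheory.Measure Ω)
            [MeasureTheory.IsProbabilityMeasure Pr]
            (𝓕 : MeasureTheory.Filtration ℕ (inferInstance : MeasurableSpace Ω))
            (X : Trajectory Ω St Ac m k d) (ηθ ηω ηφ : ℕ → ℝ) (h : ℕ → Ω → Euc k),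
            (∀ t : ℕ, 1 ≤ t → ηθ t = cθ / √(t : ℝ)) →
            (∀ t : ℕ, 1 ≤ t → ηω t = cω / √(t : ℝ)) →
            (∀ t : ℕ, 1 ≤ t → ηφ t = cφ / (t : ℝ)) →
            X.IsRun M Pr 𝓕 ηθ ηω Cω →
            (∀ t w, X.φ (t + 1) w = X.φ t w + ηφ t • h t w) →
            (∀ t, MeasureTheory.MemLp (h t) 2 Pr) →
            (∀ t, ∫ w, ‖h t w‖ ^ 2 ∂Pr ≤ Cφ ^ 2) →
            -- the quantities below are meaningful
            (∀ φ ∈ M.rewardSet, Differentiable ℝ (M.J φ)) ∧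
            (∀ t : ℕ, 1 ≤ t → MeasureTheory.Integrable (X.gradSq M t) Pr ∧
              MeasureTheory.Integrable (X.criticSq M t) Pr ∧
              MeasureTheory.Integrable (X.rewardSq t) Pr) ∧
            -- the bounds
            ∀ T : ℕ, 2 ≤ T →
              X.rewardVariation Pr T ≤ K / T ∧
              X.actorError M Pr T ≤ K / √(T : ℝ) + K * M.approxError ∧
              X.criticError M Pr T ≤ K / √(T : ℝ) + K * M.approxError := by
  have hγ' : 0 < 1 - γ := sub_pos.2 hγ1
  have hκ : 0 ≤ ParamMDP.actorCoupling γ L / ((1 - γ) / 2) := by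
    unfold ParamMDP.actorCoupling; positivity
  set a := 1 + ParamMDP.actorCoupling γ L / ((1 - γ) / 2) with ha
  -- The constants are fixed before any decision process is given; absolute values make them
  -- nonnegative without one.
  set l := |ParamMDP.starLip γ lam L C| with hl
  have hl0 : 0 ≤ l := abs_nonneg _
  have hsl : ParamMDP.starLip γ lam L C ≤ l := le_abs_self _
  set q := 6 * |ParamMDP.starQuad γ lam L S C| + 1 with hq
  have hgain0 : 0 ≤ l * (1 + 2 * L) * a := by positivity
  -- A Lipschitz constant may be enlarged. Write `G` for `l * (1 + 2 * L) * a`. The summand `G / (8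
  -- * L * lam)` is chosen so that `16 * L` times it is `2 * G / lam`. Then `cθ / cω ≤ 1 / (16 * L *
  -- Lω)` forces `cθ / cω * G ≤ lam / 2`, the gain condition of `coupled_bound`. The final `1`
  -- ensures positivity. The factor `6` in `q` comes from `QuadApprox.deriv_sub_le`.
  refine ⟨l + l * (1 + 2 * L) * a / (8 * L * lam) + 1, by positivity, q, by positivity, ?_, ?_⟩
  · intro St Ac _ _ m k d M hγM hA hp hr φ hφ
    subst hγM
    have h := ParamMDP.quadApprox_omegaStar hlam hA hp hL.le hS.le hC.le hr hφ
    refine ⟨ParamMDP.norm_omegaStar_le hlam hA hr hφ, fun θ θ' => ?_,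
      fun θ => (h.hasFDerivAt θ).differentiableAt, fun θ θ' => ?_⟩
    · refine (h.norm_sub_le (ParamMDP.norm_starDeriv_le hlam hA hp hL.le hS.le hC.le hr hφ)
        θ' θ).trans ?_
      gcongr
      have : 0 ≤ l * (1 + 2 * L) * a / (8 * L * lam) := by positivity
      linarith
    · rw [(h.hasFDerivAt θ).fderiv, (h.hasFDerivAt θ').fderiv]
      refine (h.deriv_sub_le θ' θ).trans ?_
      gcongr
      rw [hq]
      linarith [le_abs_self (ParamMDP.starQuad M.γ lam L S C)]
  · intro cθ cω cφ Cφ Cω hcθ hcω hcφ _ hCω hstep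
    refine ⟨Trajectory.IsRun.errorConst γ lam L S C D Cω cθ cω cφ Cφ,
      Trajectory.IsRun.errorConst_pos .., ?_⟩
    intro St Ac _ _ m k d M hγM hA hp hr hstar Ω _ Pr _ 𝓕 X ηθ ηω ηφ h hηθ hηω hηφ hX hφ hh hhC
    subst hγM
    have hM : M.Regular lam L S C D :=
      ⟨hlam, hL.le, hS.le, hC.le, hD.le, hA, hp, hr⟩
    have hSt : Trajectory.IsRun.Steps X Pr ηθ ηω ηφ h cθ cω cφ Cφ :=
      ⟨hcθ, hcω, hcφ, hηθ, hηω, hηφ, hφ, hh, hhC⟩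
    have hgain : cθ / cω * ParamMDP.critCoupling M.γ lam L C
        * (1 + ParamMDP.actorCoupling M.γ L / ((1 - M.γ) / 2)) ≤ lam / 2 := by
      have h1 := hstep.trans (min_le_right _ _)
      have h2 : cθ / cω * (l * (1 + 2 * L) * a) ≤ lam / 2 := by
        calc _ ≤ 1 / (16 * L * (l * (1 + 2 * L) * a / (8 * L * lam) + 1))
              * (l * (1 + 2 * L) * a) := by
              refine mul_le_mul_of_nonneg_right (h1.trans ?_) hgain0
              gcongr
              linarith
          _ ≤ lam / 2 := by
              rw [one_div_mul_eq_div, div_le_iff₀ (by positivity)]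
              field_simp
              nlinarith [mul_pos hL hlam]
      refine le_trans ?_ h2
      rw [mul_assoc]
      unfold ParamMDP.critCoupling
      gcongr
    refine ⟨fun φ hφ => ParamMDP.differentiable_J hp hL.le hS.le hC.le hr hφ, fun t ht => ⟨?_, ?_, ?_⟩,
      fun T hT => hX.errors_le hCω hSt hM hstar hgain hT⟩
    · rw [hX.gradSq_eq hCω hSt hM]
      exact hX.integrable_gradJ_sq hCω hM t
    · rw [hX.criticSq_eq hCω hSt hM ht]
      exact hX.integrable_critErr_sq hCω hM t
    · rw [Trajectory.IsRun.rewardSq_eq hSt ht]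
      exact (Trajectory.IsRun.integrable_norm_sq hSt t).const_mul _
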